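/- **Setting.** Let $(N^{2m+1},g)$ be a (smooth, Hausdorff) Riemannian manifold with Levi-Civita connection $\widehat{\overline\nabla}$ and curvature tensor $\widehat{\overline R}$, where for a connection $D$ we put $R^D(X,Y)Z=D_XD_YZ-D_YD_XZ-D_{[X,Y]}Z$ and $R^D(X,Y,Z,W)=g(R^D(X,Y)Z,W)$. Suppose that $N$ is a $(\kappa,\mu)$-contact space form $N(c)$, where $\kappa,\mu,c\in\mathbb R$. This means that there are a smooth $(1,1)$-tensor field $\varphi$, a smooth vector field $\xi$ and a $1$-form $\eta$ with $$\varphi^2X=-X+\eta(X)\xi,\quad \eta(\xi)=1,\quad \varphi\xi=0,\quad \eta\circ\varphi=0,\quad g(X,\varphi Y)=-g(\varphi X,Y),\quad g(X,\xi)=\eta(X),$$ and $d\eta(X,Y)=g(X,\varphi Y)$, with the convention $2\,d\eta(X,Y)=X\eta(Y)-Y\eta(X)-\eta([X,Y])$; that, with $h'=\frac12 L_\xi\varphi$, $$\widehat{\overline R}(X,Y)\xi=\kappa[\eta(Y)X-\eta(X)Y]+\mu[\eta(Y)h'X-\eta(X)h'Y];$$ and that $\widehat{\overline R}(X,\varphi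 X,\varphi X,X)=c$ for every unit tangent vector $X$ orthogonal to $\xi$. Let $P$ be a smooth vector field on $N$, $\pi=g(P,\cdot)$, $\lambda_1,\lambda_2\in\mathbb R$, and let $$\overline\nabla_XY=\widehat{\overline\nabla}_XY+\lambda_1\pi(Y)X-\lambda_2g(X,Y)P .$$ Let $M^n$, $n\ge3$, be an $n$-dimensional (immersed) submanifold of $N$ with the induced metric, and $p=2m+1-n$ its codimension. The induced connection $\nabla$ and the form $h$ are the tangential and normal parts in $\overline\nabla_XY=\nabla_XY+h(X,Y)$ for $X,Y$ tangent to $M$; the usual second fundamental form $\widehat h$ is the normal part of $\widehat{\overline\nabla}_XY$. With $R$ the curvature of $\nabla$ and $e_1,e_2$ an orthonormal basis of a plane $\Pi\subset T_xM$, put $K(\Pi)=\frac12[R(e_1,e_2,e_2,e_1)-R(e_1,e_2,e_1,e_2)]$, and $\tau(x)=\sum_{i<j}K(e_i\wedge e_j)$ for an orthonormal basis $e_1,\dots,e_n$ of $T_xM$. Put $H=\frac1n\sum_ih(e_i,e_i)$. For a normal vector $\nu$ the shape operator $A_\nu$ is given by $g(A_\nu X,Y)=g(h(X,Y),\nu)$.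 *Notation.* $\top$ denotes the part tangent to $M$; $\widehat PX=(\varphi X)^\top$, and $(h')^\top X=(h'X)^\top$, $(\varphi h')^\top X=(\varphi h'X)^\top$ for $X\in T_xM$; $\|\vartheta\|^2=\sum_{i,j}g(e_i,\vartheta e_j)^2$ for $\vartheta\in\{\widehat P,(h')^\top,(\varphi h')^\top\}$; $$\alpha(X,Y)=(\widehat{\overline\nabla}_X\pi)(Y)-\lambda_1\pi(X)\pi(Y)+\tfrac{\lambda_2}2g(X,Y)\pi(P),\qquad \beta(X,Y)=\tfrac{\pi(P)}2g(X,Y)+\pi(X)\pi(Y).$$ For a plane $\Pi\subset T_xM$ with orthonormal basis $e_1,e_2$ let $\beta(\Pi)=g(\widehat Pe_1,e_2)^2$, $\gamma(\Pi)=\eta(e_1)^2+\eta(e_2)^2$ and $$\theta(\Pi)=\eta(e_1)^2g((h')^\top e_2,e_2)+\eta(e_2)^2g((h')^\top e_1,e_1)-2\eta(e_1)\eta(e_2)g((h')^\top e_1,e_2).$$ Traces ${\rm tr}_M$ of $\alpha,\beta$ are taken over $T_xM$, and ${\rm tr}(\cdot|_\Pi)$, $\det(\cdot|_\Pi)$ are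 the trace and determinant of the $2\times2$ matrix with respect to $e_1,e_2$ (of $g(e_i,\vartheta e_j)$ for an operator $\vartheta$; ${\rm tr}(h|_\Pi)=h(e_1,e_1)+h(e_2,e_2)$). For $x\in M$ and a plane $\Pi\subset T_xM$, Chen's inequality is $$\begin{aligned} \tau(x)-K(\Pi)\le{}&\frac{(n+1)(n-2)}2\,\frac{c+3}4+\frac{c+3-4\kappa}4\bigl[-(n-1)\|\xi^\top\|^2+\gamma(\Pi)\bigr]+\frac{c-1}8\bigl[3\|\widehat P\|^2-6\beta(\Pi)\bigr]\\ &+\frac14\bigl[\|(\varphi h')^\top\|^2-\|(h')^\top\|^2+({\rm tr}(h')^\top)^2-({\rm tr}(\varphi h')^\top)^2\bigr]\\ &-\frac12\bigl[\det(h'|_\Pi)-\det((\varphi h')|_\Pi)\bigr]+(n-1){\rm tr}((h')^\top)-{\rm tr}(h'|_\Pi)\\ &+(1-\mu)\bigl[g(\xi^\top,h'\xi^\top)-{\rm tr}((h')^\top)\|\xi^\top\|^2+\theta(\Pi)\bigr]\\ &-\frac{\lambda_1+\lambda_2}2(n-1)\,{\rm tr}_M\alpha-\frac{\lambda_2(\lambda_1-\lambda_2)}2(n-1)\,{\rm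 tr}_M\beta-\frac{\lambda_1-\lambda_2}2(n-1)n\,\pi(H)\\ &+\frac{\lambda_1+\lambda_2}2{\rm tr}(\alpha|_\Pi)+\frac{\lambda_2(\lambda_1-\lambda_2)}2{\rm tr}(\beta|_\Pi)+\frac{\lambda_1-\lambda_2}2g({\rm tr}(h|_\Pi),P)+\frac{n^2(n-2)}{2(n-1)}\|H\|^2. \qquad(\ast) \end{aligned}$$ **Corollary 3.2.** Suppose that $P$ is tangent to $M$ at every point of $M$. Then $h=\widehat h$. Moreover, for every $x\in M$ and every plane $\Pi\subset T_xM$, equality holds in $(\ast)$ if and only if there are an orthonormal basis $e_1,\dots,e_n$ of $T_xM$ with $\Pi={\rm span}\{e_1,e_2\}$ and an orthonormal basis $e_{n+1},\dots,e_{n+p}$ of $T_x^\perp M$ such that, writing $h^r_{ij}=g(h(e_i,e_j),e_r)$, the matrices of the shape operators $A_r=A_{e_r}$ with respect to $e_1,\dots,e_n$ are $$A_{n+1}={\rm diag}\bigl(h^{n+1}_{11},\,h^{n+1}_{22},\,h^{n+1}_{11}+h^{n+1}_{22},\dots,h^{n+1}_{11}+h^{n+1}_{22}\bigr),$$ $$A_r=\begin{pmatrix}h^r_{11}&h^r_{12}&0\\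 h^r_{12}&-h^r_{11}&0\\ 0&0&0_{n-2}\end{pmatrix},\qquad r=n+2,\dots,n+p .$$ (If $p=0$ there are no conditions on shape operators.) -/

import Mathlib

open Bundle Manifold ContDiff

noncomputable section

namespace ChenKappaMu

/-- The model space `ℝᵈ`. -/
abbrev E (d : ℕ) : Type := EuclideanSpace ℝ (Fin d)

/-- The tangent spaces of a `d`-dimensional manifold. -/
abbrev T (d : ℕ) {N : Type*} [TopologicalSpace N] [ChartedSpace (E d) N] (x : N) : Type :=
  TangentSpace (𝓡 d) x

instance {d : ℕ} {N : Type*} [TopologicalSpace N] [ChartedSpace (E d) N] (x : N) :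
    FiniteDimensional ℝ (TangentSpace (𝓡 d) x) :=
  inferInstanceAs (FiniteDimensional ℝ (EuclideanSpace ℝ (Fin d)))

instance {d : ℕ} {N : Type*} [TopologicalSpace N] [ChartedSpace (E d) N] [IsManifold (𝓡 d) ∞ N]
    [RiemannianBundle (fun x : N ↦ TangentSpace (𝓡 d) x)]
    [IsContMDiffRiemannianBundle (𝓡 d) ∞ (E d) (fun x : N ↦ TangentSpace (𝓡 d) x)] :
    IsContMDiffRiemannianBundle (𝓡 d) 1 (E d) (fun x : N ↦ TangentSpace (𝓡 d) x) :=
  .of_le (n := ∞) (by simp)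

/-! ### Connections and curvature -/

section Connections

variable {d : ℕ} {N : Type*} [TopologicalSpace N] [ChartedSpace (E d) N] [IsManifold (𝓡 d) ∞ N]

/-- A local extension of the tangent vector `u` at `x` to a vector field: the field that is constant
in the preferred chart at `x`. -/
def extendField {x : N} (u : T d x) : Π y : N, T d y := FiberBundle.extend (E d) u

/-- The type of a differentiation of vector fields: `D Y x v` stands for `(∇_v Y)(x)`. -/
abbrev Nabla (d : ℕ) (N : Type*) [TopologicalSpace N] [ChartedSpace (E d) N] : Type _ :=
  (Π y : N, T d y) → Π x : N, T d x → T d x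

/-- The curvature `R(u,v)w = ∇_U ∇_V W - ∇_V ∇_U W - ∇_[U,V] W` at `x`, where `U`, `V`, `W` extend
the tangent vectors `u`, `v`, `w`. -/
def curvature (D : Nabla d N) (x : N) (u v w : T d x) : T d x :=
  D (fun y ↦ D (extendField w) y (extendField v y)) x u - D (fun y ↦ D (extendField w) y (extendField u y)) x v
    - D (extendField w) x (VectorField.mlieBracket (𝓡 d) (extendField u) (extendField v) x)

variable [RiemannianBundle (fun x : N ↦ TangentSpace (𝓡 d) x)]

/-- The curvature as a `(0,4)`-tensor, `R(u,v,w,z) = g(R(u,v)w, z)`. -/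
def curvature₄ (D : Nabla d N) (x : N) (u v w z : T d x) : ℝ :=
  inner ℝ (curvature D x u v w) z

/-- `K(u ∧ v) = (R(u,v,v,u) - R(u,v,u,v)) / 2`, for an orthonormal pair `u`, `v`. -/
def sectional (D : Nabla d N) (x : N) (u v : T d x) : ℝ :=
  1 / 2 * (curvature₄ D x u v v u - curvature₄ D x u v u v)

/-- The scalar curvature `τ(x)`: the sum of `K(e_i ∧ e_j)` over `i < j`, for an orthonormal basis
`e` of the tangent space. -/
def scalarCurvature (D : Nabla d N) (x : N) : ℝ :=
  let e := stdOrthonormalBasis ℝ (T d x)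
  ∑ i, ∑ j ∈ Finset.Ioi i, sectional D x (e i) (e j)

/-- Affine connections on `N`. -/
abbrev Connection (d : ℕ) (N : Type*) [TopologicalSpace N] [ChartedSpace (E d) N]
    [IsManifold (𝓡 d) ∞ N] :=
  CovariantDerivative (𝓡 d) (E d) (fun x : N ↦ TangentSpace (𝓡 d) x)

/-- The differentiation of vector fields given by an affine connection. -/
def Connection.nabla (cov : Connection d N) : Nabla d N := fun Y x v ↦ cov Y x v

/-- `cov` is the Levi-Civita connection: the smooth, metric and torsion-free affine connection. -/
structure IsLeviCivita
    [IsContMDiffRiemannianBundle (𝓡 d) ∞ (E d) (fun x : N ↦ TangentSpace (𝓡 d) x)]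
    (cov : Connection d N) : Prop where
  smooth : ∀ s : Set N, IsOpen s → ContMDiffCovariantDerivativeOn (E d) ∞ cov.toFun s
  metric : cov.IsMetricCompatible
  torsion_free : cov.torsion = 0

/-- The first generalized semi-symmetric non-metric connection
`∇̄_v Y = ∇_v Y + λ₁ π(Y) v - λ₂ g(v,Y) P`, with `π = g(P, ·)`. -/
def semiSymmetric (cov : Connection d N) (P : Π x : N, T d x) (lam₁ lam₂ : ℝ) : Nabla d N :=
  fun Y x v ↦ cov Y x v + (lam₁ * inner ℝ (P x) (Y x)) • v - (lam₂ * inner ℝ v (Y x)) • P x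

/-- `(∇_u π)(v) = u(π(V)) - π(∇_u V)` for the one-form `π = g(P, ·)`. -/
def nablaPi (cov : Connection d N) (P : Π x : N, T d x) (x : N) (u v : T d x) : ℝ :=
  mvfderiv (𝓡 d) (fun y ↦ (inner ℝ (P y) (extendField v y) : ℝ)) x u - inner ℝ (P x) (cov (extendField v) x u)

/-- `α(u,v) = (∇_u π)(v) - λ₁ π(u) π(v) + (λ₂/2) g(u,v) π(P)`. -/
def alpha (cov : Connection d N) (P : Π x : N, T d x) (lam₁ lam₂ : ℝ) (x : N) (u v : T d x) : ℝ :=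
  nablaPi cov P x u v - lam₁ * inner ℝ (P x) u * inner ℝ (P x) v
    + lam₂ / 2 * inner ℝ u v * inner ℝ (P x) (P x)

/-- `β(u,v) = (π(P)/2) g(u,v) + π(u) π(v)`. -/
def beta (P : Π x : N, T d x) (x : N) (u v : T d x) : ℝ :=
  inner ℝ (P x) (P x) / 2 * inner ℝ u v + inner ℝ (P x) u * inner ℝ (P x) v

end Connections

/-! ### `(κ, μ)`-contact space forms -/

section Contact

variable {d : ℕ} {N : Type*} [TopologicalSpace N] [ChartedSpace (E d) N] [IsManifold (𝓡 d) ∞ N]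
  [RiemannianBundle (fun x : N ↦ TangentSpace (𝓡 d) x)]

variable (d N) in
/-- An almost contact metric structure `(φ, ξ, η)` on a Riemannian manifold. -/
structure AlmostContactMetric where
  φ : Π x : N, TangentSpace (𝓡 d) x →L[ℝ] TangentSpace (𝓡 d) x
  ξ : Π x : N, TangentSpace (𝓡 d) x
  η : Π x : N, TangentSpace (𝓡 d) x →L[ℝ] ℝ
  smooth_φ : ContMDiff (𝓡 d) ((𝓡 d).prod 𝓘(ℝ, E d →L[ℝ] E d)) ∞
    (fun x ↦ (⟨x, φ x⟩ : TotalSpace (E d →L[ℝ] E d)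
      (fun x : N ↦ TangentSpace (𝓡 d) x →L[ℝ] TangentSpace (𝓡 d) x)))
  smooth_ξ : ContMDiff (𝓡 d) ((𝓡 d).prod 𝓘(ℝ, E d)) ∞
    (fun x ↦ (⟨x, ξ x⟩ : TotalSpace (E d) (fun x : N ↦ TangentSpace (𝓡 d) x)))
  smooth_η : ContMDiff (𝓡 d) ((𝓡 d).prod 𝓘(ℝ, E d →L[ℝ] ℝ)) ∞
    (fun x ↦ (⟨x, η x⟩ : TotalSpace (E d →L[ℝ] ℝ)
      (fun x : N ↦ TangentSpace (𝓡 d) x →L[ℝ] Bundle.Trivial N ℝ x)))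
  φ_φ : ∀ x (u : T d x), φ x (φ x u) = -u + η x u • ξ x
  η_ξ : ∀ x, η x (ξ x) = 1
  φ_ξ : ∀ x, φ x (ξ x) = 0
  η_φ : ∀ x (u : T d x), η x (φ x u) = 0
  inner_φ : ∀ x (u v : T d x), (inner ℝ u (φ x v) : ℝ) = -inner ℝ (φ x u) v
  inner_ξ : ∀ x (u : T d x), (inner ℝ u (ξ x) : ℝ) = η x u

/-- The exterior derivative of a one-form,
`dη(u,v) = (u(η(V)) - v(η(U)) - η([U,V])) / 2` (the convention with the factor `1/2`, as is usual in
contact metric geometry). -/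
def extDerivOneForm (η : Π x : N, TangentSpace (𝓡 d) x →L[ℝ] ℝ) (x : N) (u v : T d x) : ℝ :=
  1 / 2 * (mvfderiv (𝓡 d) (fun y ↦ η y (extendField v y)) x u - mvfderiv (𝓡 d) (fun y ↦ η y (extendField u y)) x v
    - η x (VectorField.mlieBracket (𝓡 d) (extendField u) (extendField v) x))

namespace AlmostContactMetric

variable (S : AlmostContactMetric d N)

/-- `dη = Φ`, where `Φ(u,v) = g(u, φ v)` is the fundamental 2-form. -/
def IsContactMetric : Prop :=
  ∀ x (u v : T d x), extDerivOneForm S.η x u v = inner ℝ u (S.φ x v)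

/-- The tensor `h' = (1/2) L_ξ φ`, that is `2 h' u = [ξ, φ U] - φ [ξ, U]`. -/
def hTensor (x : N) (u : T d x) : T d x :=
  (1 / 2 : ℝ) • (VectorField.mlieBracket (𝓡 d) S.ξ (fun y ↦ S.φ y (extendField u y)) x
    - S.φ x (VectorField.mlieBracket (𝓡 d) S.ξ (extendField u) x))

/-- The `(κ, μ)`-nullity distribution at `x`. -/
def nullity (cov : Connection d N) (κ μ : ℝ) (x : N) : Set (T d x) :=
  {z | ∀ u v : T d x, curvature cov.nabla x u v z
    = κ • ((inner ℝ v z : ℝ) • u - (inner ℝ u z : ℝ) • v)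
      + μ • ((inner ℝ v z : ℝ) • S.hTensor x u - (inner ℝ u z : ℝ) • S.hTensor x v)}

/-- A `(κ, μ)`-contact space form of constant `φ`-sectional curvature `c`: a contact metric manifold
such that `ξ` belongs to the `(κ, μ)`-nullity distribution and every `φ`-section, spanned by a unit
vector `u` orthogonal to `ξ` and by `φ u`, has sectional curvature `c`. Here `cov` is the
Levi-Civita connection. -/
structure IsKappaMuSpaceForm (cov : Connection d N) (κ μ c : ℝ) : Prop where
  contact : S.IsContactMetric
  nullity_ξ : ∀ x, S.ξ x ∈ S.nullity cov κ μ x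
  φ_sectional : ∀ x (u : T d x), ‖u‖ = 1 → (inner ℝ u (S.ξ x) : ℝ) = 0 →
    curvature₄ cov.nabla x u (S.φ x u) (S.φ x u) u = c

end AlmostContactMetric

end Contact

/-! ### Submanifolds -/

section Submanifold

variable {n d : ℕ}
  {M : Type*} [TopologicalSpace M] [ChartedSpace (E n) M] [IsManifold (𝓡 n) ∞ M]
  [RiemannianBundle (fun x : M ↦ TangentSpace (𝓡 n) x)]
  {N : Type*} [TopologicalSpace N] [ChartedSpace (E d) N] [IsManifold (𝓡 d) ∞ N]
  [RiemannianBundle (fun x : N ↦ TangentSpace (𝓡 d) x)]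

/-- The differential `T_x M → T_{f x} N`. -/
def df (f : M → N) (x : M) : TangentSpace (𝓡 n) x →L[ℝ] TangentSpace (𝓡 d) (f x) :=
  mfderiv (𝓡 n) (𝓡 d) f x

/-- `f : M → N` is a smooth isometric immersion, that is, `M` is an (immersed) submanifold of `N`
with the induced metric. -/
structure IsIsometricImmersion (f : M → N) : Prop where
  smooth : ContMDiff (𝓡 n) (𝓡 d) ∞ f
  isometric : ∀ x (u v : T n x),
    (inner ℝ (df (n := n) (d := d) f x u) (df (n := n) (d := d) f x v) : ℝ) = inner ℝ u v

/-- The tangential part `w^⊤ ∈ T_x M` of a vector `w ∈ T_{f x} N`, for an isometric immersion: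
the vector with `g(w^⊤, u) = g(w, df u)` for all `u ∈ T_x M`. -/
def tangential (f : M → N) (x : M) : TangentSpace (𝓡 d) (f x) →ₗ[ℝ] TangentSpace (𝓡 n) x :=
  LinearMap.adjoint (df f x).toLinearMap

/-- The normal part `w^⊥` of a vector `w ∈ T_{f x} N`. -/
def normal (f : M → N) (x : M) (w : T d (f x)) : T d (f x) :=
  w - df (n := n) f x (tangential f x w)

/-- The derivative `(∇̄_v V)(x)` of a vector field `V` of `N` along `f`, for `v ∈ T_x M`. Write
`V = ∑ c_i (s_i ∘ f)` near `x` with the local frame `s_i` of `N` that is constant in the preferred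
trivialization at `f x`; then `∇̄_v V = ∑ c_i(x) ∇̄_(df v) s_i + ∑ dc_i(v) s_i`. If `V = Z ∘ f` for a
vector field `Z` of `N`, this is `∇̄_(df v) Z`. -/
def nablaAlong (D : Nabla d N) (f : M → N) (V : Π y : M, T d (f y)) (x : M) (v : T n x) :
    T d (f x) :=
  let t := trivializationAt (E d) (fun z : N ↦ TangentSpace (𝓡 d) z) (f x)
  D (extendField (V x)) (f x) (df f x v)
    + t.symm (f x) (mvfderiv (𝓡 n) (fun y ↦ (t ⟨f y, V y⟩).2) x v)

/-- The connection induced on `M` by a connection of `N`: the tangential part in the Gauss formula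
`∇̄_X Y = ∇_X Y + h(X,Y)`. -/
def induced (D : Nabla d N) (f : M → N) : Nabla n M :=
  fun Y x v ↦ tangential f x (nablaAlong D f (fun y ↦ df f y (Y y)) x v)

/-- The second fundamental form: the normal part in the Gauss formula
`∇̄_X Y = ∇_X Y + h(X,Y)`. -/
def secondFF (D : Nabla d N) (f : M → N) (x : M) (u v : T n x) : T d (f x) :=
  normal (n := n) f x (nablaAlong D f (fun y ↦ df f y (extendField v y)) x u)

/-- The shape operator `A_ν` of a normal vector `ν`: `g(A_ν u, v) = g(h(u,v), ν)`. -/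
def shapeOperator (D : Nabla d N) (f : M → N) (x : M) (ν : T d (f x)) (u : T n x) : T n x :=
  ∑ i, (inner ℝ (secondFF D f x u (stdOrthonormalBasis ℝ (T n x) i)) ν : ℝ) •
    stdOrthonormalBasis ℝ (T n x) i

/-- The coefficients `h_ij = g(h(e_i,e_j), ν)`. -/
def coeffFF (D : Nabla d N) (f : M → N) (x : M) (e : Fin n → T n x) (ν : T d (f x)) (i j : Fin n) :
    ℝ :=
  inner ℝ (secondFF D f x (e i) (e j)) ν

/-- The matrix `g(e_i, A_ν e_j)` of the shape operator `A_ν` in the orthonormal basis `e`. -/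
def shapeMatrix (D : Nabla d N) (f : M → N) (x : M) (e : Fin n → T n x) (ν : T d (f x)) :
    Matrix (Fin n) (Fin n) ℝ :=
  Matrix.of fun i j ↦ inner ℝ (e i) (shapeOperator D f x ν (e j))

/-- The mean curvature vector `H = (1/n) ∑ h(e_i,e_i)`. -/
def meanCurvature (D : Nabla d N) (f : M → N) (x : M) : T d (f x) :=
  (1 / (n : ℝ)) • ∑ i, secondFF D f x (stdOrthonormalBasis ℝ (T n x) i)
    (stdOrthonormalBasis ℝ (T n x) i)

/-- The operator `u ↦ (A u)^⊤` of `T_x M` defined by an operator `A` of `T_{f x} N`. -/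
def compress (f : M → N) (x : M) (A : T d (f x) → T d (f x)) (u : T n x) : T n x :=
  tangential f x (A (df f x u))

/-- The trace `∑ B(e_i,e_i)` of a bilinear form on `T_x M`. -/
def trForm (x : M) (B : T n x → T n x → ℝ) : ℝ :=
  ∑ i, B (stdOrthonormalBasis ℝ (T n x) i) (stdOrthonormalBasis ℝ (T n x) i)

/-- The trace `∑ g(e_i, ϑ e_i)` of an operator of `T_x M`. -/
def trOp (x : M) (ϑ : T n x → T n x) : ℝ := trForm x (fun u v ↦ inner ℝ u (ϑ v))

/-- `‖ϑ‖² = ∑ g(e_i, ϑ e_j)²` for an operator of `T_x M`. -/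
def normSqOp (x : M) (ϑ : T n x → T n x) : ℝ :=
  ∑ i, ∑ j, (inner ℝ (stdOrthonormalBasis ℝ (T n x) i)
    (ϑ (stdOrthonormalBasis ℝ (T n x) j)) : ℝ) ^ 2

/-- An orthonormal basis `e 0, e 1` of a plane `Π ⊂ T_x M`. -/
def planeBasis {x : M} {Pl : Submodule ℝ (TangentSpace (𝓡 n) x)} (hPl : Module.finrank ℝ Pl = 2)
    (i : Fin 2) : T n x :=
  ((stdOrthonormalBasis ℝ Pl).reindex (finCongr hPl) i : Pl)

/-- `tr(B|Π) = B(e₁,e₁) + B(e₂,e₂)`. -/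
def trPlane {x : M} (e : Fin 2 → T n x) (B : T n x → T n x → ℝ) : ℝ := B (e 0) (e 0) + B (e 1) (e 1)

/-- The determinant `det(B|Π)` of the matrix `B(e_i,e_j)`. -/
def detPlane {x : M} (e : Fin 2 → T n x) (B : T n x → T n x → ℝ) : ℝ :=
  (Matrix.of fun i j ↦ B (e i) (e j)).det

variable (S : AlmostContactMetric d N) (cov : Connection d N) (P : Π z : N, T d z)

/-- The right-hand side of Chen's inequality for a plane section `Π` of `T_x M`, where the
submanifold `M` of the `(κ, μ)`-contact space form `N` has the connection induced by the first
generalized semi-symmetric non-metric connection with parameters `λ₁`, `λ₂` and vector field `P`. -/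
def chenBound (lam₁ lam₂ κ μ c : ℝ) (f : M → N) (x : M)
    (Pl : Submodule ℝ (TangentSpace (𝓡 n) x)) (hPl : Module.finrank ℝ Pl = 2) : ℝ :=
  let D : Nabla d N := semiSymmetric cov P lam₁ lam₂
  let i : T n x → T d (f x) := df f x
  let e : Fin 2 → T n x := planeBasis hPl
  let H : T d (f x) := meanCurvature (n := n) D f x
  let ξT : T n x := tangential f x (S.ξ (f x))
  let Phat : T n x → T n x := compress f x (S.φ (f x))
  let hT : T n x → T n x := compress f x (S.hTensor (f x))
  let φhT : T n x → T n x := compress f x (fun w ↦ S.φ (f x) (S.hTensor (f x) w))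
  let a : T n x → T n x → ℝ := fun u v ↦ alpha cov P lam₁ lam₂ (f x) (i u) (i v)
  let b : T n x → T n x → ℝ := fun u v ↦ beta P (f x) (i u) (i v)
  let η : T n x → ℝ := fun u ↦ S.η (f x) (i u)
  -- the functions of the plane section: `β(Π)`, `γ(Π)`, `θ(Π)`
  let betaPl : ℝ := (inner ℝ (Phat (e 0)) (e 1)) ^ 2
  let gammaPl : ℝ := η (e 0) ^ 2 + η (e 1) ^ 2
  let thetaPl : ℝ := η (e 0) ^ 2 * inner ℝ (hT (e 1)) (e 1) + η (e 1) ^ 2 * inner ℝ (hT (e 0)) (e 0)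
    - 2 * η (e 0) * η (e 1) * inner ℝ (hT (e 0)) (e 1)
  ((n : ℝ) + 1) * ((n : ℝ) - 2) / 2 * ((c + 3) / 4)
  + (c + 3 - 4 * κ) / 4 * (-((n : ℝ) - 1) * ‖ξT‖ ^ 2 + gammaPl)
  + (c - 1) / 8 * (3 * normSqOp x Phat - 6 * betaPl)
  + 1 / 4 * (normSqOp x φhT - normSqOp x hT + trOp x hT ^ 2 - trOp x φhT ^ 2)
  - 1 / 2 * (detPlane e (fun u v ↦ inner ℝ u (hT v)) - detPlane e (fun u v ↦ inner ℝ u (φhT v)))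
  + ((n : ℝ) - 1) * trOp x hT - trPlane e (fun u v ↦ inner ℝ u (hT v))
  + (1 - μ) * (inner ℝ ξT (hT ξT) - trOp x hT * ‖ξT‖ ^ 2 + thetaPl)
  - (lam₁ + lam₂) / 2 * ((n : ℝ) - 1) * trForm x a
  - lam₂ / 2 * (lam₁ - lam₂) * ((n : ℝ) - 1) * trForm x b
  - (lam₁ - lam₂) / 2 * ((n : ℝ) - 1) * n * inner ℝ (P (f x)) H
  + (lam₁ + lam₂) / 2 * trPlane e a
  + lam₂ * (lam₁ - lam₂) / 2 * trPlane e b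
  + (lam₁ - lam₂) / 2 *
    inner ℝ (secondFF D f x (e 0) (e 0) + secondFF D f x (e 1) (e 1)) (P (f x))
  + (n : ℝ) ^ 2 * ((n : ℝ) - 2) / (2 * ((n : ℝ) - 1)) * ‖H‖ ^ 2

/-- The left-hand side `τ(x) - K(Π)` of Chen's inequality, for the connection induced on `M` by the
first generalized semi-symmetric non-metric connection. -/
def chenInvariant (lam₁ lam₂ : ℝ) (f : M → N) (x : M)
    (Pl : Submodule ℝ (TangentSpace (𝓡 n) x)) (hPl : Module.finrank ℝ Pl = 2) : ℝ :=
  let DM : Nabla n M := induced (semiSymmetric cov P lam₁ lam₂) f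
  scalarCurvature DM x - sectional DM x (planeBasis hPl 0) (planeBasis hPl 1)

end Submanifold

/-- The first index of `Fin n`, for `3 ≤ n`. -/
def fst {n : ℕ} (hn : 3 ≤ n) : Fin n := ⟨0, by omega⟩

/-- The second index of `Fin n`, for `3 ≤ n`. -/
def snd {n : ℕ} (hn : 3 ≤ n) : Fin n := ⟨1, by omega⟩

/-- `diag(a, b, a + b, …, a + b)`. -/
def diagForm (n : ℕ) (a b : ℝ) : Matrix (Fin n) (Fin n) ℝ :=
  Matrix.diagonal fun i ↦ if i.val = 0 then a else if i.val = 1 then b else a + b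

/-- The matrix with upper left block `(a, b; b, -a)` and all other entries zero. -/
def blockForm (n : ℕ) (a b : ℝ) : Matrix (Fin n) (Fin n) ℝ :=
  Matrix.of fun i j ↦
    if i.val = 0 ∧ j.val = 0 then a
    else if i.val = 1 ∧ j.val = 1 then -a
    else if i.val = 0 ∧ j.val = 1 ∨ i.val = 1 ∧ j.val = 0 then b
    else 0

end ChenKappaMu

end

/-! Fix a point and let B be the Levi-Civita second fundamental form there. When P is tangent to M,
the extra terms λ₁π(Y)X − λ₂g(X,Y)P of the connection are tangent, so h = B. The core of the proof
is that the right side of (∗) minus its left side equals the defect ½(∑‖B(e_i,e_j)‖² − ‖tr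
B‖²/(n−1)) + ⟨B(q₀,q₀), B(q₁,q₁)⟩ − ‖B(q₀,q₁)‖², with q an orthonormal basis of Π
(`chenBound_sub_chenInvariant`). Equality in (∗) is then a question of linear algebra about B.

The identity has two sources. The first is the sectional curvature of the ambient space form
(`curvature₄_eq`), derived here from the definitions. With A = ∇ξ, the contact condition gives A =
−φ − φh', and the Ricci identity along ξ gives A² = κφ². These relations determine ∇φ (`covEnd_φ`),
through the eigenspaces of φh' when κ < 1. The Ricci identity for φ then shows that on ξ^⊥ the
curvature differs from an explicit model by a tensor of Kähler type with zero holomorphic sectional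
curvature, and such a tensor has zero sectional curvature. The components involving ξ are given by
the nullity condition.

The second source is the Gauss equation (`gauss`) for a connection that need not be metric. It uses
compatibility with g only when a normal vector is paired with a tangent one, and this holds because
P is tangent. The averaged definition of K symmetrises the λ-terms into traces of α and β, and π(H)
= 0 because H is normal.

For the linear algebra, the defect in a basis adapted to Π is a sum of squares: the off-diagonal
entries other than (1,2), and half the total squared deviation of the n−1 vectors B₁₁+B₂₂, B₃₃, …,
B_nn from their mean (`chenDefect_eq_zero_iff`). If it vanishes, then tr B = (n−1)(B₁₁+B₂₂). Putting
the first normal vector along tr B makes the other shape operators trace-free on Π, and a rotation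
inside Π diagonalises the first one; the converse is read off from the matrices
(`chenDefect_equality`).

The differential geometry is done in charts: connections become Christoffel symbols and tensor
fields become functions on the model space. -/

set_option synthInstance.maxHeartbeats 400000

noncomputable section

namespace ChenKappaMu

open Filter Topology

/-! ### Vector fields and derivatives in the preferred charts -/

section Charts

variable {d : ℕ} {N : Type*} [TopologicalSpace N] [ChartedSpace (E d) N] [IsManifold (𝓡 d) ∞ N]

/-- The preferred trivialization at `x`, as a map from the tangent space at `y`. -/
def toModel (x y : N) : T d y →L[ℝ] E d :=
  (trivializationAt (E d) (fun z : N ↦ TangentSpace (𝓡 d) z) x).continuousLinearMapAt ℝ y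

/-- The inverse of the preferred trivialization at `x`. -/
def ofModel (x y : N) : E d →L[ℝ] T d y :=
  (trivializationAt (E d) (fun z : N ↦ TangentSpace (𝓡 d) z) x).symmL ℝ y

/-- The chart at `x` with values in the model space. -/
abbrev ch (d : ℕ) {N : Type*} [TopologicalSpace N] [ChartedSpace (E d) N] (x : N) :
    PartialEquiv N (E d) := extChartAt (𝓡 d) x

omit [IsManifold (𝓡 d) ∞ N] in
lemma mem_ch_self (x : N) : x ∈ (ch d x).source := mem_extChartAt_source x

lemma mem_base {x y : N} (hy : y ∈ (ch d x).source) :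
    y ∈ (trivializationAt (E d) (fun z : N ↦ TangentSpace (𝓡 d) z) x).baseSet := by
  simpa using hy

lemma ofModel_toModel {x y : N} (hy : y ∈ (ch d x).source) (v : T d y) :
    ofModel x y (toModel x y v) = v :=
  Trivialization.symmL_continuousLinearMapAt _ (mem_base hy) v

lemma toModel_ofModel {x y : N} (hy : y ∈ (ch d x).source) (a : E d) :
    toModel x y (ofModel x y a) = a :=
  Trivialization.continuousLinearMapAt_symmL _ (mem_base hy) a

lemma triv_snd {x y : N} (hy : y ∈ (ch d x).source) (v : T d y) :
    (trivializationAt (E d) (fun z : N ↦ TangentSpace (𝓡 d) z) x ⟨y, v⟩).2 = toModel x y v := by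
  rw [toModel, Trivialization.continuousLinearMapAt_apply,
    Trivialization.coe_linearMapAt_of_mem _ (mem_base hy)]

lemma triv_symm {x y : N} (hy : y ∈ (ch d x).source) (a : E d) :
    (trivializationAt (E d) (fun z : N ↦ TangentSpace (𝓡 d) z) x).symm y a = ofModel x y a := by
  rw [ofModel, Trivialization.symmL_apply _ (mem_base hy)]

/-- The vector field that is constant, equal to `a`, in the preferred trivialization at `x`. -/
def constField (x : N) (a : E d) (y : N) : T d y :=
  (trivializationAt (E d) (fun z : N ↦ TangentSpace (𝓡 d) z) x).symm y a

lemma constField_apply {x y : N} (hy : y ∈ (ch d x).source) (a : E d) :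
    constField x a y = ofModel x y a := triv_symm hy a

/-- The extensions used in the definition of curvature are coordinate fields of the chart at the
same point. Their chart expressions are therefore constant and their brackets vanish. -/
lemma extendField_eq {x : N} (u : T d x) : extendField u = constField x (toModel x x u) := by
  funext y
  simp only [extendField, FiberBundle.extend, constField, triv_snd (mem_ch_self x)]

lemma extendField_self {x : N} (u : T d x) : extendField u x = u :=
  FiberBundle.extend_apply_self _ u

/-- The expression of a vector field in the chart at `x`. -/
def rep (x : N) (V : Π y : N, T d y) (e : E d) : E d :=
  toModel x ((ch d x).symm e) (V ((ch d x).symm e))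

omit [IsManifold (𝓡 d) ∞ N] in
lemma ch_left {x y : N} (hy : y ∈ (ch d x).source) : (ch d x).symm (ch d x y) = y :=
  (ch d x).left_inv hy

lemma rep_apply {x y : N} (hy : y ∈ (ch d x).source) (V : Π y : N, T d y) :
    rep x V (ch d x y) = toModel x y (V y) := by
  simp only [rep]; rw [ch_left hy]

omit [IsManifold (𝓡 d) ∞ N] in
lemma ch_target_mem {x y : N} (hy : y ∈ (ch d x).source) : (ch d x).target ∈ 𝓝 (ch d x y) :=
  extChartAt_target_mem_nhds' ((ch d x).map_source hy)

lemma rep_constField {x : N} (a : E d) {e : E d} (he : e ∈ (ch d x).target) :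
    rep x (constField x a) e = a := by
  rw [rep, constField_apply ((ch d x).map_target he), toModel_ofModel ((ch d x).map_target he)]

/-- `V` is differentiable at `y` as a section. -/
abbrev VDiffAt (V : Π y : N, T d y) (y : N) : Prop :=
  MDifferentiableAt (𝓡 d) ((𝓡 d).prod 𝓘(ℝ, E d))
    (fun z ↦ (⟨z, V z⟩ : TotalSpace (E d) (fun z : N ↦ TangentSpace (𝓡 d) z))) y

lemma mdiff_symm {x y : N} (hy : y ∈ (ch d x).source) :
    ContMDiffAt 𝓘(ℝ, E d) (𝓡 d) ∞ (ch d x).symm (ch d x y) :=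
  (contMDiffOn_extChartAt_symm (n := ∞) x).contMDiffAt (ch_target_mem hy)

lemma mdiff_ch {x y : N} (hy : y ∈ (ch d x).source) :
    ContMDiffAt (𝓡 d) 𝓘(ℝ, E d) ∞ (ch d x) y :=
  contMDiffAt_extChartAt' (by simpa using hy)

section Functions
variable {F : Type*} [NormedAddCommGroup F] [NormedSpace ℝ F]

lemma differentiableAt_comp_symm {x y : N} (hy : y ∈ (ch d x).source) {s : N → F}
    (hs : MDifferentiableAt (𝓡 d) 𝓘(ℝ, F) s y) :
    DifferentiableAt ℝ (s ∘ (ch d x).symm) (ch d x y) := by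
  rw [← mdifferentiableAt_iff_differentiableAt]
  refine MDifferentiableAt.comp (I' := 𝓡 d) _ ?_ ((mdiff_symm hy).mdifferentiableAt (by simp))
  rwa [ch_left hy]

lemma contDiffAt_comp_symm {x y : N} (hy : y ∈ (ch d x).source) {s : N → F}
    (hs : ContMDiffAt (𝓡 d) 𝓘(ℝ, F) ∞ s y) :
    ContDiffAt ℝ ∞ (s ∘ (ch d x).symm) (ch d x y) := by
  rw [← contMDiffAt_iff_contDiffAt]
  refine ContMDiffAt.comp (I' := 𝓡 d) _ ?_ (mdiff_symm hy)
  rwa [ch_left hy]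

omit [IsManifold (𝓡 d) ∞ N] in
lemma eventually_comp_ch {x y : N} (hy : y ∈ (ch d x).source) {α : Type*} (s : N → α) :
    s =ᶠ[𝓝 y] (s ∘ (ch d x).symm) ∘ ch d x := by
  filter_upwards [extChartAt_source_mem_nhds' hy] with z hz
  simp only [Function.comp_apply]; rw [ch_left hz]

lemma mdifferentiableAt_of_comp_symm {x y : N} (hy : y ∈ (ch d x).source) {s : N → F}
    (hs : DifferentiableAt ℝ (s ∘ (ch d x).symm) (ch d x y)) :
    MDifferentiableAt (𝓡 d) 𝓘(ℝ, F) s y := by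
  refine MDifferentiableAt.congr_of_eventuallyEq ?_ (eventually_comp_ch hy s)
  exact MDifferentiableAt.comp (I' := 𝓘(ℝ, E d)) _ (mdifferentiableAt_iff_differentiableAt.2 hs)
    ((mdiff_ch hy).mdifferentiableAt (by simp))

lemma mvfderiv_eq {x y : N} (hy : y ∈ (ch d x).source) {s : N → F}
    (hs : MDifferentiableAt (𝓡 d) 𝓘(ℝ, F) s y) (v : T d y) :
    mvfderiv (𝓡 d) s y v = fderiv ℝ (s ∘ (ch d x).symm) (ch d x y) (toModel x y v) := by
  have h1 : mfderiv (𝓡 d) 𝓘(ℝ, F) s y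
      = mfderiv (𝓡 d) 𝓘(ℝ, F) ((s ∘ (ch d x).symm) ∘ ch d x) y :=
    (eventually_comp_ch hy s).mfderiv_eq
  have h2 := mfderiv_comp (I := 𝓡 d) (I' := 𝓘(ℝ, E d)) (I'' := 𝓘(ℝ, F)) y
    (mdifferentiableAt_iff_differentiableAt.2 (differentiableAt_comp_symm hy hs))
    ((mdiff_ch hy).mdifferentiableAt (by simp))
  -- The preferred trivialization of the tangent bundle is the derivative of the chart.
  have h3 : toModel x y = mfderiv (𝓡 d) 𝓘(ℝ, E d) (ch d x) y :=
    TangentBundle.continuousLinearMapAt_trivializationAt (by simpa using hy)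
  rw [h3, ← mfderiv_eq_fderiv]
  change mfderiv (𝓡 d) 𝓘(ℝ, F) s y v = _
  rw [h1, h2]; rfl

end Functions

lemma vdiffAt_iff {x y : N} (hy : y ∈ (ch d x).source) (V : Π y : N, T d y) :
    VDiffAt V y ↔ DifferentiableAt ℝ (rep x V) (ch d x y) := by
  have h1 := (trivializationAt (E d) (fun z : N ↦ TangentSpace (𝓡 d) z)
      x).mdifferentiableAt_section_iff
    (𝓡 d) V (mem_base hy)
  rw [VDiffAt, h1]
  have h2 : (fun z ↦ (trivializationAt (E d) (fun z : N ↦ TangentSpace (𝓡 d) z) x ⟨z, V z⟩).2)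
      ∘ (ch d x).symm =ᶠ[𝓝 (ch d x y)] rep x V := by
    filter_upwards [ch_target_mem hy] with e he
    exact triv_snd ((ch d x).map_target he) _
  rw [← h2.differentiableAt_iff]
  exact ⟨differentiableAt_comp_symm hy, mdifferentiableAt_of_comp_symm hy⟩

lemma contDiffAt_rep {x : N} (V : Π y : N, T d y)
    (hV : ContMDiffAt (𝓡 d) ((𝓡 d).prod 𝓘(ℝ, E d)) ∞
      (fun z ↦ (⟨z, V z⟩ : TotalSpace (E d) (fun z : N ↦ TangentSpace (𝓡 d) z))) x) :
    ContDiffAt ℝ ∞ (rep x V) (ch d x x) := by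
  rw [contMDiffAt_section] at hV
  refine (contDiffAt_comp_symm (mem_ch_self x) hV).congr_of_eventuallyEq ?_
  filter_upwards [ch_target_mem (mem_ch_self x)] with e he
  exact (triv_snd ((ch d x).map_target he) _).symm

lemma vdiffAt_constField {x y : N} (hy : y ∈ (ch d x).source) (a : E d) :
    VDiffAt (constField x a) y := by
  rw [vdiffAt_iff hy]
  refine (differentiableAt_const a).congr_of_eventuallyEq ?_
  filter_upwards [ch_target_mem hy] with e he using rep_constField a he

lemma vdiffAt_extendField {x : N} (u : T d x) : VDiffAt (extendField u) x := by
  rw [extendField_eq]; exact vdiffAt_constField (mem_ch_self x) _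

end Charts

lemma contDiffAt_flip_sum_smulRight {F G ι : Type*} [NormedAddCommGroup F] [NormedSpace ℝ F]
    [NormedAddCommGroup G] [NormedSpace ℝ G] [Fintype ι] (c : ι → F →L[ℝ] ℝ) {n : ℕ∞ω}
    {f : ι → G → F →L[ℝ] F} {e : G} (hf : ∀ i, ContDiffAt ℝ n (f i) e) :
    ContDiffAt ℝ n (fun z ↦ (∑ i, (c i).smulRight (f i z)).flip) e := by
  have h1 : ContDiff ℝ n (ContinuousLinearMap.flipₗᵢ ℝ F F F) :=
    (ContinuousLinearMap.flipₗᵢ ℝ F F F).contDiff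
  have h3 : ContDiffAt ℝ n (fun z ↦ ∑ i, (c i).smulRight (f i z)) e :=
    ContDiffAt.sum fun i _ ↦ contDiffAt_const.smulRight (hf i)
  exact h1.contDiffAt.comp e h3

/-! ### Christoffel symbols of a connection -/

section Christoffel

variable {d : ℕ} {N : Type*} [TopologicalSpace N] [ChartedSpace (E d) N] [IsManifold (𝓡 d) ∞ N]

/-- `Γ` is, at `y`, the Christoffel symbol of the differentiation `D` in the chart at `x`. -/
def HasChristoffelAt (D : Nabla d N) (x : N) (Γ : E d → E d →L[ℝ] E d →L[ℝ] E d) (y : N) : Prop :=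
  ∀ V : Π z : N, T d z, VDiffAt V y → ∀ v : T d y,
    toModel x y (D V y v) = fderiv ℝ (rep x V) (ch d x y) (toModel x y v)
      + Γ (ch d x y) (toModel x y v) (rep x V (ch d x y))

/-- `Γ` is the Christoffel symbol of the differentiation `D` in the chart at `x`. -/
def HasChristoffel (D : Nabla d N) (x : N) (Γ : E d → E d →L[ℝ] E d →L[ℝ] E d) : Prop :=
  ∀ y ∈ (ch d x).source, HasChristoffelAt D x Γ y

/-- The Christoffel symbol of a connection in the trivialization at `x`, as a function on the
manifold. -/
def christoffelAt (cov : Connection d N) (x y : N) : E d →L[ℝ] E d →L[ℝ] E d :=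
  (∑ i, (EuclideanSpace.proj i : E d →L[ℝ] ℝ).smulRight
    (toModel x y ∘L cov (constField x (EuclideanSpace.single i 1)) y ∘L ofModel x y)).flip

/-- The Christoffel symbol of a connection in the chart at `x`. -/
def christoffel (cov : Connection d N) (x : N) (e : E d) : E d →L[ℝ] E d →L[ℝ] E d :=
  christoffelAt cov x ((ch d x).symm e)

lemma christoffelAt_apply (cov : Connection d N) (x y : N) (a b : E d) :
    christoffelAt cov x y a b = ∑ i, b i • toModel x y
      (cov (constField x (EuclideanSpace.single i 1)) y (ofModel x y a)) := by
  simp [christoffelAt]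

/-- Additivity of a connection requires differentiable summands, so differentiability of the partial
sums has to run through the induction together with the formula. -/
lemma cov_sum (cov : Connection d N) {y : N} {ι : Type*} (s : Finset ι) (V : ι → Π z : N, T d z)
    (hV : ∀ i, VDiffAt (V i) y) :
    VDiffAt (∑ i ∈ s, V i) y ∧ cov (∑ i ∈ s, V i) y = ∑ i ∈ s, cov (V i) y := by
  classical
  induction s using Finset.induction_on with
  | empty =>
    simp only [Finset.sum_empty, CovariantDerivative.zero]
    exact ⟨mdifferentiableAt_zeroSection .., rfl⟩
  | insert i s hi ih =>
    rw [Finset.sum_insert hi, Finset.sum_insert hi,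
      cov.isCovariantDerivativeOnUniv.add (hV i) ih.1, ih.2]
    exact ⟨mdifferentiableAt_add_section (hV i) ih.1, rfl⟩

lemma sum_coord (b : E d) : ∑ i, b i • (EuclideanSpace.single i (1 : ℝ) : E d) = b := by
  ext j
  simp [Finset.sum_apply, Pi.single_apply]

/-- Near y, V is a combination of the coordinate fields whose coefficients are its components in the
chart. The Leibniz rule turns the derivatives of the coefficients into the first term and the
derivatives of the frame into the Christoffel term. -/
lemma hasChristoffel (cov : Connection d N) (x : N) :
    HasChristoffel cov.nabla x (christoffel cov x) := by
  intro y hy V hV v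
  have hrep := (vdiffAt_iff hy V).1 hV
  set c : Fin d → N → ℝ := fun i z ↦ toModel x z (V z) i with hc
  have hcsymm : ∀ i, c i ∘ (ch d x).symm = fun e ↦ rep x V e i := fun i ↦ rfl
  have hcd : ∀ i, MDifferentiableAt (𝓡 d) 𝓘(ℝ, ℝ) (c i) y := by
    intro i
    refine mdifferentiableAt_of_comp_symm hy ?_
    rw [hcsymm]
    exact (EuclideanSpace.proj i : E d →L[ℝ] ℝ).differentiableAt.comp _ hrep
  set W : Fin d → Π z : N, T d z := fun i ↦ c i • constField x (EuclideanSpace.single i 1) with hW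
  have hWd : ∀ i, VDiffAt (W i) y := fun i ↦ (hcd i).smul_section (vdiffAt_constField hy _)
  obtain ⟨h1, h2⟩ := cov_sum cov Finset.univ W hWd
  have hVW : ∀ᶠ z in 𝓝 y, V z = (∑ i, W i) z := by
    filter_upwards [extChartAt_source_mem_nhds' hy] with z hz
    have : (∑ i, W i) z = ofModel x z (∑ i, c i z • (EuclideanSpace.single i (1 : ℝ) : E d)) := by
      simp only [Finset.sum_apply, map_sum, map_smul, hW, Pi.smul_apply', constField_apply hz]
    rw [this, sum_coord (toModel x z (V z)), ofModel_toModel hz]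
  have h3 : cov V y = cov (∑ i, W i) y :=
    cov.isCovariantDerivativeOnUniv.congr_of_eventuallyEq hV h1 univ_mem hVW
  have h4 : ∀ i, cov (W i) y v = c i y • cov (constField x (EuclideanSpace.single i 1)) y v
      + mvfderiv (𝓡 d) (c i) y v • constField x (EuclideanSpace.single i 1) y := by
    intro i
    rw [hW, cov.isCovariantDerivativeOnUniv.leibniz (vdiffAt_constField hy _) (hcd i)]
    rfl
  have h5 : ∀ i, mvfderiv (𝓡 d) (c i) y v
      = fderiv ℝ (rep x V) (ch d x y) (toModel x y v) i := by
    intro i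
    rw [mvfderiv_eq hy (hcd i), hcsymm]
    have := ((EuclideanSpace.proj i : E d →L[ℝ] ℝ).hasFDerivAt.comp (ch d x y)
      hrep.hasFDerivAt).fderiv
    exact congrArg (fun L ↦ L (toModel x y v)) this
  change toModel x y (cov V y v) = _
  rw [h3, h2, sum_apply, map_sum]
  simp only [h4, map_add, map_smul, constField_apply hy, toModel_ofModel hy, h5,
    Finset.sum_add_distrib]
  rw [sum_coord (fderiv ℝ (rep x V) (ch d x y) (toModel x y v)), add_comm, christoffel,
    ch_left hy, christoffelAt_apply, ofModel_toModel hy, rep_apply hy]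

/-- A smooth connection sends the smooth coordinate fields to smooth sections of the endomorphism
bundle; the Christoffel symbol is assembled linearly from their expressions in the trivialization.
-/
lemma contDiffAt_christoffel (cov : Connection d N)
    (hsm : ∀ s : Set N, IsOpen s → ContMDiffCovariantDerivativeOn (E d) ∞ cov.toFun s) (x : N) :
    ContDiffAt ℝ ∞ (christoffel cov x) (ch d x x) := by
  set t := trivializationAt (E d) (fun z : N ↦ TangentSpace (𝓡 d) z) x
  have h1 : ∀ a : E d, ContDiffAt ℝ ∞ (fun e ↦ toModel x ((ch d x).symm e) ∘L
      cov (constField x a) ((ch d x).symm e) ∘L ofModel x ((ch d x).symm e)) (ch d x x) := by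
    intro a
    have h2 : ContMDiffOn (𝓡 d) ((𝓡 d).prod 𝓘(ℝ, E d)) (∞ + 1) (fun z ↦
        (⟨z, constField x a z⟩ : TotalSpace (E d) (fun z : N ↦ TangentSpace (𝓡 d) z))) t.baseSet :=
            by
      have : (∞ + 1 : ℕ∞ω) = ∞ := rfl
      rw [this, t.contMDiffOn_section_baseSet_iff]
      refine (contMDiffOn_const (c := a)).congr fun z hz ↦ ?_
      simp [constField, t, Trivialization.apply_mk_symm _ hz]
    have h3 := ((hsm t.baseSet t.open_baseSet).contMDiff h2).contMDiffAt
      (t.open_baseSet.mem_nhds (mem_base (mem_ch_self x)))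
    rw [contMDiffAt_hom_bundle] at h3
    exact contDiffAt_comp_symm (mem_ch_self x) h3.2
  exact contDiffAt_flip_sum_smulRight _ fun i ↦ h1 (EuclideanSpace.single i 1)

/-- Pulled back by the inverse chart these fields become constant fields of the model space, which
commute. The bracket is natural under pullback, and the derivative of the inverse chart is
invertible. -/
lemma mlieBracket_constField {x y : N} (hy : y ∈ (ch d x).source) (a b : E d) :
    VectorField.mlieBracket (𝓡 d) (constField x a) (constField x b) y = 0 := by
  have hsymm := mdiff_symm (x := x) hy
  have key : ∀ e ∈ (ch d x).target, ∀ a : E d,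
      mfderiv 𝓘(ℝ, E d) (𝓡 d) (ch d x).symm e a = ofModel x ((ch d x).symm e) a := by
    intro e he a
    have h := TangentBundle.symmL_trivializationAt (I := 𝓡 d) (x₀ := x) (x := (ch d x).symm e)
      (by simpa using (ch d x).map_target he)
    rw [ofModel, h, (ch d x).right_inv he]
    rw [ModelWithCorners.range_eq_univ, mfderivWithin_univ]
    rfl
  have hinv : ∀ e ∈ (ch d x).target,
      (mfderiv 𝓘(ℝ, E d) (𝓡 d) (ch d x).symm e).IsInvertible := by
    intro e he
    have := isInvertible_mfderivWithin_extChartAt_symm (I := 𝓡 d) he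
    rwa [ModelWithCorners.range_eq_univ, mfderivWithin_univ] at this
  have hpull : ∀ c : E d, VectorField.mpullback 𝓘(ℝ, E d) (𝓡 d) (ch d x).symm (constField x c)
      =ᶠ[𝓝 (ch d x y)] fun _ ↦ c := by
    intro c
    filter_upwards [ch_target_mem hy] with e he
    rw [VectorField.mpullback_apply, constField_apply ((ch d x).map_target he), ← key e he c]
    exact (hinv e he).inverse_apply_self c
  have : IsManifold (𝓡 d) (minSmoothness ℝ 2) N := by
    rw [minSmoothness_of_isRCLikeNormedField]; infer_instance
  have h1 := VectorField.mpullback_mlieBracket (I := 𝓘(ℝ, E d)) (I' := 𝓡 d)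
    (f := (ch d x).symm) (V := constField x a) (W := constField x b) (x₀ := ch d x y) (n := ∞)
    (by rw [ch_left hy]; exact vdiffAt_constField hy a)
    (by rw [ch_left hy]; exact vdiffAt_constField hy b) hsymm
    (by rw [minSmoothness_of_isRCLikeNormedField]; exact WithTop.coe_le_coe.2 le_top)
  rw [(hpull a).mlieBracket_vectorField_eq (hpull b)] at h1
  have h2 : VectorField.mlieBracket 𝓘(ℝ, E d) (fun _ : E d ↦ a) (fun _ : E d ↦ b) (ch d x y)
      = (0 : E d) := by
    have h := VectorField.mlieBracketWithin_eq_lieBracketWithin (𝕜 := ℝ) (V := fun _ : E d ↦ a)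
      (W := fun _ : E d ↦ b) (s := Set.univ)
    refine (congrFun (VectorField.mlieBracketWithin_univ (I := 𝓘(ℝ, E d)) (V := fun _ : E d ↦ a)
      (W := fun _ : E d ↦ b)).symm (ch d x y)).trans ((congrFun h (ch d x y)).trans ?_)
    simp only [VectorField.lieBracketWithin, fderivWithin_univ, fderiv_fun_const]
    exact sub_self _
  obtain ⟨L, hL⟩ := hinv _ ((ch d x).map_source hy)
  have h3 : L.symm (VectorField.mlieBracket (𝓡 d) (constField x a) (constField x b)
      ((ch d x).symm (ch d x y))) = 0 := by
    rw [h2, VectorField.mpullback_apply, ← hL, ContinuousLinearMap.inverse_equiv] at h1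
    exact h1
  rw [ch_left hy] at h3
  exact (map_eq_zero_iff _ L.symm.injective).1 h3

end Christoffel

/-! ### Curvature and Levi-Civita data in a chart -/

section Flat
variable {F G H : Type*} [NormedAddCommGroup F] [NormedSpace ℝ F] [NormedAddCommGroup G]
  [NormedSpace ℝ G] [NormedAddCommGroup H] [NormedSpace ℝ H]

lemma contDiffAt_clm_of_apply [FiniteDimensional ℝ F] {n : ℕ∞ω} {f : H → F →L[ℝ] G} {p : H}
    (hf : ∀ a, ContDiffAt ℝ n (fun e ↦ f e a) p) : ContDiffAt ℝ n f p := by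
  let d := Module.finrank ℝ F
  have hd : d = Module.finrank ℝ (Fin d → ℝ) := (Module.finrank_fin_fun ℝ).symm
  let e₁ := ContinuousLinearEquiv.ofFinrankEq hd
  let e₂ := (e₁.arrowCongr (ContinuousLinearEquiv.refl ℝ G)).trans
    (ContinuousLinearEquiv.piRing (Fin d))
  rw [← Function.id_comp f, ← e₂.symm_comp_self]
  exact e₂.symm.contDiff.contDiffAt.comp p (contDiffAt_pi.mpr fun i ↦ hf _)

lemma contDiffAt_clm_of_apply₂ [FiniteDimensional ℝ F] {n : ℕ∞ω} {f : H → F →L[ℝ] F →L[ℝ] G} {p : H}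
    (hf : ∀ a b, ContDiffAt ℝ n (fun e ↦ f e a b) p) : ContDiffAt ℝ n f p :=
  contDiffAt_clm_of_apply fun a ↦ contDiffAt_clm_of_apply fun b ↦ hf a b

lemma fderiv_apply₁ {f : H → F →L[ℝ] G} {p : H} (hf : DifferentiableAt ℝ f p) (u : H) (a : F) :
    fderiv ℝ (fun e ↦ f e a) p u = fderiv ℝ f p u a := by
  rw [(hf.hasFDerivAt.clm_apply (hasFDerivAt_const a p)).fderiv]
  simp

lemma fderiv_apply₂ {f : H → F →L[ℝ] F →L[ℝ] G} {p : H} (hf : DifferentiableAt ℝ f p) (u : H)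
    (a b : F) : fderiv ℝ (fun e ↦ f e a b) p u = fderiv ℝ f p u a b := by
  have h1 : DifferentiableAt ℝ (fun e ↦ f e a) p := hf.clm_apply (differentiableAt_const a)
  rw [fderiv_apply₁ h1, fderiv_apply₁ hf]

/-- The curvature in a chart, in terms of the Christoffel symbol. -/
def flatCurv (Γ : F → F →L[ℝ] F →L[ℝ] F) (p u v w : F) : F :=
  fderiv ℝ Γ p u v w - fderiv ℝ Γ p v u w + Γ p u (Γ p v w) - Γ p v (Γ p u w)

/-- `Γ` is near `p` the Christoffel symbol of the Levi-Civita connection of the metric `g`. -/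
structure IsFlatLC (g : F → F →L[ℝ] F →L[ℝ] ℝ) (Γ : F → F →L[ℝ] F →L[ℝ] F) (p : F) : Prop where
  smooth_g : ContDiffAt ℝ 2 g p
  smooth_Γ : ContDiffAt ℝ 2 Γ p
  symm : ∀ e a b, g e a b = g e b a
  pos : ∀ᶠ e in 𝓝 p, ∀ a, a ≠ 0 → 0 < g e a a
  torsion : ∀ᶠ e in 𝓝 p, ∀ a b, Γ e a b = Γ e b a
  metric : ∀ᶠ e in 𝓝 p, ∀ u a b, fderiv ℝ g e u a b = g e (Γ e u a) b + g e a (Γ e u b)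

end Flat

/-! ### Passage from the manifold to the chart -/

section Manifold

variable {d : ℕ} {N : Type*} [TopologicalSpace N] [ChartedSpace (E d) N] [IsManifold (𝓡 d) ∞ N]

lemma HasChristoffelAt.constField {D : Nabla d N} {x : N} {Γ : E d → E d →L[ℝ] E d →L[ℝ] E d}
    {y : N} (h : HasChristoffelAt D x Γ y) (hy : y ∈ (ch d x).source) (b : E d) (v : T d y) :
    toModel x y (D (constField x b) y v) = Γ (ch d x y) (toModel x y v) b := by
  have h1 : rep x (ChenKappaMu.constField x b) =ᶠ[𝓝 (ch d x y)] fun _ ↦ b := by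
    filter_upwards [ch_target_mem hy] with e he using rep_constField b he
  rw [h _ (vdiffAt_constField hy b), h1.fderiv_eq, h1.eq_of_nhds]
  simp

lemma HasChristoffel.constField {D : Nabla d N} {x : N} {Γ : E d → E d →L[ℝ] E d →L[ℝ] E d}
    (h : HasChristoffel D x Γ) {y : N} (hy : y ∈ (ch d x).source) (b : E d) (v : T d y) :
    toModel x y (D (constField x b) y v) = Γ (ch d x y) (toModel x y v) b :=
  (h y hy).constField hy b v

/-- At the centre of the chart the extended vectors are coordinate fields, so the bracket term drops
and each second derivative is dΓ + ΓΓ. Neither torsion nor the metric enters, so this also serves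
the semi-symmetric and the induced connections. -/
lemma toModel_curvature {D : Nabla d N} {x : N} {Γ : E d → E d →L[ℝ] E d →L[ℝ] E d}
    (h : ∀ᶠ y in 𝓝 x, HasChristoffelAt D x Γ y) (hΓ : DifferentiableAt ℝ Γ (ch d x x))
    (u v w : T d x) :
    toModel x x (curvature D x u v w)
      = flatCurv Γ (ch d x x) (toModel x x u) (toModel x x v) (toModel x x w) := by
  have hev : ∀ᶠ e in 𝓝 (ch d x x), HasChristoffelAt D x Γ ((ch d x).symm e) := by
    refine (mdiff_symm (mem_ch_self x)).continuousAt.eventually ?_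
    rwa [ch_left (mem_ch_self x)]
  have key : ∀ u v w : T d x, toModel x x (D (fun y ↦ D (extendField w) y (extendField v y)) x u)
      = fderiv ℝ Γ (ch d x x) (toModel x x u) (toModel x x v) (toModel x x w)
        + Γ (ch d x x) (toModel x x u) (Γ (ch d x x) (toModel x x v) (toModel x x w)) := by
    intro u v w
    have h1 : rep x (fun y ↦ D (extendField w) y (extendField v y))
        =ᶠ[𝓝 (ch d x x)] fun e ↦ Γ e (toModel x x v) (toModel x x w) := by
      filter_upwards [ch_target_mem (mem_ch_self x), hev] with e he h
      have hy := (ch d x).map_target he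
      rw [rep, extendField_eq, extendField_eq, h.constField hy, constField_apply hy,
        toModel_ofModel hy, (ch d x).right_inv he]
    have h0 : DifferentiableAt ℝ (fun e ↦ Γ e (toModel x x v) (toModel x x w)) (ch d x x) :=
      (hΓ.clm_apply (differentiableAt_const _)).clm_apply (differentiableAt_const _)
    have h2 : VDiffAt (fun y ↦ D (extendField w) y (extendField v y)) x := by
      rw [vdiffAt_iff (mem_ch_self x)]
      exact h0.congr_of_eventuallyEq h1
    rw [h.self_of_nhds _ h2 u, h1.fderiv_eq, h1.eq_of_nhds, fderiv_apply₂ hΓ]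
  have h4 : toModel x x
      (D (extendField w) x (VectorField.mlieBracket (𝓡 d) (extendField u) (extendField v) x))
      = 0 := by
    rw [extendField_eq, h.self_of_nhds.constField (mem_ch_self x), extendField_eq, extendField_eq,
      mlieBracket_constField (mem_ch_self x)]
    simp
  rw [curvature, map_sub, map_sub, h4, key, key, flatCurv]
  abel

lemma contMDiffAt_constField {x y : N} (hy : y ∈ (ch d x).source) (a : E d) :
    ContMDiffAt (𝓡 d) ((𝓡 d).prod 𝓘(ℝ, E d)) ∞ (fun z ↦
      (⟨z, constField x a z⟩ : TotalSpace (E d) (fun z : N ↦ TangentSpace (𝓡 d) z))) y := by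
  set t := trivializationAt (E d) (fun z : N ↦ TangentSpace (𝓡 d) z) x
  refine ContMDiffOn.contMDiffAt (s := t.baseSet) ?_ (t.open_baseSet.mem_nhds (mem_base hy))
  rw [t.contMDiffOn_section_baseSet_iff]
  refine (contMDiffOn_const (c := a)).congr fun z hz ↦ ?_
  simp [constField, t, Trivialization.apply_mk_symm _ hz]

variable [RiemannianBundle (fun x : N ↦ TangentSpace (𝓡 d) x)]

/-- The metric at `y`, in the trivialization at `x`. -/
def metricAt (x y : N) : E d →L[ℝ] E d →L[ℝ] ℝ :=
  (innerSL ℝ : T d y →L[ℝ] T d y →L[ℝ] ℝ).bilinearComp (ofModel x y) (ofModel x y)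

/-- The metric in the chart at `x`. -/
def chartMetric (x : N) (e : E d) : E d →L[ℝ] E d →L[ℝ] ℝ := metricAt x ((ch d x).symm e)

lemma metricAt_apply (x y : N) (a b : E d) :
    metricAt x y a b = inner ℝ (ofModel x y a) (ofModel x y b) := rfl

lemma chartMetric_toModel {x y : N} (hy : y ∈ (ch d x).source) (u v : T d y) :
    chartMetric x (ch d x y) (toModel x y u) (toModel x y v) = inner ℝ u v := by
  rw [chartMetric, ch_left hy, metricAt_apply, ofModel_toModel hy, ofModel_toModel hy]

variable [IsContMDiffRiemannianBundle (𝓡 d) ∞ (E d) (fun x : N ↦ TangentSpace (𝓡 d) x)]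

lemma contDiffAt_chartMetric (x : N) : ContDiffAt ℝ ∞ (chartMetric x) (ch d x x) := by
  refine contDiffAt_clm_of_apply₂ fun a b ↦ ?_
  have h1 := ContMDiffAt.inner_bundle (contMDiffAt_constField (mem_ch_self x) a)
    (contMDiffAt_constField (mem_ch_self x) b)
  refine (contDiffAt_comp_symm (mem_ch_self x) h1).congr_of_eventuallyEq ?_
  filter_upwards [ch_target_mem (mem_ch_self x)] with e he
  have hy := (ch d x).map_target he
  simp only [chartMetric, metricAt_apply, Function.comp_apply, constField_apply hy]

/-- Everything is tested on coordinate fields: they commute, so zero torsion is the symmetry of Γ,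
and the product rule for their inner products is the formula for the derivative of g. -/
lemma isFlatLC {cov : Connection d N} (hcov : IsLeviCivita cov) (x : N) :
    IsFlatLC (chartMetric x) (christoffel cov x) (ch d x x) where
  smooth_g := (contDiffAt_chartMetric x).of_le (WithTop.coe_le_coe.2 le_top)
  smooth_Γ := (contDiffAt_christoffel cov hcov.smooth x).of_le (WithTop.coe_le_coe.2 le_top)
  symm e a b := by rw [chartMetric, metricAt_apply, metricAt_apply, real_inner_comm]
  pos := by
    filter_upwards [ch_target_mem (mem_ch_self x)] with e he a ha
    have hy := (ch d x).map_target he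
    rw [chartMetric, metricAt_apply, real_inner_self_eq_norm_sq]
    have : ofModel x ((ch d x).symm e) a ≠ 0 := fun h ↦ ha (by
      rw [← toModel_ofModel hy a, h, map_zero])
    positivity
  torsion := by
    filter_upwards [ch_target_mem (mem_ch_self x)] with e he a b
    have hy := (ch d x).map_target he
    have h1 := CovariantDerivative.torsion_apply cov (vdiffAt_constField hy a)
      (vdiffAt_constField hy b)
    rw [hcov.torsion_free, mlieBracket_constField hy, sub_zero] at h1
    have h2 := sub_eq_zero.1 h1.symm
    have h3 := congrArg (toModel x ((ch d x).symm e)) h2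
    have h4 := (hasChristoffel cov x).constField hy
    simp only [Connection.nabla] at h4
    rw [h4, h4, constField_apply hy, constField_apply hy, toModel_ofModel hy, toModel_ofModel hy,
      (ch d x).right_inv he] at h3
    exact h3
  metric := by
    have hg : ContDiffAt ℝ 1 (chartMetric x) (ch d x x) :=
      (contDiffAt_chartMetric x).of_le (WithTop.coe_le_coe.2 le_top)
    filter_upwards [ch_target_mem (mem_ch_self x), hg.eventually (by simp)] with e he hg u a b
    have hy := (ch d x).map_target he
    have h4 := (hasChristoffel cov x).constField hy
    simp only [Connection.nabla] at h4
    have h1 := hcov.metric.mvfderiv_inner_eq (constField x u) (vdiffAt_constField hy a)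
      (vdiffAt_constField hy b)
    have hs := (vdiffAt_constField hy a).inner_bundle (vdiffAt_constField hy b)
    rw [mvfderiv_eq hy hs, (ch d x).right_inv he] at h1
    have h2 : (fun y ↦ (inner ℝ (constField x a y) (constField x b y) : ℝ)) ∘ (ch d x).symm
        =ᶠ[𝓝 e] fun e ↦ chartMetric x e a b := by
      have := ch_target_mem hy
      rw [(ch d x).right_inv he] at this
      filter_upwards [this] with e' he'
      have hy' := (ch d x).map_target he'
      simp only [chartMetric, metricAt_apply, Function.comp_apply, constField_apply hy']
    rw [h2.fderiv_eq, constField_apply hy, toModel_ofModel hy,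
      fderiv_apply₂ (hg.differentiableAt (by simp))] at h1
    rw [h1]
    have h3 := chartMetric_toModel hy
    rw [(ch d x).right_inv he] at h3
    rw [(ch d x).right_inv he] at h4
    simp only [← h3, h4, toModel_ofModel hy, constField_apply hy]

end Manifold

/-! ### Covariant calculus and Ricci identities in a chart -/

section FlatCalculus
variable {F : Type*} [NormedAddCommGroup F] [NormedSpace ℝ F]
  {g : F → F →L[ℝ] F →L[ℝ] ℝ} {Γ : F → F →L[ℝ] F →L[ℝ] F} {p : F}

/-- The covariant derivative of a vector field in a chart. -/
def covVec (Γ : F → F →L[ℝ] F →L[ℝ] F) (V : F → F) (e : F) : F →L[ℝ] F :=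
  fderiv ℝ V e + (Γ e).flip (V e)

/-- The covariant derivative of a field of endomorphisms in a chart. -/
def covEnd (Γ : F → F →L[ℝ] F →L[ℝ] F) (T : F → F →L[ℝ] F) (e u : F) : F →L[ℝ] F :=
  fderiv ℝ T e u + Γ e u ∘L T e - T e ∘L Γ e u

lemma covVec_apply (V : F → F) (e u : F) : covVec Γ V e u = fderiv ℝ V e u + Γ e u (V e) := rfl

lemma covEnd_apply (T : F → F →L[ℝ] F) (e u a : F) :
    covEnd Γ T e u a = fderiv ℝ T e u a + Γ e u (T e a) - T e (Γ e u a) := rfl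

lemma covEnd_congr {T S : F → F →L[ℝ] F} (h : T =ᶠ[𝓝 p] S) (u : F) :
    covEnd Γ T p u = covEnd Γ S p u := by
  rw [covEnd, covEnd, h.fderiv_eq, h.eq_of_nhds]

lemma covVec_congr {V W : F → F} (h : V =ᶠ[𝓝 p] W) : covVec Γ V p = covVec Γ W p := by
  rw [covVec, covVec, h.fderiv_eq, h.eq_of_nhds]

lemma covEnd_add {T S : F → F →L[ℝ] F} (hT : DifferentiableAt ℝ T p) (hS : DifferentiableAt ℝ S p)
    (u a : F) : covEnd Γ (fun e ↦ T e + S e) p u a = covEnd Γ T p u a + covEnd Γ S p u a := by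
  simp only [covEnd_apply, fderiv_fun_add hT hS, add_apply, map_add]
  abel

lemma covEnd_sub {T S : F → F →L[ℝ] F} (hT : DifferentiableAt ℝ T p) (hS : DifferentiableAt ℝ S p)
    (u a : F) : covEnd Γ (fun e ↦ T e - S e) p u a = covEnd Γ T p u a - covEnd Γ S p u a := by
  simp only [covEnd_apply, fderiv_fun_sub hT hS, sub_apply, map_sub]
  abel

lemma covEnd_smul {T : F → F →L[ℝ] F} (hT : DifferentiableAt ℝ T p) (c : ℝ) (u a : F) :
    covEnd Γ (fun e ↦ c • T e) p u a = c • covEnd Γ T p u a := by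
  simp only [covEnd_apply, fderiv_fun_const_smul hT, smul_apply, map_smul, smul_add, smul_sub]

lemma covEnd_id (u a : F) : covEnd Γ (fun _ ↦ ContinuousLinearMap.id ℝ F) p u a = 0 := by
  simp [covEnd_apply]

lemma covEnd_comp {T S : F → F →L[ℝ] F} (hT : DifferentiableAt ℝ T p)
    (hS : DifferentiableAt ℝ S p) (u a : F) :
    covEnd Γ (fun e ↦ T e ∘L S e) p u a = covEnd Γ T p u (S p a) + T p (covEnd Γ S p u a) := by
  have h : fderiv ℝ (fun e ↦ T e ∘L S e) p u a = fderiv ℝ T p u (S p a) + T p (fderiv ℝ S p u a) :=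
      by
    rw [(hT.hasFDerivAt.clm_comp hS.hasFDerivAt).fderiv]
    simp [add_comm]
  simp only [covEnd_apply, h, ContinuousLinearMap.comp_apply, map_add, map_sub]
  abel

lemma covVec_clm {T : F → F →L[ℝ] F} {V : F → F} (hT : DifferentiableAt ℝ T p)
    (hV : DifferentiableAt ℝ V p) (u : F) :
    covVec Γ (fun e ↦ T e (V e)) p u = covEnd Γ T p u (V p) + T p (covVec Γ V p u) := by
  have h : fderiv ℝ (fun e ↦ T e (V e)) p u = fderiv ℝ T p u (V p) + T p (fderiv ℝ V p u) := by
    rw [(hT.hasFDerivAt.clm_apply hV.hasFDerivAt).fderiv]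
    simp [add_comm]
  simp only [covEnd_apply, covVec_apply, h, map_add]
  abel

lemma fderiv_metric (hg : DifferentiableAt ℝ g p)
    (hm : ∀ u a b, fderiv ℝ g p u a b = g p (Γ p u a) b + g p a (Γ p u b)) {V W : F → F}
    (hV : DifferentiableAt ℝ V p) (hW : DifferentiableAt ℝ W p) (u : F) :
    fderiv ℝ (fun e ↦ g e (V e) (W e)) p u
      = g p (covVec Γ V p u) (W p) + g p (V p) (covVec Γ W p u) := by
  rw [((hg.hasFDerivAt.clm_apply hV.hasFDerivAt).clm_apply hW.hasFDerivAt).fderiv]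
  simp only [add_apply, ContinuousLinearMap.comp_apply, ContinuousLinearMap.flip_apply, hm,
    covVec_apply, map_add]
  ring

/-- Differentiating g(Ta, b) = g(a, Sb) for constant a, b and using metric compatibility shows that
covariant differentiation preserves adjoint pairs. Symmetry and skew-symmetry of a field of
endomorphisms thus pass to its covariant derivative. -/
lemma covEnd_adjoint (hg : DifferentiableAt ℝ g p)
    (hm : ∀ u a b, fderiv ℝ g p u a b = g p (Γ p u a) b + g p a (Γ p u b)) {T S : F → F →L[ℝ] F}
    (hT : DifferentiableAt ℝ T p) (hS : DifferentiableAt ℝ S p)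
    (h : ∀ᶠ e in 𝓝 p, ∀ a b, g e (T e a) b = g e a (S e b)) (u a b : F) :
    g p (covEnd Γ T p u a) b = g p a (covEnd Γ S p u b) := by
  have hc (c : F) : DifferentiableAt ℝ (fun _ : F ↦ c) p := differentiableAt_const c
  have h1 := fderiv_metric hg hm (hT.clm_apply (hc a)) (hc b) u
  have h2 := fderiv_metric hg hm (hc a) (hS.clm_apply (hc b)) u
  have h3 : (fun e ↦ g e (T e a) b) =ᶠ[𝓝 p] fun e ↦ g e a (S e b) := by
    filter_upwards [h] with e he using he a b
  rw [h3.fderiv_eq, h2, covVec_clm hS (hc b), covVec_clm hT (hc a)] at h1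
  have h4 := h.self_of_nhds
  simp only [covVec_apply, fderiv_fun_const, map_add, add_apply, Pi.zero_apply,
    zero_apply, zero_add, h4] at h1
  linarith [h4 a (Γ p u b)]

lemma covEnd_smulRight (hg : DifferentiableAt ℝ g p)
    (hm : ∀ u a b, fderiv ℝ g p u a b = g p (Γ p u a) b + g p a (Γ p u b)) {V W : F → F}
    (hV : DifferentiableAt ℝ V p) (hW : DifferentiableAt ℝ W p) (u a : F) :
    covEnd Γ (fun e ↦ (g e (V e)).smulRight (W e)) p u a
      = g p (covVec Γ V p u) a • W p + g p (V p) a • covVec Γ W p u := by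
  have hc : DifferentiableAt ℝ (fun _ : F ↦ a) p := differentiableAt_const a
  have hT : DifferentiableAt ℝ (fun e ↦ (g e (V e)).smulRight (W e)) p :=
    DifferentiableAt.comp (f := fun e ↦ (g e (V e), W e))
      (g := fun q : (F →L[ℝ] ℝ) × F ↦ q.1.smulRight q.2) p
      (isBoundedBilinearMap_smulRight.differentiableAt _) ((hg.clm_apply hV).prodMk hW)
  have h1 := covVec_clm (Γ := Γ) hT hc u
  have hs : DifferentiableAt ℝ (fun e ↦ g e (V e) a) p := (hg.clm_apply hV).clm_apply hc
  have h2 : fderiv ℝ (fun e ↦ g e (V e) a • W e) p u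
      = g p (V p) a • fderiv ℝ W p u + fderiv ℝ (fun e ↦ g e (V e) a) p u • W p := by
    rw [(hs.hasFDerivAt.fun_smul hW.hasFDerivAt).fderiv]
    simp
  rw [fderiv_metric hg hm hV hc] at h2
  simp only [covVec_apply, fderiv_fun_const, ContinuousLinearMap.smulRight_apply, h2,
    Pi.zero_apply, zero_apply, zero_add, map_smul] at h1 ⊢
  rw [eq_sub_of_add_eq h1.symm]
  module

lemma differentiableAt_covVec {V : F → F} (hV : ContDiffAt ℝ 2 V p)
    (hΓ : DifferentiableAt ℝ Γ p) : DifferentiableAt ℝ (covVec Γ V) p := by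
  have h1 : DifferentiableAt ℝ (fderiv ℝ V) p :=
    (hV.fderiv_right (m := 1) le_rfl).differentiableAt (by simp)
  have h2 : DifferentiableAt ℝ (fun e ↦ (Γ e).flip (V e)) p := by
    refine DifferentiableAt.clm_apply ?_ (hV.differentiableAt (by simp))
    exact (ContinuousLinearMap.flipₗᵢ ℝ F F F).differentiableAt.comp p hΓ
  exact h1.add h2

lemma fderiv_fderiv_apply {G : Type*} [NormedAddCommGroup G] [NormedSpace ℝ G] {V : F → G}
    (hV : ContDiffAt ℝ 2 V p) (u v : F) :
    fderiv ℝ (fun e ↦ fderiv ℝ V e v) p u = fderiv ℝ (fderiv ℝ V) p u v :=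
  fderiv_apply₁ ((hV.fderiv_right (m := 1) le_rfl).differentiableAt (by simp)) u v

lemma fderiv_fderiv_comm {G : Type*} [NormedAddCommGroup G] [NormedSpace ℝ G] {V : F → G}
    (hV : ContDiffAt ℝ 2 V p) (u v : F) :
    fderiv ℝ (fderiv ℝ V) p u v = fderiv ℝ (fderiv ℝ V) p v u :=
  (hV.isSymmSndFDerivAt (by simp)).eq u v

/-- The Ricci identity for vector fields. -/
lemma covEnd_covVec_sub {V : F → F} (hV : ContDiffAt ℝ 2 V p) (hΓ : DifferentiableAt ℝ Γ p)
    (ht : ∀ a b, Γ p a b = Γ p b a) (u v : F) :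
    covEnd Γ (covVec Γ V) p u v - covEnd Γ (covVec Γ V) p v u = flatCurv Γ p u v (V p) := by
  have hVd := hV.differentiableAt (by simp)
  have key : ∀ u v, fderiv ℝ (covVec Γ V) p u v
      = fderiv ℝ (fderiv ℝ V) p u v + fderiv ℝ Γ p u v (V p) + Γ p v (fderiv ℝ V p u) := by
    intro u v
    rw [← fderiv_apply₁ (differentiableAt_covVec hV hΓ)]
    have h1 : DifferentiableAt ℝ (fun e ↦ fderiv ℝ V e v) p :=
      ((hV.fderiv_right (m := 1) le_rfl).differentiableAt (by simp)).clm_apply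
        (differentiableAt_const v)
    have h2 : DifferentiableAt ℝ (fun e ↦ Γ e v) p := hΓ.clm_apply (differentiableAt_const v)
    simp only [covVec_apply]
    rw [fderiv_fun_add h1 (h2.clm_apply hVd), add_apply, fderiv_fderiv_apply hV,
      (h2.hasFDerivAt.clm_apply hVd.hasFDerivAt).fderiv]
    simp only [add_apply, ContinuousLinearMap.comp_apply, ContinuousLinearMap.flip_apply,
      fderiv_apply₁ hΓ]
    abel
  simp only [covEnd_apply, key, flatCurv, fderiv_fderiv_comm hV u v, ht v u, covVec_apply, map_add]
  abel

/-- The Ricci identity for fields of endomorphisms. -/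
lemma covEnd_covEnd_sub {T : F → F →L[ℝ] F} (hT : ContDiffAt ℝ 2 T p)
    (hΓ : DifferentiableAt ℝ Γ p) (u v a : F) :
    covEnd Γ (fun e ↦ covEnd Γ T e v) p u a - covEnd Γ (fun e ↦ covEnd Γ T e u) p v a
      = flatCurv Γ p u v (T p a) - T p (flatCurv Γ p u v a) := by
  have hTd := hT.differentiableAt (by simp)
  have h0 : DifferentiableAt ℝ (fderiv ℝ T) p :=
    (hT.fderiv_right (m := 1) le_rfl).differentiableAt (by simp)
  have hc (v : F) : DifferentiableAt ℝ (fun _ : F ↦ v) p := differentiableAt_const v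
  have hN (v : F) : DifferentiableAt ℝ (fun e ↦ covEnd Γ T e v) p :=
    ((h0.clm_apply (hc v)).add ((hΓ.clm_apply (hc v)).clm_comp hTd)).sub
      (hTd.clm_comp (hΓ.clm_apply (hc v)))
  have key : ∀ u v, fderiv ℝ (fun e ↦ covEnd Γ T e v) p u a
      = fderiv ℝ (fderiv ℝ T) p u v a + (fderiv ℝ Γ p u v (T p a) + Γ p v (fderiv ℝ T p u a))
        - (fderiv ℝ T p u (Γ p v a) + T p (fderiv ℝ Γ p u v a)) := by
    intro u v
    rw [← fderiv_apply₁ (hN v)]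
    have h1 : DifferentiableAt ℝ (fun e ↦ fderiv ℝ T e v a) p :=
      (h0.clm_apply (hc v)).clm_apply (hc a)
    have h2 : DifferentiableAt ℝ (fun e ↦ Γ e v) p := hΓ.clm_apply (hc v)
    have h3 : DifferentiableAt ℝ (fun e ↦ T e a) p := hTd.clm_apply (hc a)
    have h4 : DifferentiableAt ℝ (fun e ↦ Γ e v a) p := h2.clm_apply (hc a)
    simp only [covEnd_apply]
    rw [fderiv_fun_sub (h1.fun_add (h2.clm_apply h3)) (hTd.clm_apply h4),
      fderiv_fun_add h1 (h2.clm_apply h3), (h2.hasFDerivAt.clm_apply h3.hasFDerivAt).fderiv,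
      (hTd.hasFDerivAt.clm_apply h4.hasFDerivAt).fderiv]
    simp only [add_apply, sub_apply, ContinuousLinearMap.comp_apply,
      ContinuousLinearMap.flip_apply, fderiv_apply₁ hΓ, fderiv_apply₁ hTd, fderiv_apply₂ h0,
      fderiv_apply₂ hΓ]
    abel
  simp only [covEnd_apply, key, flatCurv, fderiv_fderiv_comm hT u v, map_add, map_sub]
  abel

lemma flatCurv_swap (u v w : F) : flatCurv Γ p u v w = -flatCurv Γ p v u w := by
  simp only [flatCurv]; abel

/-- Symmetry of Γ near p also makes dΓ symmetric in its last two arguments; after these exchanges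
all terms of the cyclic sum cancel in pairs. -/
lemma flatCurv_bianchi (hΓ : DifferentiableAt ℝ Γ p)
    (ht : ∀ᶠ e in 𝓝 p, ∀ a b, Γ e a b = Γ e b a) (u v w : F) :
    flatCurv Γ p u v w + flatCurv Γ p v w u + flatCurv Γ p w u v = 0 := by
  have h : ∀ u a b, fderiv ℝ Γ p u a b = fderiv ℝ Γ p u b a := by
    intro u a b
    have h1 : (fun e ↦ Γ e a b) =ᶠ[𝓝 p] fun e ↦ Γ e b a := by
      filter_upwards [ht] with e he using he a b
    rw [← fderiv_apply₂ hΓ, ← fderiv_apply₂ hΓ, h1.fderiv_eq]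
  have h0 := ht.self_of_nhds
  simp only [flatCurv]
  rw [h u w v, h v w u, h u v w, h w v u, h v u w, h w u v, h0 v w, h0 u w, h0 u v]
  abel

end FlatCalculus

/-! ### Contact metric and (κ, μ) structures: the operator ∇ξ -/

section FlatContactSection
variable {F : Type*} [NormedAddCommGroup F] [NormedSpace ℝ F]

/-- The second derivative of the function g(a, b) is symmetric. Computing it twice by metric
compatibility, the mixed terms cancel in the antisymmetrisation and the two curvature terms remain.
-/
lemma IsFlatLC.metric_curv {g : F → F →L[ℝ] F →L[ℝ] ℝ} {Γ : F → F →L[ℝ] F →L[ℝ] F} {p : F}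
    (h : IsFlatLC g Γ p) (u v a b : F) :
    g p (flatCurv Γ p u v a) b = -g p a (flatCurv Γ p u v b) := by
  have hg2 : ContDiffAt ℝ 2 g p := h.smooth_g
  have hg := hg2.differentiableAt (by simp)
  have hΓ := h.smooth_Γ.differentiableAt (by simp)
  have h2 : ContDiffAt ℝ 2 (fun e ↦ g e a b) p :=
    (hg2.clm_apply contDiffAt_const).clm_apply contDiffAt_const
  have hc (a : F) : DifferentiableAt ℝ (fun _ : F ↦ a) p := differentiableAt_const a
  have hd (v a : F) : DifferentiableAt ℝ (fun e ↦ Γ e v a) p :=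
    (hΓ.clm_apply (hc v)).clm_apply (hc a)
  have hev : ∀ᶠ e in 𝓝 p, DifferentiableAt ℝ g e := by
    filter_upwards [h.smooth_g.eventually
      (by simp)] with e he using he.differentiableAt (by simp)
  have key : ∀ u v, fderiv ℝ (fderiv ℝ (fun e ↦ g e a b)) p u v
      = g p (fderiv ℝ Γ p u v a + Γ p u (Γ p v a)) b + g p (Γ p v a) (Γ p u b)
        + (g p (Γ p u a) (Γ p v b) + g p a (fderiv ℝ Γ p u v b + Γ p u (Γ p v b))) := by
    intro u v
    rw [← fderiv_fderiv_apply h2]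
    have h3 : (fun e ↦ fderiv ℝ (fun e ↦ g e a b) e v)
        =ᶠ[𝓝 p] fun e ↦ g e (Γ e v a) b + g e a (Γ e v b) := by
      filter_upwards [h.metric, hev] with e he1 he2
      rw [fderiv_apply₂ he2, he1]
    have h4 : DifferentiableAt ℝ (fun e ↦ g e (Γ e v a) b) p :=
      (hg.clm_apply (hd v a)).clm_apply (hc b)
    have h5 : DifferentiableAt ℝ (fun e ↦ g e a (Γ e v b)) p :=
      (hg.clm_apply (hc a)).clm_apply (hd v b)
    rw [h3.fderiv_eq, fderiv_fun_add h4 h5, add_apply,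
      fderiv_metric hg h.metric.self_of_nhds (hd v a) (hc b),
      fderiv_metric hg h.metric.self_of_nhds (hc a) (hd v b)]
    simp [covVec_apply, fderiv_apply₂ hΓ]
  have h6 := fderiv_fderiv_comm h2 u v
  rw [key, key] at h6
  simp only [flatCurv, map_add, map_sub, add_apply, sub_apply] at h6 ⊢
  linarith

/-- The usual octahedron argument: four Bianchi identities combined with skewness in each pair. -/
lemma IsFlatLC.pair_symm {g : F → F →L[ℝ] F →L[ℝ] ℝ} {Γ : F → F →L[ℝ] F →L[ℝ] F} {p : F}
    (h : IsFlatLC g Γ p) (u v a b : F) :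
    g p (flatCurv Γ p u v a) b = g p (flatCurv Γ p a b u) v := by
  have hB : ∀ u v w z, g p (flatCurv Γ p u v w) z + g p (flatCurv Γ p v w u) z
      + g p (flatCurv Γ p w u v) z = 0 := by
    intro u v w z
    rw [← add_apply, ← add_apply, ← map_add, ← map_add,
      flatCurv_bianchi (h.smooth_Γ.differentiableAt (by simp)) h.torsion, map_zero, zero_apply]
  have hS : ∀ u v w z, g p (flatCurv Γ p u v w) z = -g p (flatCurv Γ p v u w) z := by
    intro u v w z
    rw [flatCurv_swap, map_neg, neg_apply]
  have hM : ∀ u v w z, g p (flatCurv Γ p u v w) z = -g p (flatCurv Γ p u v z) w := by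
    intro u v w z
    rw [h.metric_curv, h.symm]
  linarith [hB u v a b, hB v a b u, hB a b u v, hB b u v a, hS u v a b, hM u v a b, hS v a u b,
    hM v a u b, hS a u v b, hM a u v b, hM a b v u, hS a b v u, hM b v a u, hS b v a u,
    hM b u a v, hS b u a v, hM u a b v, hM a b u v, hM v a b u, hM u v b a, hM b u v a,
    hM v b u a, hS v b u a, hS b v u a, hM b v u a, hS u v b a, hS u b v a, hS u b a v]

/-- A contact metric structure in a chart near `p`. -/
structure FlatContact (g : F → F →L[ℝ] F →L[ℝ] ℝ) (Γ : F → F →L[ℝ] F →L[ℝ] F)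
    (φ : F → F →L[ℝ] F) (ξ : F → F) (p : F) : Prop where
  lc : IsFlatLC g Γ p
  smooth_φ : ContDiffAt ℝ 2 φ p
  smooth_ξ : ContDiffAt ℝ 2 ξ p
  φφ : ∀ᶠ e in 𝓝 p, ∀ a, φ e (φ e a) = -a + g e (ξ e) a • ξ e
  ξξ : ∀ᶠ e in 𝓝 p, g e (ξ e) (ξ e) = 1
  φξ : ∀ᶠ e in 𝓝 p, φ e (ξ e) = 0
  skew : ∀ᶠ e in 𝓝 p, ∀ a b, g e (φ e a) b = -g e a (φ e b)
  unit : ∀ᶠ e in 𝓝 p, ∀ a, g e (covVec Γ ξ e a) (ξ e) = 0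
  contact : ∀ᶠ e in 𝓝 p, ∀ a b,
    g e (covVec Γ ξ e a) b - g e (covVec Γ ξ e b) a = 2 * g e a (φ e b)

namespace FlatContact
variable {g : F → F →L[ℝ] F →L[ℝ] ℝ} {Γ : F → F →L[ℝ] F →L[ℝ] F} {φ : F → F →L[ℝ] F}
  {ξ : F → F} {p : F} (h : FlatContact g Γ φ ξ p)
include h

lemma diff_g : DifferentiableAt ℝ g p := h.lc.smooth_g.differentiableAt (by simp)
lemma diff_Γ : DifferentiableAt ℝ Γ p := h.lc.smooth_Γ.differentiableAt (by simp)
lemma diff_φ : DifferentiableAt ℝ φ p := h.smooth_φ.differentiableAt (by simp)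
lemma diff_ξ : DifferentiableAt ℝ ξ p := h.smooth_ξ.differentiableAt (by simp)
lemma diff_A : DifferentiableAt ℝ (covVec Γ ξ) p := differentiableAt_covVec h.smooth_ξ h.diff_Γ

lemma nondeg {a : F} (ha : ∀ z, g p a z = 0) : a = 0 := by
  by_contra hne
  exact absurd (ha a) (h.lc.pos.self_of_nhds a hne).ne'

lemma eq_of_inner {a b : F} (hab : ∀ z, g p a z = g p b z) : a = b := by
  refine sub_eq_zero.1 (h.nondeg fun z ↦ ?_)
  rw [map_sub, sub_apply, hab, sub_self]

lemma ηφ (a : F) : g p (ξ p) (φ p a) = 0 := by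
  have h1 := h.skew.self_of_nhds (ξ p) a
  rw [h.φξ.self_of_nhds, map_zero, zero_apply] at h1
  linarith

/-- In the contact condition with first argument ξ, the term g(∇_b ξ, ξ) vanishes because ξ is unit
and the right side vanishes because φξ = 0. Taking b = ∇_ξ ξ shows that its norm is zero. -/
lemma A_ξ_eventually : ∀ᶠ e in 𝓝 p, covVec Γ ξ e (ξ e) = 0 := by
  filter_upwards [h.φξ, h.skew, h.unit, h.contact, h.lc.pos] with e h1 h2 h3 h4 h5
  by_contra hne
  have h6 := h4 (ξ e) (covVec Γ ξ e (ξ e))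
  have h7 := h2 (ξ e) (covVec Γ ξ e (ξ e))
  rw [h1, map_zero, zero_apply] at h7
  have h8 := h5 _ hne
  rw [h3] at h6
  linarith

lemma A_ξ : covVec Γ ξ p (ξ p) = 0 := h.A_ξ_eventually.self_of_nhds

lemma ηA (a : F) : g p (ξ p) (covVec Γ ξ p a) = 0 := by
  rw [h.lc.symm]; exact h.unit.self_of_nhds a

lemma deriv_φφ (u a : F) : covEnd Γ φ p u (φ p a) + φ p (covEnd Γ φ p u a)
    = g p (covVec Γ ξ p u) a • ξ p + g p (ξ p) a • covVec Γ ξ p u := by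
  have h1 : (fun e ↦ φ e ∘L φ e) =ᶠ[𝓝 p]
      fun e ↦ (g e (ξ e)).smulRight (ξ e) - ContinuousLinearMap.id ℝ F := by
    filter_upwards [h.φφ] with e he
    ext a
    simp [he, neg_add_eq_sub]
  have hT : DifferentiableAt ℝ (fun e ↦ (g e (ξ e)).smulRight (ξ e)) p :=
    DifferentiableAt.comp (f := fun e ↦ (g e (ξ e), ξ e))
      (g := fun q : (F →L[ℝ] ℝ) × F ↦ q.1.smulRight q.2) p
      (isBoundedBilinearMap_smulRight.differentiableAt _)
      ((h.diff_g.clm_apply h.diff_ξ).prodMk h.diff_ξ)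
  rw [← covEnd_comp h.diff_φ h.diff_φ, covEnd_congr h1,
    covEnd_sub hT (differentiableAt_const _), covEnd_id,
    covEnd_smulRight h.diff_g h.lc.metric.self_of_nhds h.diff_ξ h.diff_ξ, sub_zero]

lemma deriv_φξ (u : F) : covEnd Γ φ p u (ξ p) = -φ p (covVec Γ ξ p u) := by
  have h1 : (fun e ↦ φ e (ξ e)) =ᶠ[𝓝 p] fun _ ↦ 0 := h.φξ
  have h2 := covVec_clm (Γ := Γ) h.diff_φ h.diff_ξ u
  rw [covVec_congr h1] at h2
  simp only [covVec_apply, fderiv_fun_const, Pi.zero_apply, zero_apply, map_zero, add_zero] at h2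
  exact eq_neg_of_add_eq_zero_left h2.symm

lemma deriv_Aξ (u : F) :
    covEnd Γ (covVec Γ ξ) p u (ξ p) = -covVec Γ ξ p (covVec Γ ξ p u) := by
  have h1 : (fun e ↦ covVec Γ ξ e (ξ e)) =ᶠ[𝓝 p] fun _ ↦ 0 := h.A_ξ_eventually
  have h2 := covVec_clm (Γ := Γ) h.diff_A h.diff_ξ u
  rw [covVec_congr h1] at h2
  have h3 : covVec Γ (fun _ : F ↦ (0 : F)) p u = 0 := by simp [covVec_apply]
  rw [h3] at h2
  exact eq_neg_of_add_eq_zero_left h2.symm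

lemma deriv_skew (u a b : F) : g p (covEnd Γ φ p u a) b = -g p a (covEnd Γ φ p u b) := by
  have h1 := covEnd_adjoint (S := fun e ↦ (-1 : ℝ) • φ e) h.diff_g h.lc.metric.self_of_nhds
    h.diff_φ (h.diff_φ.const_smul (-1 : ℝ))
    (by filter_upwards [h.skew] with e he a b; simp [he]) u a b
  rw [h1, covEnd_smul h.diff_φ]
  simp

/-- The contact condition says that the adjoint of A = ∇ξ is A + 2φ, a form that `covEnd_adjoint`
can differentiate. -/
lemma deriv_contact (u a b : F) :
    g p (covEnd Γ (covVec Γ ξ) p u a) b - g p (covEnd Γ (covVec Γ ξ) p u b) a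
      = 2 * g p a (covEnd Γ φ p u b) := by
  have hs : DifferentiableAt ℝ (fun e ↦ (2 : ℝ) • φ e) p := h.diff_φ.const_smul (2 : ℝ)
  have h1 := covEnd_adjoint (T := covVec Γ ξ) (S := fun e ↦ covVec Γ ξ e + (2 : ℝ) • φ e)
    h.diff_g h.lc.metric.self_of_nhds h.diff_A (h.diff_A.add hs)
    (by
      filter_upwards [h.contact] with e he a b
      simp only [add_apply, smul_apply, map_add, map_smul, smul_eq_mul]
      rw [h.lc.symm e a]
      linarith [he a b]) u a b
  rw [h1, covEnd_add h.diff_A hs, covEnd_smul h.diff_φ, map_add,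
    map_smul, h.lc.symm p a, smul_eq_mul]
  ring

lemma ricci_ξ (u v : F) : covEnd Γ (covVec Γ ξ) p u v - covEnd Γ (covVec Γ ξ) p v u
    = flatCurv Γ p u v (ξ p) :=
  covEnd_covVec_sub h.smooth_ξ h.diff_Γ h.lc.torsion.self_of_nhds u v

/-- This is dΦ = 0 for Φ = dη. The differentiated contact condition writes ∇φ through ∇∇ξ, whose
antisymmetrisation is R(·,·)ξ by the Ricci identity; its cyclic sum is zero by Bianchi. -/
lemma cyclic (u v w : F) : g p (covEnd Γ φ p u v) w + g p (covEnd Γ φ p v w) u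
    + g p (covEnd Γ φ p w u) v = 0 := by
  have hR : ∀ u v w, g p (covEnd Γ (covVec Γ ξ) p u v) w - g p (covEnd Γ (covVec Γ ξ) p v u) w
      = -g p (ξ p) (flatCurv Γ p u v w) := by
    intro u v w
    rw [← h.lc.metric_curv, ← h.ricci_ξ, map_sub, sub_apply]
  have hB : g p (ξ p) (flatCurv Γ p u v w) + g p (ξ p) (flatCurv Γ p v w u)
      + g p (ξ p) (flatCurv Γ p w u v) = 0 := by
    rw [← map_add, ← map_add, flatCurv_bianchi h.diff_Γ h.lc.torsion, map_zero]
  have := h.deriv_contact u v w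
  have := h.deriv_contact v w u
  have := h.deriv_contact w u v
  linarith [hR u v w, hR v w u, hR w u v, h.deriv_skew u v w, h.deriv_skew v w u,
    h.deriv_skew w u v]

lemma N_ξ_eq (a : F) : covEnd Γ φ p (ξ p) a
    = -(φ p (covVec Γ ξ p a) + covVec Γ ξ p (φ p a) + (2 : ℝ) • φ p (φ p a)) := by
  refine h.eq_of_inner fun z ↦ ?_
  have h1 := h.cyclic (ξ p) a z
  have h2 := h.deriv_skew a z (ξ p)
  rw [h.deriv_φξ, map_neg, h.lc.symm p z, h.skew.self_of_nhds] at h2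
  rw [h.deriv_φξ, map_neg, neg_apply, h.skew.self_of_nhds] at h1
  have h3 := h.contact.self_of_nhds (φ p a) z
  have h4 := h.contact.self_of_nhds a (φ p z)
  have h5 := h.skew.self_of_nhds (covVec Γ ξ p a) z
  have h6 := h.skew.self_of_nhds (φ p a) z
  have h7 := h.skew.self_of_nhds a (φ p z)
  simp only [map_neg, map_add, map_smul, neg_apply, add_apply, smul_apply, smul_eq_mul]
  linarith

lemma φφ_of_η {a : F} (ha : g p (ξ p) a = 0) : φ p (φ p a) = -a := by
  rw [h.φφ.self_of_nhds, ha, zero_smul, add_zero]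

lemma A_φφ (a : F) : covVec Γ ξ p (φ p (φ p a)) = -covVec Γ ξ p a := by
  rw [h.φφ.self_of_nhds, map_add, map_smul, h.A_ξ, smul_zero, add_zero, map_neg]

/-- Let N = ∇_ξ φ. The formula `N_ξ_eq` makes N commute with φ, while differentiating φ² along ξ,
where Aξ = 0, makes it anticommute. Hence φN = 0, and since N takes values in ξ^⊥, where φ² = −1, N
= 0. -/
lemma N_ξ (a : F) : covEnd Γ φ p (ξ p) a = 0 := by
  have h1 := h.deriv_φφ (ξ p) a
  rw [h.A_ξ, map_zero, zero_apply, zero_smul, smul_zero, add_zero, h.N_ξ_eq, h.N_ξ_eq, A_φφ h] at h1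
  simp only [map_neg, map_add, map_smul, h.φφ_of_η (h.ηA a), h.φφ_of_η (h.ηφ _)] at h1
  have h2 : φ p (covEnd Γ φ p (ξ p) a) = 0 := by
    rw [h.N_ξ_eq]
    simp only [map_neg, map_add, map_smul, h.φφ_of_η (h.ηA a), h.φφ_of_η (h.ηφ _)]
    rw [← smul_right_injective F (two_ne_zero' ℝ) |>.eq_iff, smul_zero, ← h1]
    module
  have h3 : g p (ξ p) (covEnd Γ φ p (ξ p) a) = 0 := by
    rw [h.N_ξ_eq]
    simp [h.ηA, h.ηφ]
  have h4 := h.φφ_of_η h3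
  rw [h2, map_zero] at h4
  exact neg_eq_zero.1 h4.symm

lemma φA_add_Aφ (a : F) :
    φ p (covVec Γ ξ p a) + covVec Γ ξ p (φ p a) + (2 : ℝ) • φ p (φ p a) = 0 := by
  rw [← neg_eq_zero, ← h.N_ξ_eq, h.N_ξ]

lemma φA (a : F) : φ p (covVec Γ ξ p a) = -covVec Γ ξ p (φ p a) - (2 : ℝ) • φ p (φ p a) := by
  rw [← sub_eq_zero, ← h.φA_add_Aφ a]
  module

lemma Aφ (a : F) : covVec Γ ξ p (φ p a) = -φ p (covVec Γ ξ p a) - (2 : ℝ) • φ p (φ p a) := by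
  rw [h.φA]
  module

-- The hypotheses are germs at p, so every pointwise consequence also holds at nearby points and may
-- be differentiated again.
omit h in
protected lemma eventually (h : FlatContact g Γ φ ξ p) : ∀ᶠ e in 𝓝 p, FlatContact g Γ φ ξ e := by
  have hg := h.lc.smooth_g.eventually (by simp)
  have hΓ := h.lc.smooth_Γ.eventually (by simp)
  have hφ := h.smooth_φ.eventually (by simp)
  have hξ := h.smooth_ξ.eventually (by simp)
  filter_upwards [hg, hΓ, hφ, hξ, h.lc.pos.eventually_nhds, h.lc.torsion.eventually_nhds,
    h.lc.metric.eventually_nhds, h.φφ.eventually_nhds, h.ξξ.eventually_nhds,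
    h.φξ.eventually_nhds, h.skew.eventually_nhds, h.unit.eventually_nhds,
    h.contact.eventually_nhds] with e h1 h2 h3 h4 h5 h6 h7 h8 h9 h10 h11 h12 h13
  exact ⟨⟨h1, h2, h.lc.symm, h5, h6, h7⟩, h3, h4, h8, h9, h10, h11, h12, h13⟩

end FlatContact

/-- The tensor `h' = (1/2) L_ξ φ` in a chart. -/
def flatH (Γ : F → F →L[ℝ] F →L[ℝ] F) (φ : F → F →L[ℝ] F) (ξ : F → F) (e a : F) : F :=
  (1 / 2 : ℝ) • (covEnd Γ φ e (ξ e) a - covVec Γ ξ e (φ e a) + φ e (covVec Γ ξ e a))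

/-- A contact metric structure in a chart near `p`, whose Reeb field belongs to the
`(κ, μ)`-nullity distribution. -/
structure FlatKappaMu (g : F → F →L[ℝ] F →L[ℝ] ℝ) (Γ : F → F →L[ℝ] F →L[ℝ] F)
    (φ : F → F →L[ℝ] F) (ξ : F → F) (κ μ : ℝ) (p : F) : Prop extends FlatContact g Γ φ ξ p where
  nullity : ∀ᶠ e in 𝓝 p, ∀ u v, flatCurv Γ e u v (ξ e)
    = κ • (g e (ξ e) v • u - g e (ξ e) u • v)
      + μ • (g e (ξ e) v • flatH Γ φ ξ e u - g e (ξ e) u • flatH Γ φ ξ e v)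

/-- Because ∇_ξ φ = 0 and φA + Aφ = −2φ², the Lie derivative collapses. Applying φ gives the
classical form ∇ξ = −φ − φh'. -/
lemma FlatContact.flatH_eq {g : F → F →L[ℝ] F →L[ℝ] ℝ} {Γ : F → F →L[ℝ] F →L[ℝ] F}
    {φ : F → F →L[ℝ] F} {ξ : F → F} {p : F} (h : FlatContact g Γ φ ξ p) (a : F) :
    flatH Γ φ ξ p a = φ p (covVec Γ ξ p a) + φ p (φ p a) := by
  rw [flatH, h.N_ξ, h.φA]
  module

namespace FlatKappaMu
variable {g : F → F →L[ℝ] F →L[ℝ] ℝ} {Γ : F → F →L[ℝ] F →L[ℝ] F} {φ : F → F →L[ℝ] F}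
  {ξ : F → F} {κ μ : ℝ} {p : F} (h : FlatKappaMu g Γ φ ξ κ μ p)
include h

omit h in
protected lemma eventually (h : FlatKappaMu g Γ φ ξ κ μ p) :
    ∀ᶠ e in 𝓝 p, FlatKappaMu g Γ φ ξ κ μ e := by
  filter_upwards [h.toFlatContact.eventually, h.nullity.eventually_nhds] with e h1 h2
  exact ⟨h1, h2⟩

lemma φφA (a : F) : φ p (φ p (covVec Γ ξ p a)) = -covVec Γ ξ p a := h.φφ_of_η (h.ηA a)

lemma AAφ (a : F) : covVec Γ ξ p (covVec Γ ξ p (φ p a)) = φ p (covVec Γ ξ p (covVec Γ ξ p a)) := by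
  rw [h.Aφ a, map_sub, map_neg, map_smul, h.A_φφ, h.Aφ, h.φφA]
  module

/-- A Riccati equation for A along ξ: the Ricci identity for ξ in the directions ξ and a, with R(ξ,
a)ξ supplied by nullity and (∇_a A)ξ = −A² a by Aξ = 0. -/
lemma C_ξ (a : F) : covEnd Γ (covVec Γ ξ) p (ξ p) a = -covVec Γ ξ p (covVec Γ ξ p a)
    + κ • (g p (ξ p) a • ξ p - a) - μ • (φ p (covVec Γ ξ p a) + φ p (φ p a)) := by
  have h1 := h.ricci_ξ (ξ p) a
  rw [h.deriv_Aξ, h.nullity.self_of_nhds, h.ξξ.self_of_nhds, h.flatH_eq, h.flatH_eq, h.A_ξ,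
    h.φξ.self_of_nhds, map_zero] at h1
  rw [sub_eq_iff_eq_add.1 h1]
  module

/-- This is A² = κφ², equivalent to the classical h'² = (κ−1)φ². It comes from differentiating φA +
Aφ + 2φ² = 0 along ξ, where ∇_ξ φ = 0, and inserting the Riccati equation for ∇_ξ A. -/
lemma AA (a : F) : covVec Γ ξ p (covVec Γ ξ p a) = -κ • (a - g p (ξ p) a • ξ p) := by
  have h1 : (fun e ↦ (φ e ∘L covVec Γ ξ e + covVec Γ ξ e ∘L φ e) + (2 : ℝ) • (φ e ∘L φ e))
      =ᶠ[𝓝 p] fun e ↦ (0 : ℝ) • ContinuousLinearMap.id ℝ F := by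
    filter_upwards [h.toFlatContact.eventually] with e he
    ext a
    simpa using he.φA_add_Aφ a
  have d1 := h.diff_φ.clm_comp h.diff_A
  have d2 := h.diff_A.clm_comp h.diff_φ
  have d3 := h.diff_φ.clm_comp h.diff_φ
  have h2 := congrArg (fun T : F →L[ℝ] F ↦ T a) (covEnd_congr (Γ := Γ) h1 (ξ p))
  have d4 : DifferentiableAt ℝ (fun e ↦ (2 : ℝ) • (φ e ∘L φ e)) p := d3.const_smul (2 : ℝ)
  rw [covEnd_smul (differentiableAt_const _), zero_smul, covEnd_add (d1.fun_add d2) d4,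
    covEnd_add d1 d2, covEnd_smul d3, covEnd_comp h.diff_φ h.diff_A,
    covEnd_comp h.diff_A h.diff_φ, covEnd_comp h.diff_φ h.diff_φ] at h2
  simp only [h.N_ξ, h.C_ξ, map_zero, zero_add, add_zero, smul_zero, map_add, map_sub, map_neg,
    map_smul, h.φξ.self_of_nhds, h.AAφ, h.φφA, h.ηφ, zero_smul] at h2
  -- The μ-terms cancel by the anticommutation rule and A² commutes with φ, so twice the desired
  -- identity is left, up to sign.
  have h4 : φ p (covVec Γ ξ p (covVec Γ ξ p a)) = -κ • φ p a := by
    have h3 := h.φA (φ p a)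
    rw [h.A_φφ] at h3
    rw [h3] at h2
    have h4 := congrArg (fun w : F ↦ (-1 / 2 : ℝ) • w) h2
    rw [← sub_eq_zero, ← smul_zero (-1 / 2 : ℝ), ← h4]
    module
  have h5 := congrArg (φ p) h4
  rw [h.φφA, map_smul, h.φφ.self_of_nhds] at h5
  rw [← neg_inj, h5]
  module

end FlatKappaMu
end FlatContactSection

/-- The algebra behind the formula for `∇φ` on the contact distribution: `F` stands for `∇φ`
and `G` for `∇S`, where `S = -∇ξ - φ`. -/
lemma trilinear_eq_zero {V : Type*} [AddCommGroup V] [Module ℝ V] (F G : V →ₗ[ℝ] V →ₗ[ℝ] V →ₗ[ℝ] ℝ)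
    (J S : V →ₗ[ℝ] V) {l : ℝ} (hl : l ≠ 0) (hJ : ∀ a, J (J a) = -a) (hS : ∀ a, S (S a) = (l * l) •
        a)
    (hJS : ∀ a, J (S a) = -S (J a)) (hF : ∀ x y z, F x y z = -F x z y)
    (hG : ∀ x y z, G x y z = G x z y) (h1 : ∀ x y z, G x y z - G y x z = F z x y)
    (h2 : ∀ z x y, F z (J x) (J y) = -F z x y)
    (h3 : ∀ x y z, G x (J y) z - G x y (J z) = -F x (S y) z - F x y (S z))
    (h4 : ∀ x y z, G x (S y) z + G x y (S z) = 0) (x y z : V) : F x y z = 0 := by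
  -- The plan is to split V into the two eigenspaces of S, which J exchanges. Differentiating S² =
  -- l² gives `h4`, so G vanishes when its last two arguments lie in the same eigenspace. All steps
  -- are stated for an arbitrary eigenvalue, so that they apply to l and to −l.
  have ha : ∀ l : ℝ, l ≠ 0 → ∀ x y z : V, S y = l • y → S z = l • z → G x y z = 0 := by
    intro l hl x y z hy hz
    have := h4 x y z
    rw [hy, hz] at this
    simp only [map_smul, LinearMap.smul_apply, smul_eq_mul] at this
    have h5 : l * G x y z = 0 := by linarith
    exact (mul_eq_zero.1 h5).resolve_left hl
  have hJE : ∀ (l : ℝ) (y : V), S y = l • y → S (J y) = (-l) • J y := by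
    intro l y hy
    rw [← neg_inj, ← hJS, hy, map_smul, neg_smul, neg_neg]
  have hJE' : ∀ (l : ℝ) (y : V), S y = (-l) • y → S (-J y) = l • (-J y) := by
    intro l y hy
    rw [map_neg, hJE _ y hy, neg_neg, smul_neg]
  have hb : ∀ l : ℝ, l ≠ 0 → ∀ x y z : V, S x = l • x → S y = l • y → S z = l • z →
      F x y z = 0 := by
    intro l hl x y z hx hy hz
    rw [← h1, ha l hl y z x hz hx, ha l hl z y x hy hx, sub_zero]
  -- On one eigenspace the form G(x, Jy, z) is symmetric in y, z by `h3`, and skew in x, y by `h1`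
  -- and `h2`. A trilinear form with both properties is zero.
  have hGJ : ∀ l : ℝ, l ≠ 0 → ∀ x y z : V, S x = l • x → S y = l • y → S z = l • z →
      G x (J y) z = 0 := by
    intro l hl
    have hs : ∀ x y z : V, S x = l • x → S y = l • y → S z = l • z →
        G x (J y) z = G x (J z) y := by
      intro x y z hx hy hz
      have := h3 x y z
      rw [hy, hz] at this
      simp only [map_smul, LinearMap.smul_apply, smul_eq_mul, hb l hl x y z hx hy hz] at this
      rw [hG x y] at this
      linarith
    have ht : ∀ x y z : V, S x = l • x → S y = l • y → S z = l • z →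
        G x (J y) z = -G y (J x) z := by
      intro x y z hx hy hz
      have e1 := h1 x (J y) z
      rw [ha l hl (J y) x z hx hz] at e1
      have e2 := h1 y (J x) z
      rw [ha l hl (J x) y z hy hz] at e2
      have e3 := h2 z x (J y)
      rw [hJ, map_neg] at e3
      have e4 := hF z (J x) y
      linarith
    intro x y z hx hy hz
    linarith [hs x y z hx hy hz, ht x z y hx hz hy, hs z x y hz hx hy, ht z y x hz hy hx,
      hs y z x hy hz hx, ht y x z hy hx hz]
  have hc : ∀ l : ℝ, l ≠ 0 → ∀ x y z : V, S x = l • x → S y = l • y → S z = (-l) • z →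
      F x y z = 0 := by
    intro l hl x y z hx hy hz
    obtain ⟨w, hw, rfl⟩ : ∃ w, S w = l • w ∧ z = J w :=
      ⟨-J z, hJE' l z hz, by rw [map_neg, hJ, neg_neg]⟩
    -- With z = Jw, `h1` expresses F through G(y, Jw, x) and G(Jw, y, x). The second vanishes by
    -- `ha`, the first by `hGJ`.
    rw [← h1, hG, hGJ l hl y x w hy hx hw |> fun _ ↦ ha l hl (J w) y x hy hx, sub_zero, hG]
    exact hGJ l hl y w x hy hw hx
  have hd : ∀ l : ℝ, l ≠ 0 → ∀ x y z : V, S x = (-l) • x → S y = l • y → S z = l • z →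
      F x y z = 0 := by
    intro l hl x y z hx hy hz
    obtain ⟨w, hw, rfl⟩ : ∃ w, S w = l • w ∧ x = J w :=
      ⟨-J x, hJE' l x hx, by rw [map_neg, hJ, neg_neg]⟩
    rw [← h1, hG, hGJ l hl y w z hy hw hz, hG, hGJ l hl z w y hz hw hy, sub_zero]
  have he : ∀ l : ℝ, l ≠ 0 → ∀ x y z : V, S x = l • x → (S y = l • y ∨ S y = (-l) • y) →
      (S z = l • z ∨ S z = (-l) • z) → F x y z = 0 := by
    rintro l hl x y z hx (hy | hy) (hz | hz)
    · exact hb l hl x y z hx hy hz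
    · exact hc l hl x y z hx hy hz
    · rw [hF, hc l hl x z y hx hz hy, neg_zero]
    -- Two arguments in the (−l)-eigenspace: the preceding case with the roles of the eigenspaces
    -- exchanged.
    · exact hd (-l) (neg_ne_zero.2 hl) x y z (by rwa [neg_neg]) hy hz
  have hp : ∀ a : V, ∃ b c : V, S b = l • b ∧ S c = (-l) • c ∧ a = b + c := by
    intro a
    refine ⟨(1 / (2 * l)) • (l • a + S a), (1 / (2 * l)) • (l • a - S a), ?_, ?_, ?_⟩
    · simp only [map_smul, map_add, hS]
      module
    · simp only [map_smul, map_sub, hS]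
      module
    · have : (1 / (2 * l)) • (l • a + S a) + (1 / (2 * l)) • (l • a - S a)
          = (1 / (2 * l) * (2 * l)) • a := by module
      rw [this, one_div_mul_cancel (by simpa using hl), one_smul]
  have hf : ∀ l : ℝ, l ≠ 0 → (∀ a : V, ∃ b c : V, S b = l • b ∧ S c = (-l) • c ∧ a = b + c) →
      ∀ x y z : V, S x = l • x → F x y z = 0 := by
    intro l hl hp x y z hx
    obtain ⟨y1, y2, hy1, hy2, rfl⟩ := hp y
    obtain ⟨z1, z2, hz1, hz2, rfl⟩ := hp z
    simp [he l hl x y1 z1 hx (.inl hy1) (.inl hz1), he l hl x y1 z2 hx (.inl hy1) (.inr hz2),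
      he l hl x y2 z1 hx (.inr hy2) (.inl hz1), he l hl x y2 z2 hx (.inr hy2) (.inr hz2)]
  obtain ⟨x1, x2, hx1, hx2, rfl⟩ := hp x
  have hp' : ∀ a : V, ∃ b c : V, S b = (-l) • b ∧ S c = (- -l) • c ∧ a = b + c := by
    intro a
    obtain ⟨b, c, hb, hc, rfl⟩ := hp a
    exact ⟨c, b, hc, by rwa [neg_neg], add_comm _ _⟩
  rw [map_add, LinearMap.add_apply, LinearMap.add_apply, hf l hl hp x1 y z hx1,
    hf (-l) (neg_ne_zero.2 hl) hp' x2 y z hx2, add_zero]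

/-! ### The covariant derivative of φ -/

section FlatContactSection
variable {F : Type*} [NormedAddCommGroup F] [NormedSpace ℝ F]

lemma covEnd_add_left (Γ : F → F →L[ℝ] F →L[ℝ] F) (T : F → F →L[ℝ] F) (p u v : F) :
    covEnd Γ T p (u + v) = covEnd Γ T p u + covEnd Γ T p v := by
  ext a
  simp only [covEnd_apply, map_add, add_apply]
  abel

lemma covEnd_smul_left (Γ : F → F →L[ℝ] F →L[ℝ] F) (T : F → F →L[ℝ] F) (p : F) (c : ℝ) (u : F) :
    covEnd Γ T p (c • u) = c • covEnd Γ T p u := by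
  ext a
  simp only [covEnd_apply, map_smul, smul_apply]
  module

/-- The covariant derivative of a field of endomorphisms as a trilinear form on a subspace. -/
def covTri (g : F →L[ℝ] F →L[ℝ] ℝ) (Γ : F → F →L[ℝ] F →L[ℝ] F) (T : F → F →L[ℝ] F) (p : F)
    (V : Submodule ℝ F) : V →ₗ[ℝ] V →ₗ[ℝ] V →ₗ[ℝ] ℝ :=
  LinearMap.mk₂ ℝ (fun x y ↦ (g (covEnd Γ T p x y)).toLinearMap.comp V.subtype)
    (fun x x' y ↦ by ext; simp [covEnd_add_left])
    (fun c x y ↦ by ext; simp [covEnd_smul_left])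
    (fun x y y' ↦ by ext; simp)
    (fun c x y ↦ by ext; simp)

namespace FlatKappaMu
variable {g : F → F →L[ℝ] F →L[ℝ] ℝ} {Γ : F → F →L[ℝ] F →L[ℝ] F} {φ : F → F →L[ℝ] F}
  {ξ : F → F} {κ μ : ℝ} {p : F} (h : FlatKappaMu g Γ φ ξ κ μ p)
include h

lemma g_φφ (a b : F) : g p (φ p a) (φ p b) = g p a b - g p (ξ p) a * g p (ξ p) b := by
  have h1 := h.skew.self_of_nhds a (φ p b)
  rw [h1, h.φφ.self_of_nhds]
  simp only [map_add, map_neg, map_smul, smul_eq_mul, h.lc.symm p a (ξ p)]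
  ring

lemma A_symm (a b : F) : g p (covVec Γ ξ p a) b = g p (covVec Γ ξ p b) a + 2 * g p a (φ p b) := by
  rw [← h.contact.self_of_nhds]; ring

/-- The operator S = −A − φ is φh'. Expanding its square and using A² = κφ² and φA + Aφ = −2φ²
leaves (κ−1)φ². -/
lemma SS (a : F) : -covVec Γ ξ p (-covVec Γ ξ p a - φ p a) - φ p (-covVec Γ ξ p a - φ p a)
    = (1 - κ) • (a - g p (ξ p) a • ξ p) := by
  simp only [map_sub, map_neg, h.AA, h.Aφ, h.φφ.self_of_nhds]
  module

lemma S_symm (a b : F) : g p (-covVec Γ ξ p a - φ p a) b = g p a (-covVec Γ ξ p b - φ p b) := by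
  simp only [map_sub, map_neg, sub_apply, neg_apply, h.skew.self_of_nhds a b, h.A_symm a b,
    h.lc.symm p a (covVec Γ ξ p b)]
  ring

omit h in
/-- `∇φ` vanishes on the contact distribution. -/
lemma covEnd_φ_eq_zero (h : FlatKappaMu g Γ φ ξ κ μ p) {x y z : F} (hx : g p (ξ p) x = 0)
    (hy : g p (ξ p) y = 0) (hz : g p (ξ p) z = 0) : g p (covEnd Γ φ p x y) z = 0 := by
  have hdS : DifferentiableAt ℝ (fun e ↦ -covVec Γ ξ e - φ e) p := h.diff_A.neg.sub h.diff_φ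
  have hevent := h.eventually
  have hG : ∀ x y z, g p (covEnd Γ (fun e ↦ -covVec Γ ξ e - φ e) p x y) z
      = g p (covEnd Γ (fun e ↦ -covVec Γ ξ e - φ e) p x z) y := by
    intro x y z
    rw [covEnd_adjoint h.diff_g h.lc.metric.self_of_nhds hdS hdS
      (by filter_upwards [hevent] with e he a b using he.S_symm a b), h.lc.symm]
  have hGC : ∀ x y, covEnd Γ (fun e ↦ -covVec Γ ξ e - φ e) p x y
      = -covEnd Γ (covVec Γ ξ) p x y - covEnd Γ φ p x y := by
    intro x y
    have hA' : DifferentiableAt ℝ (fun e ↦ -covVec Γ ξ e) p := h.diff_A.neg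
    have h1 : (fun e ↦ -covVec Γ ξ e) = fun e ↦ (-1 : ℝ) • covVec Γ ξ e := by
      ext; simp
    rw [covEnd_sub hA' h.diff_φ, h1, covEnd_smul h.diff_A, neg_one_smul]
  have hcyc := h.cyclic
  have hskew := h.deriv_skew
  have hR : ∀ x y, g p (ξ p) x = 0 → g p (ξ p) y = 0 →
      covEnd Γ (covVec Γ ξ) p x y = covEnd Γ (covVec Γ ξ) p y x := by
    intro x y hx hy
    rw [← sub_eq_zero, h.ricci_ξ, h.nullity.self_of_nhds, hx, hy]
    simp
  -- On ξ^⊥ nullity gives R(x, y)ξ = 0, so ∇A is symmetric there. The antisymmetrisation of ∇S = −∇A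
  -- − ∇φ is then that of −∇φ, which the cyclic identity rewrites as ∇_z φ.
  have h1 : ∀ x y z, g p (ξ p) x = 0 → g p (ξ p) y = 0 →
      g p (covEnd Γ (fun e ↦ -covVec Γ ξ e - φ e) p x y) z
        - g p (covEnd Γ (fun e ↦ -covVec Γ ξ e - φ e) p y x) z = g p (covEnd Γ φ p z x) y := by
    intro x y z hx hy
    rw [hGC, hGC, hR x y hx hy]
    simp only [map_sub, map_neg, sub_apply, neg_apply]
    rw [hskew y x z, h.lc.symm p x]
    linarith [hcyc x y z]
  set V : Submodule ℝ F := LinearMap.ker (g p (ξ p)).toLinearMap with hV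
  have hmem : ∀ a : V, g p (ξ p) a = 0 := fun a ↦ a.2
  -- On ξ^⊥ the self-adjoint S has square 1 − κ. For κ < 1 its eigenvalues are ±√(1−κ) and
  -- `trilinear_eq_zero` applies; for κ = 1 it vanishes near p, hence so does ∇S; for κ > 1 the
  -- square would be negative, so ξ^⊥ = 0.
  rcases lt_trichotomy κ 1 with hκ | rfl | hκ
  · let l := √(1 - κ)
    have hl : l ≠ 0 := (Real.sqrt_pos.2 (by linarith)).ne'
    have hll : l * l = 1 - κ := Real.mul_self_sqrt (by linarith)
    let J : V →ₗ[ℝ] V := (φ p).toLinearMap.restrict (p := V) (q := V) fun a _ ↦ h.ηφ a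
    let S : V →ₗ[ℝ] V := (-covVec Γ ξ p - φ p).toLinearMap.restrict (p := V) (q := V) fun a _ ↦ by
      change g p (ξ p) (-covVec Γ ξ p a - φ p a) = 0
      rw [map_sub, map_neg, h.ηA, h.ηφ, neg_zero, sub_zero]
    have hSv : ∀ a : V, (S a : F) = -covVec Γ ξ p a - φ p a := fun a ↦ rfl
    have hJv : ∀ a : V, (J a : F) = φ p a := fun a ↦ rfl
    refine trilinear_eq_zero (covTri (g p) Γ φ p V)
      (covTri (g p) Γ (fun e ↦ -covVec Γ ξ e - φ e) p V) J S hl ?_ ?_ ?_ ?_ ?_ ?_ ?_ ?_ ?_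
      ⟨x, hx⟩ ⟨y, hy⟩ ⟨z, hz⟩
    · exact fun a ↦ Subtype.ext (h.φφ_of_η (hmem a))
    · intro a
      have := h.SS a
      rw [hmem a, zero_smul, sub_zero] at this
      exact Subtype.ext (by rw [hll]; exact this)
    · intro a
      refine Subtype.ext ?_
      change φ p (-covVec Γ ξ p a - φ p a) = -(-covVec Γ ξ p (φ p a) - φ p (φ p a))
      rw [h.Aφ, map_sub, map_neg]
      module
    · intro x y z
      change g p (covEnd Γ φ p x y) z = -g p (covEnd Γ φ p x z) y
      rw [hskew, h.lc.symm]
    · exact fun x y z ↦ hG x y z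
    · exact fun x y z ↦ h1 x y z (hmem x) (hmem y)
    · intro z x y
      change g p (covEnd Γ φ p z (φ p x)) (φ p y) = -g p (covEnd Γ φ p z x) y
      rw [eq_sub_of_add_eq (h.deriv_φφ z x), hmem x, zero_smul, add_zero, map_sub, sub_apply,
        map_smul, smul_apply, h.ηφ, h.g_φφ, hmem y]
      simp
    · intro x y z
      change g p (covEnd Γ (fun e ↦ -covVec Γ ξ e - φ e) p x (φ p y)) z
        - g p (covEnd Γ (fun e ↦ -covVec Γ ξ e - φ e) p x y) (φ p z)
        = -g p (covEnd Γ φ p x (-covVec Γ ξ p y - φ p y)) z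
          - g p (covEnd Γ φ p x y) (-covVec Γ ξ p z - φ p z)
      -- Condition `h3` of the algebraic lemma is the covariant derivative of φS + Sφ = 0.
      have e1 : (fun e ↦ φ e ∘L (-covVec Γ ξ e - φ e) + (-covVec Γ ξ e - φ e) ∘L φ e) =ᶠ[𝓝 p]
          fun e ↦ (0 : ℝ) • ContinuousLinearMap.id ℝ F := by
        filter_upwards [hevent] with e he
        ext a
        simp only [add_apply, ContinuousLinearMap.comp_apply, sub_apply, neg_apply, he.Aφ, map_sub,
          map_neg, zero_smul, zero_apply]
        module
      have e2 := congrArg (fun T : F →L[ℝ] F ↦ T y) (covEnd_congr (Γ := Γ) e1 x)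
      rw [covEnd_smul (differentiableAt_const _), zero_smul,
        covEnd_add (h.diff_φ.clm_comp hdS) (hdS.clm_comp h.diff_φ), covEnd_comp h.diff_φ hdS,
        covEnd_comp hdS h.diff_φ] at e2
      have e3 := congrArg (fun w ↦ g p w z) e2
      simp only [sub_apply, neg_apply] at e3
      rw [map_zero, zero_apply, map_add, map_add, map_add, add_apply, add_apply, add_apply,
        h.S_symm, h.skew.self_of_nhds] at e3
      linarith
    · intro x y z
      change g p (covEnd Γ (fun e ↦ -covVec Γ ξ e - φ e) p x (-covVec Γ ξ p y - φ p y)) z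
        + g p (covEnd Γ (fun e ↦ -covVec Γ ξ e - φ e) p x y) (-covVec Γ ξ p z - φ p z) = 0
      -- Condition `h4` is the covariant derivative of S² = (1−κ)(1 − η⊗ξ); the derivatives of η and
      -- ξ disappear when tested on ξ^⊥.
      have e1 : (fun e ↦ (-covVec Γ ξ e - φ e) ∘L (-covVec Γ ξ e - φ e)) =ᶠ[𝓝 p]
          fun e ↦ (1 - κ) • (ContinuousLinearMap.id ℝ F - (g e (ξ e)).smulRight (ξ e)) := by
        filter_upwards [hevent] with e he
        ext a
        exact he.SS a
      have hT : DifferentiableAt ℝ (fun e ↦ (g e (ξ e)).smulRight (ξ e)) p :=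
        DifferentiableAt.comp (f := fun e ↦ (g e (ξ e), ξ e))
          (g := fun q : (F →L[ℝ] ℝ) × F ↦ q.1.smulRight q.2) p
          (isBoundedBilinearMap_smulRight.differentiableAt _)
          ((h.diff_g.clm_apply h.diff_ξ).prodMk h.diff_ξ)
      have e2 := congrArg (fun T : F →L[ℝ] F ↦ g p (T y) z) (covEnd_congr (Γ := Γ) e1 x)
      rw [covEnd_smul ((differentiableAt_const _).fun_sub hT),
        covEnd_sub (differentiableAt_const _) hT, covEnd_id,
        covEnd_smulRight h.diff_g h.lc.metric.self_of_nhds h.diff_ξ h.diff_ξ, hmem y, zero_smul,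
        covEnd_comp hdS hdS] at e2
      have e3 := h.S_symm (covEnd Γ (fun e ↦ -covVec Γ ξ e - φ e) p x y) z
      simp only [map_add, map_sub, map_neg, map_smul, map_zero, add_apply, sub_apply, neg_apply,
        smul_apply, zero_apply, hmem z, smul_zero, add_zero, sub_zero] at e2 e3 ⊢
      linarith
  · have e1 : (fun e ↦ -covVec Γ ξ e - φ e) =ᶠ[𝓝 p] fun e ↦ (0 : ℝ) • ContinuousLinearMap.id ℝ F :=
        by
      filter_upwards [hevent] with e he
      ext a
      by_contra hne
      rw [zero_smul, zero_apply] at hne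
      have e2 := he.lc.pos.self_of_nhds _ hne
      rw [sub_apply, neg_apply, he.S_symm, he.SS] at e2
      simp at e2
    rw [← h1 y z x hy hz]
    rw [covEnd_congr e1, covEnd_congr e1, covEnd_smul (differentiableAt_const _),
      covEnd_smul (differentiableAt_const _)]
    simp
  · have e2 := h.S_symm x (-covVec Γ ξ p x - φ p x)
    rw [h.SS, hx, zero_smul, sub_zero, map_smul, smul_eq_mul] at e2
    have e3 : x = 0 := by
      by_contra hne
      have e4 := h.lc.pos.self_of_nhds x hne
      have e5 : 0 ≤ g p (-covVec Γ ξ p x - φ p x) (-covVec Γ ξ p x - φ p x) := by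
        by_cases hz : -covVec Γ ξ p x - φ p x = 0
        · rw [hz, map_zero]
        · exact (h.lc.pos.self_of_nhds _ hz).le
      nlinarith
    rw [e3, ← zero_smul ℝ (0 : F), covEnd_smul_left]
    simp

/-- The covariant derivative of `φ` on a `(κ, μ)`-contact metric manifold. -/
lemma covEnd_φ (u a : F) : covEnd Γ φ p u a
    = g p (φ p (covVec Γ ξ p u)) a • ξ p - g p (ξ p) a • φ p (covVec Γ ξ p u) := by
  refine h.eq_of_inner fun z ↦ ?_
  have hπ : ∀ a, g p (ξ p) (a - g p (ξ p) a • ξ p) = 0 := by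
    intro a
    rw [map_sub, map_smul, h.ξξ.self_of_nhds, smul_eq_mul, mul_one, sub_self]
  have hN : covEnd Γ φ p (ξ p) = 0 := by
    ext a
    exact h.N_ξ a
  -- All three arguments are projected to ξ^⊥. The discarded ξ-components are known: ∇_ξ φ = 0, (∇_u
  -- φ)ξ = −φ∇_u ξ, and ∇_u φ is skew.
  have h1 := covEnd_φ_eq_zero h (hπ u) (hπ a) (hπ z)
  have h2 : covEnd Γ φ p (u - g p (ξ p) u • ξ p) = covEnd Γ φ p u := by
    rw [sub_eq_add_neg, ← neg_smul, covEnd_add_left, covEnd_smul_left, hN, smul_zero, add_zero]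
  rw [h2] at h1
  have h3 := h.deriv_skew u a (ξ p)
  rw [h.deriv_φξ] at h3
  have h4 := h.lc.symm p a (φ p (covVec Γ ξ p u))
  have h5 := h.ηφ (covVec Γ ξ p u)
  rw [h.lc.symm] at h5
  simp only [map_sub, map_smul, map_neg, sub_apply, smul_apply, neg_apply, h.deriv_φξ, smul_eq_mul,
    h5] at h1 h3 ⊢
  rw [h3, h4] at h1
  linarith


end FlatKappaMu
end FlatContactSection

/-! ### Algebraic curvature tensors -/

section AlgebraicCurvature
variable {V : Type*} [AddCommGroup V] [Module ℝ V]

/-- An algebraic curvature tensor. -/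
structure IsAlgCurv (R : V → V → V → V → ℝ) : Prop where
  swap : ∀ u v w z, R u v w z = -R v u w z
  skew : ∀ u v w z, R u v w z = -R u v z w
  pair : ∀ u v w z, R u v w z = R w z u v
  bianchi : ∀ u v w z, R u v w z + R v w u z + R w u v z = 0
  add : ∀ u u' v w z, R (u + u') v w z = R u v w z + R u' v w z
  smul : ∀ (r : ℝ) u v w z, R (r • u) v w z = r * R u v w z

namespace IsAlgCurv
variable {R R' : V → V → V → V → ℝ}

lemma linComb (h : IsAlgCurv R) (h' : IsAlgCurv R') (r r' : ℝ) :
    IsAlgCurv fun u v w z ↦ r * R u v w z + r' * R' u v w z where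
  swap u v w z := by rw [h.swap, h'.swap]; ring
  skew u v w z := by rw [h.skew, h'.skew]; ring
  pair u v w z := by rw [h.pair, h'.pair]
  bianchi u v w z := by linear_combination r * h.bianchi u v w z + r' * h'.bianchi u v w z
  add u u' v w z := by rw [h.add, h'.add]; ring
  smul t u v w z := by rw [h.smul, h'.smul]; ring

lemma add₂ (h : IsAlgCurv R) (u v v' w z : V) : R u (v + v') w z = R u v w z + R u v' w z := by
  rw [h.swap, h.add, h.swap v, h.swap v']; ring
lemma add₃ (h : IsAlgCurv R) (u v w w' z : V) : R u v (w + w') z = R u v w z + R u v w' z := by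
  rw [h.pair, h.add, h.pair w, h.pair w']
lemma add₄ (h : IsAlgCurv R) (u v w z z' : V) : R u v w (z + z') = R u v w z + R u v w z' := by
  rw [h.skew, h.add₃, h.skew u v z, h.skew u v z']; ring
lemma smul₂ (h : IsAlgCurv R) (r : ℝ) (u v w z : V) : R u (r • v) w z = r * R u v w z := by
  rw [h.swap, h.smul, h.swap v]; ring
lemma smul₃ (h : IsAlgCurv R) (r : ℝ) (u v w z : V) : R u v (r • w) z = r * R u v w z := by
  rw [h.pair, h.smul, h.pair w]
lemma smul₄ (h : IsAlgCurv R) (r : ℝ) (u v w z : V) : R u v w (r • z) = r * R u v w z := by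
  rw [h.skew, h.smul₃, h.skew u v z]; ring
lemma neg₁ (h : IsAlgCurv R) (u v w z : V) : R (-u) v w z = -R u v w z := by
  rw [← neg_one_smul ℝ, h.smul, neg_one_mul]
lemma neg₂ (h : IsAlgCurv R) (u v w z : V) : R u (-v) w z = -R u v w z := by
  rw [← neg_one_smul ℝ v, h.smul₂, neg_one_mul]
lemma neg₃ (h : IsAlgCurv R) (u v w z : V) : R u v (-w) z = -R u v w z := by
  rw [← neg_one_smul ℝ w, h.smul₃, neg_one_mul]
lemma neg₄ (h : IsAlgCurv R) (u v w z : V) : R u v w (-z) = -R u v w z := by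
  rw [← neg_one_smul ℝ z, h.smul₄, neg_one_mul]

/-- Half a Kulkarni–Nomizu square. Together with `of_skewForm`, the Kähler-form part of a complex
space form, it supplies the pieces of the model curvature. -/
lemma wedge {b : V →ₗ[ℝ] V →ₗ[ℝ] ℝ} (hb : ∀ u v, b u v = b v u) :
    IsAlgCurv fun u v w z ↦ b v w * b u z - b u w * b v z where
  swap u v w z := by ring
  skew u v w z := by ring
  pair u v w z := by rw [hb z u, hb w v, hb w u, hb z v]; ring
  bianchi u v w z := by rw [hb w u, hb v u, hb w v]; ring
  add u u' v w z := by simp only [map_add, LinearMap.add_apply]; ring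
  smul r u v w z := by simp only [map_smul, LinearMap.smul_apply, smul_eq_mul]; ring

lemma of_skewForm {b : V →ₗ[ℝ] V →ₗ[ℝ] ℝ} (hb : ∀ u v, b u v = -b v u) :
    IsAlgCurv fun u v w z ↦ -2 * b u v * b w z - b u w * b v z + b v w * b u z where
  swap u v w z := by rw [hb u v]; ring
  skew u v w z := by rw [hb w z]; ring
  pair u v w z := by rw [hb z u, hb w v, hb w u, hb z v]; ring
  bianchi u v w z := by rw [hb w u, hb v u, hb w v]; ring
  add u u' v w z := by simp only [map_add, LinearMap.add_apply]; ring
  smul r u v w z := by simp only [map_smul, LinearMap.smul_apply, smul_eq_mul]; ring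

/-- A curvature tensor of Kähler type with vanishing holomorphic sectional curvature has vanishing
sectional curvature. -/
lemma sectional_eq_zero (h : IsAlgCurv R) {J : V →ₗ[ℝ] V} (hJ : ∀ a, J (J a) = -a)
    (hK : ∀ u v w z, R u v (J w) (J z) = R u v w z) (h0 : ∀ u, R u (J u) (J u) u = 0) (u v : V) :
    R u v v u = 0 := by
  have hK' : ∀ u v w z, R (J u) (J v) w z = R u v w z := by
    intro u v w z; rw [h.pair, hK, h.pair]
  -- Polarise R(u, Ju, Ju, u) = 0 by adding the identities for u + v and u − v, and reduce the mixed
  -- terms with J-invariance and Bianchi. Applying the result to v and to Jv gives two independent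
  -- equations for the same two numbers.
  have key : ∀ u v, R u v v u + 3 * R u (J v) (J v) u = 0 := by
    intro u v
    have h1 := h0 (u + v)
    have h2 := h0 (u + -v)
    simp only [map_add, map_neg, h.add, h.add₂, h.add₃, h.add₄, h.neg₁, h.neg₂, h.neg₃,
      h.neg₄, h0] at h1 h2
    have e1 : R v (J u) (J u) v = R u (J v) (J v) u := by
      rw [← hK' v, hJ, h.neg₂, ← hK _ _ (J u), hJ, h.neg₃, neg_neg, h.swap, h.skew, neg_neg]
    have e2 : ∀ u v, R u (J v) (J u) v = R u (J v) (J v) u := by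
      intro u v
      rw [← hK _ _ (J u), hJ, h.neg₃, ← h.skew]
    have e3 : ∀ u v, R u (J u) (J v) v = R u v v u + R u (J v) (J v) u := by
      intro u v
      have := h.bianchi u (J u) (J v) v
      rw [hK', h.skew u v, h.swap (J v) u, e2] at this
      linarith
    have e4 := e3 v u
    have e5 := e2 v u
    have e6 : R v u u v = R u v v u := by rw [h.swap, h.skew, neg_neg]
    rw [e3] at h1 h2
    rw [e2 u v] at h1 h2
    rw [e4, e5, e6, e1] at h1 h2
    linarith
  have h1 := key u v
  have h2 := key u (J v)
  rw [hJ, h.neg₂, h.neg₃, neg_neg] at h2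
  linarith

/-- The curvature tensor of a `(κ, μ)`-contact space form on the contact distribution. -/
lemma sectional_eq (h : IsAlgCurv R) {g : V →ₗ[ℝ] V →ₗ[ℝ] ℝ} (hg : ∀ u v, g u v = g v u)
    {J H : V →ₗ[ℝ] V} (hJ : ∀ a, J (J a) = -a) (hJg : ∀ a b, g (J a) b = -g a (J b))
    (hH : ∀ a b, g (H a) b = g (H b) a) (hJH : ∀ a, J (H a) = -H (J a))
    (hR : ∀ u v w z, R u v (J w) z + R u v w (J z)
      = (g v w + g (H v) w) * (g u (J z) + g (H u) (J z))
        - (g u (J w) + g (H u) (J w)) * (g v z + g (H v) z)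
        - (g u w + g (H u) w) * (g v (J z) + g (H v) (J z))
        + (g v (J w) + g (H v) (J w)) * (g u z + g (H u) z)) {c : ℝ}
    (hc : ∀ u, R u (J u) (J u) u = c * g u u ^ 2) (u v : V) :
    R u v v u = (g u u + g (H u) u) * (g v v + g (H v) v) - (g u v + g (H u) v) ^ 2
      - 1 / 2 * (g (H u) u * g (H v) v - g (H u) v ^ 2
        + g (J (H u)) u * g (J (H v)) v - g (J (H u)) v ^ 2)
      + (c - 1) / 4 * (g u u * g v v - g u v ^ 2 + 3 * g u (J v) ^ 2) := by
  let s : V →ₗ[ℝ] V →ₗ[ℝ] ℝ := g ∘ₗ J ∘ₗ H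
  let k : V →ₗ[ℝ] V →ₗ[ℝ] ℝ := g ∘ₗ H
  let b : V →ₗ[ℝ] V →ₗ[ℝ] ℝ := g + k
  let q : V →ₗ[ℝ] V →ₗ[ℝ] ℝ := g.compl₂ J
  have hkv : ∀ u v, k u v = g (H u) v := fun _ _ ↦ rfl
  have hsv : ∀ u v, s u v = -k u (J v) := fun u v ↦ hJg _ _
  have hbv : ∀ u v, b u v = g u v + k u v := fun _ _ ↦ rfl
  have hqv : ∀ u v, q u v = g u (J v) := fun _ _ ↦ rfl
  have hk : ∀ u v, k u v = k v u := hH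
  have hkJ : ∀ u v, k (J u) v = k u (J v) := by
    intro u v
    rw [hkv, ← neg_neg (H (J u)), ← hJH, map_neg, LinearMap.neg_apply, hJg, neg_neg, hkv]
  have hs : ∀ u v, s u v = s v u := by
    intro u v; rw [hsv, hsv, ← hkJ, hk]
  have hb : ∀ u v, b u v = b v u := by
    intro u v; rw [hbv, hbv, hg, hk]
  have hq : ∀ u v, q u v = -q v u := by
    intro u v; rw [hqv, hqv, hg, hJg]
  -- The model. With k = g(H·,·), s = g(JH·,·) and b = g + k, the square of b has exactly the
  -- J-defect prescribed by `hR`. The squares of k and s are exchanged by J, so their sum is of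
  -- Kähler type, and the factor −1/2 restores holomorphic curvature 1. The complex space form term,
  -- with factor (c−1)/4, raises it to c. The difference from R then satisfies `sectional_eq_zero`.
  have h1 := (wedge hb).linComb ((wedge hk).linComb (wedge hs) 1 1) 1 (-1 / 2)
  have h2 := (wedge hg).linComb (of_skewForm hq) 1 1
  have h3 := h.linComb (h1.linComb h2 1 ((c - 1) / 4)) 1 (-1)
  have h4 := h3.sectional_eq_zero hJ ?_ ?_ u v
  · simp only [hbv, hkv] at h4
    rw [hq v u, hg v u, hH v u, hs v u] at h4
    have e1 : ∀ u v, s u v = g (J (H u)) v := fun _ _ ↦ rfl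
    have e2 : q u u = 0 := by linarith [hq u u]
    have e3 : q v v = 0 := by linarith [hq v v]
    rw [e1, e1, e1, e2, e3, hqv] at h4
    linarith
  · intro u v w z
    have e := hR u v w (J z)
    rw [hJ] at e
    rw [h.neg₄] at e
    simp only [hbv, hqv, hJ, hsv, hkv, map_neg] at e ⊢
    have e1 : ∀ u v, g (J u) (J v) = g u v := by intro u v; rw [hJg, hJ, map_neg, neg_neg]
    rw [hJg w z]
    linear_combination e
  · intro u
    have e1 : ∀ u v, g (J u) (J v) = g u v := by intro u v; rw [hJg, hJ, map_neg, neg_neg]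
    have e2 : g u (J u) = 0 := by have := hq u u; rw [hqv] at this; linarith
    have e3 : g (J u) u = 0 := by rw [hg, e2]
    simp only [hbv, hqv, hJ, hsv, map_neg, hkJ, e1, e2, e3, hc]
    ring

end IsAlgCurv
end AlgebraicCurvature

/-! ### Sectional curvature of a (κ, μ)-contact space form -/

section FlatContactSection
variable {F : Type*} [NormedAddCommGroup F] [NormedSpace ℝ F]

lemma IsFlatLC.isAlgCurv {g : F → F →L[ℝ] F →L[ℝ] ℝ} {Γ : F → F →L[ℝ] F →L[ℝ] F} {p : F}
    (h : IsFlatLC g Γ p) : IsAlgCurv fun u v w z ↦ g p (flatCurv Γ p u v w) z where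
  swap u v w z := by rw [flatCurv_swap, map_neg, neg_apply]
  skew u v w z := by rw [h.metric_curv, h.symm]
  pair := h.pair_symm
  bianchi u v w z := by
    rw [← add_apply, ← add_apply, ← map_add, ← map_add,
      flatCurv_bianchi (h.smooth_Γ.differentiableAt (by simp)) h.torsion, map_zero, zero_apply]
  add u u' v w z := by
    have : flatCurv Γ p (u + u') v w = flatCurv Γ p u v w + flatCurv Γ p u' v w := by
      simp only [flatCurv, ContinuousLinearMap.map_add, add_apply]
      abel
    rw [this, map_add, add_apply]
  smul r u v w z := by
    have : flatCurv Γ p (r • u) v w = r • flatCurv Γ p u v w := by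
      simp only [flatCurv, ContinuousLinearMap.map_smul, smul_apply]
      module
    rw [this, map_smul, smul_apply, smul_eq_mul]

lemma IsAlgCurv.comp {V W : Type*} [AddCommGroup V] [Module ℝ V] [AddCommGroup W] [Module ℝ W]
    {R : V → V → V → V → ℝ} (h : IsAlgCurv R) (L : W →ₗ[ℝ] V) :
    IsAlgCurv fun u v w z ↦ R (L u) (L v) (L w) (L z) where
  swap _ _ _ _ := h.swap _ _ _ _
  skew _ _ _ _ := h.skew _ _ _ _
  pair _ _ _ _ := h.pair _ _ _ _
  bianchi _ _ _ _ := h.bianchi _ _ _ _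
  add u u' v w z := by rw [map_add, h.add]
  smul r u v w z := by rw [map_smul, h.smul]

namespace FlatKappaMu
variable {g : F → F →L[ℝ] F →L[ℝ] ℝ} {Γ : F → F →L[ℝ] F →L[ℝ] F} {φ : F → F →L[ℝ] F}
  {ξ : F → F} {κ μ : ℝ} {p : F} (h : FlatKappaMu g Γ φ ξ κ μ p)
include h

omit h in
/-- The Ricci identity for `φ` on the contact distribution. -/
lemma curv_φ (h : FlatKappaMu g Γ φ ξ κ μ p) (u v : F) {w z : F} (hw : g p (ξ p) w = 0)
    (hz : g p (ξ p) z = 0) :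
    g p (flatCurv Γ p u v (φ p w)) z + g p (flatCurv Γ p u v w) (φ p z)
      = g p (φ p (covVec Γ ξ p v)) w * g p (covVec Γ ξ p u) z
        - g p (covVec Γ ξ p u) w * g p (φ p (covVec Γ ξ p v)) z
        - (g p (φ p (covVec Γ ξ p u)) w * g p (covVec Γ ξ p v) z
        - g p (covVec Γ ξ p v) w * g p (φ p (covVec Γ ξ p u)) z) := by
  have h1 := congrArg (fun a ↦ g p a z) (covEnd_covEnd_sub h.smooth_φ h.diff_Γ u v w)
  simp only [map_sub, sub_apply, h.skew.self_of_nhds (flatCurv Γ p u v w) z, sub_neg_eq_add] at h1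
  rw [← h1]
  -- Differentiate the formula for ∇φ once more. As w and z are orthogonal to ξ, only the terms in
  -- which both η and ξ have been removed survive.
  have key : ∀ u v, g p (covEnd Γ (fun e ↦ covEnd Γ φ e v) p u w) z
      = g p (φ p (covVec Γ ξ p v)) w * g p (covVec Γ ξ p u) z
        - g p (covVec Γ ξ p u) w * g p (φ p (covVec Γ ξ p v)) z := by
    intro u v
    have e1 : (fun e ↦ covEnd Γ φ e v) =ᶠ[𝓝 p] fun e ↦
        (g e (φ e (covVec Γ ξ e v))).smulRight (ξ e)
          - (g e (ξ e)).smulRight (φ e (covVec Γ ξ e v)) := by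
      filter_upwards [h.eventually] with e he
      ext a
      exact he.covEnd_φ v a
    have hV : DifferentiableAt ℝ (fun e ↦ φ e (covVec Γ ξ e v)) p :=
      h.diff_φ.clm_apply (h.diff_A.clm_apply (differentiableAt_const v))
    have hT : ∀ {V W : F → F}, DifferentiableAt ℝ V p → DifferentiableAt ℝ W p →
        DifferentiableAt ℝ (fun e ↦ (g e (V e)).smulRight (W e)) p := by
      intro V W hV hW
      exact DifferentiableAt.comp (f := fun e ↦ (g e (V e), W e))
        (g := fun q : (F →L[ℝ] ℝ) × F ↦ q.1.smulRight q.2) p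
        (isBoundedBilinearMap_smulRight.differentiableAt _) ((h.diff_g.clm_apply hV).prodMk hW)
    rw [covEnd_congr e1, covEnd_sub (hT hV h.diff_ξ) (hT h.diff_ξ hV),
      covEnd_smulRight h.diff_g h.lc.metric.self_of_nhds hV h.diff_ξ,
      covEnd_smulRight h.diff_g h.lc.metric.self_of_nhds h.diff_ξ hV]
    simp only [map_add, map_sub, map_smul, add_apply, sub_apply, smul_apply, smul_eq_mul, hw, hz]
    ring
  rw [key, key]

lemma ηH (a : F) : g p (ξ p) (flatH Γ φ ξ p a) = 0 := by
  rw [h.flatH_eq, map_add, h.ηφ, h.ηφ, add_zero]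

lemma H_symm (a b : F) : g p (flatH Γ φ ξ p a) b = g p (flatH Γ φ ξ p b) a := by
  have h1 := h.skew.self_of_nhds (covVec Γ ξ p a) b
  have h2 := h.A_symm a (φ p b)
  have h3 := h.lc.symm p (covVec Γ ξ p (φ p b)) a
  rw [h.Aφ] at h2
  have h4 := h.lc.symm p (φ p (covVec Γ ξ p b)) a
  have h5 := h.lc.symm p (φ p (φ p b)) a
  have h6 := h.skew.self_of_nhds (φ p a) b
  have h7 := h.skew.self_of_nhds a (φ p b)
  simp only [h.flatH_eq, map_add, map_sub, map_neg, map_smul, add_apply, sub_apply, neg_apply,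
    smul_apply, smul_eq_mul] at *
  linarith

-- On ξ^⊥ one has φA = 1 + h', so the Ricci identity for φ becomes the hypothesis of the algebraic
-- `IsAlgCurv.sectional_eq`, with J = φ and H = h'.
omit h in
lemma curv_contact (h : FlatKappaMu g Γ φ ξ κ μ p) {c : ℝ}
    (hc : ∀ u, g p (ξ p) u = 0 → g p u u = 1 →
      g p (flatCurv Γ p u (φ p u) (φ p u)) u = c) {u v : F} (hu : g p (ξ p) u = 0)
    (hv : g p (ξ p) v = 0) :
    g p (flatCurv Γ p u v v) u = (g p u u + g p (flatH Γ φ ξ p u) u) * (g p v v + g p (flatH Γ φ ξ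
        p v) v)
      - (g p u v + g p (flatH Γ φ ξ p u) v) ^ 2
      - 1 / 2 * (g p (flatH Γ φ ξ p u) u * g p (flatH Γ φ ξ p v) v - g p (flatH Γ φ ξ p u) v ^ 2
        + g p (φ p (flatH Γ φ ξ p u)) u * g p (φ p (flatH Γ φ ξ p v)) v
        - g p (φ p (flatH Γ φ ξ p u)) v ^ 2)
      + (c - 1) / 4 * (g p u u * g p v v - g p u v ^ 2 + 3 * g p u (φ p v) ^ 2) := by
  set V : Submodule ℝ F := LinearMap.ker (g p (ξ p)).toLinearMap with hV
  have hmem : ∀ a : V, g p (ξ p) a = 0 := fun a ↦ a.2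
  have hHe : ∀ a, (φ p ∘L (covVec Γ ξ p + φ p)) a = flatH Γ φ ξ p a := by
    intro a
    rw [h.flatH_eq]
    simp
  let J : V →ₗ[ℝ] V := (φ p).toLinearMap.restrict (p := V) (q := V) fun a _ ↦ h.ηφ a
  let H : V →ₗ[ℝ] V := (φ p ∘L (covVec Γ ξ p + φ p)).toLinearMap.restrict (p := V) (q := V)
    fun a _ ↦ h.ηφ _
  let gV : V →ₗ[ℝ] V →ₗ[ℝ] ℝ := LinearMap.mk₂ ℝ (fun x y ↦ g p x y) (by simp) (by simp) (by simp)
    (by simp)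
  have hJv : ∀ a : V, (J a : F) = φ p a := fun a ↦ rfl
  have hHv : ∀ a : V, (H a : F) = flatH Γ φ ξ p a := fun a ↦ hHe a
  have hgv : ∀ a b : V, gV a b = g p a b := fun _ _ ↦ rfl
  have hR := h.lc.isAlgCurv
  have hA : ∀ a z : V, g p (φ p (covVec Γ ξ p a)) z = gV a z + gV (H a) z := by
    intro a z
    rw [hgv, hgv, hHv, h.flatH_eq, h.φφ_of_η (hmem a), map_add, add_apply, map_neg, neg_apply]
    ring
  have hA' : ∀ a z : V, g p (covVec Γ ξ p a) z = gV a (J z) + gV (H a) (J z) := by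
    intro a z
    rw [← hA, hJv, h.g_φφ, h.ηA, zero_mul, sub_zero]
  have := (hR.comp V.subtype).sectional_eq (g := gV) (J := J) (H := H) (c := c) ?_ ?_ ?_ ?_ ?_ ?_ ?_
    ⟨u, hu⟩ ⟨v, hv⟩
  · simpa only [hgv, hJv, hHv, Submodule.subtype_apply] using this
  · exact fun a b ↦ h.lc.symm p a b
  · exact fun a ↦ Subtype.ext (h.φφ_of_η (hmem a))
  · exact fun a b ↦ h.skew.self_of_nhds a b
  · intro a b
    rw [hgv, hgv, hHv, hHv, h.H_symm]
  · intro a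
    refine Subtype.ext ?_
    rw [hJv, hHv, Submodule.coe_neg, hHv, hJv, h.flatH_eq, h.flatH_eq, h.Aφ, map_add, map_sub,
      map_neg, map_smul]
    module
  · intro u v w z
    have := h.curv_φ u v (hmem w) (hmem z)
    simp only [hA, hA'] at this
    simp only [Submodule.subtype_apply, hJv]
    rw [this]
    ring
  · intro u
    simp only [Submodule.subtype_apply, hJv, hgv]
    -- The space form condition is given for unit vectors only; both sides are homogeneous of degree
    -- four.
    by_cases hu : (u : F) = 0
    · have : flatCurv Γ p 0 (φ p 0) (φ p 0) = 0 := by simp [flatCurv]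
      rw [hu, this]
      simp
    · have hpos := h.lc.pos.self_of_nhds _ hu
      set r := √(g p u u) with hr
      have hr0 : r ≠ 0 := (Real.sqrt_pos.2 hpos).ne'
      have hrr : r * r = g p u u := Real.mul_self_sqrt hpos.le
      have h1 := hc (r⁻¹ • (u : F)) (by rw [map_smul, hmem u, smul_zero]) (by
        simp only [map_smul, smul_apply, smul_eq_mul, ← hrr]
        field_simp)
      simp only [map_smul, hR.smul, hR.smul₂, hR.smul₃, hR.smul₄] at h1
      rw [← h1, ← hrr]
      field_simp

/-- The sectional curvature of a `(κ, μ)`-contact space form. -/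
lemma sectional_eq {c : ℝ} (hc : ∀ u, g p (ξ p) u = 0 → g p u u = 1 →
      g p (flatCurv Γ p u (φ p u) (φ p u)) u = c) {u v : F} (hu : g p u u = 1)
    (hv : g p v v = 1) (huv : g p u v = 0) :
    g p (flatCurv Γ p u v v) u = (c + 3) / 4 + 3 * (c - 1) / 4 * g p u (φ p v) ^ 2
      - (c + 3 - 4 * κ) / 4 * (g p (ξ p) u ^ 2 + g p (ξ p) v ^ 2)
      + 1 / 2 * (g p (flatH Γ φ ξ p u) u * g p (flatH Γ φ ξ p v) v - g p (flatH Γ φ ξ p u) v ^ 2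
        - g p (φ p (flatH Γ φ ξ p u)) u * g p (φ p (flatH Γ φ ξ p v)) v
        + g p (φ p (flatH Γ φ ξ p u)) v ^ 2)
      + g p (flatH Γ φ ξ p u) u + g p (flatH Γ φ ξ p v) v
      + (μ - 1) * (g p (ξ p) v ^ 2 * g p (flatH Γ φ ξ p u) u + g p (ξ p) u ^ 2 * g p (flatH Γ φ ξ p
          v) v
        - 2 * g p (ξ p) u * g p (ξ p) v * g p (flatH Γ φ ξ p u) v) := by
  have hR := h.lc.isAlgCurv
  set a := g p (ξ p) u with ha
  set b := g p (ξ p) v with hb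
  -- Split off the ξ-components. Curvature terms with ξ are given by nullity, and the term with u₀,
  -- v₀ is the formula on ξ^⊥.
  obtain ⟨u₀, hu₀⟩ : ∃ u₀, u₀ = u - a • ξ p := ⟨_, rfl⟩
  obtain ⟨v₀, hv₀⟩ : ∃ v₀, v₀ = v - b • ξ p := ⟨_, rfl⟩
  have hξξ := h.ξξ.self_of_nhds
  have ηu : g p (ξ p) u₀ = 0 := by rw [hu₀, map_sub, map_smul, hξξ, smul_eq_mul, mul_one, sub_self]
  have ηv : g p (ξ p) v₀ = 0 := by rw [hv₀, map_sub, map_smul, hξξ, smul_eq_mul, mul_one, sub_self]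
  have hu1 : u = u₀ + a • ξ p := by rw [hu₀]; abel
  have hv1 : v = v₀ + b • ξ p := by rw [hv₀]; abel
  have hRξ : ∀ x y z, g p (flatCurv Γ p x y (ξ p)) z = κ * (g p (ξ p) y * g p x z - g p (ξ p) x * g
      p y z)
      + μ * (g p (ξ p) y * g p (flatH Γ φ ξ p x) z - g p (ξ p) x * g p (flatH Γ φ ξ p y) z) := by
    intro x y z
    rw [h.nullity.self_of_nhds]
    simp only [map_add, map_sub, map_smul, add_apply, sub_apply, smul_apply, smul_eq_mul]
  have hHu : flatH Γ φ ξ p u₀ = flatH Γ φ ξ p u := by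
    rw [h.flatH_eq, h.flatH_eq, hu₀, map_sub, map_smul, h.A_ξ, smul_zero, sub_zero, map_sub,
      map_smul, h.φξ.self_of_nhds, smul_zero, sub_zero]
  have hHv : flatH Γ φ ξ p v₀ = flatH Γ φ ξ p v := by
    rw [h.flatH_eq, h.flatH_eq, hv₀, map_sub, map_smul, h.A_ξ, smul_zero, sub_zero, map_sub,
      map_smul, h.φξ.self_of_nhds, smul_zero, sub_zero]
  have hφv : φ p v₀ = φ p v := by
    rw [hv₀, map_sub, map_smul, h.φξ.self_of_nhds, smul_zero, sub_zero]
  have hηξ : ∀ x, g p x (ξ p) = g p (ξ p) x := fun x ↦ h.lc.symm p _ _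
  have e1 : g p (flatCurv Γ p u v v) u = g p (flatCurv Γ p u v v₀) u₀
      + b * g p (flatCurv Γ p u v (ξ p)) u₀ - a * g p (flatCurv Γ p u v (ξ p)) v₀ := by
    have h1 : g p (flatCurv Γ p u v (ξ p)) (ξ p) = 0 := by
      linarith [hR.skew u v (ξ p) (ξ p)]
    have h2 := hR.skew u v v₀ (ξ p)
    calc g p (flatCurv Γ p u v v) u
        = g p (flatCurv Γ p u v (v₀ + b • ξ p)) (u₀ + a • ξ p) := by rw [← hu1, ← hv1]
      _ = _ := by
        rw [hR.add₃, hR.add₄, hR.add₄, hR.smul₃, hR.smul₃, hR.smul₄, hR.smul₄, h1, h2]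
        ring
  -- By pair symmetry the ξ-components of u and v meet only R(v₀, u₀)ξ, which is zero since η(u₀) =
  -- η(v₀) = 0.
  have e2 : g p (flatCurv Γ p u v v₀) u₀ = g p (flatCurv Γ p u₀ v₀ v₀) u₀ := by
    have h1 := hRξ v₀ u₀ v
    have h2 := hR.skew v₀ u₀ u₀ (ξ p)
    have h3 := hRξ v₀ u₀ u₀
    rw [ηu, ηv] at h1 h3
    calc g p (flatCurv Γ p u v v₀) u₀ = g p (flatCurv Γ p v₀ u₀ (u₀ + a • ξ p)) (v₀ + b • ξ p) := by
          rw [← hu1, ← hv1]; exact hR.pair _ _ _ _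
      _ = g p (flatCurv Γ p v₀ u₀ u₀) v₀ := by
        rw [hR.add₃, ← hv1, hR.smul₃, h1, hv1, hR.add₄, hR.smul₄, h2, h3]
        ring
      _ = _ := by rw [hR.pair]
  have guu : g p u u₀ = 1 - a ^ 2 := by
    rw [hu₀, map_sub, map_smul, hηξ, hu, smul_eq_mul, ← ha]; ring
  have gvu : g p v u₀ = -(a * b) := by
    rw [hu₀, map_sub, map_smul, hηξ, h.lc.symm p v u, huv, smul_eq_mul, ← hb]; ring
  have guv : g p u v₀ = -(a * b) := by
    rw [hv₀, map_sub, map_smul, hηξ, huv, smul_eq_mul, ← ha]; ring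
  have gvv : g p v v₀ = 1 - b ^ 2 := by
    rw [hv₀, map_sub, map_smul, hηξ, hv, smul_eq_mul, ← hb]; ring
  have guu' : g p u₀ u₀ = 1 - a ^ 2 := by
    rw [← guu, h.lc.symm p u u₀, hu1, map_add, map_smul, hηξ, ηu, smul_zero, add_zero]
  have gvv' : g p v₀ v₀ = 1 - b ^ 2 := by
    rw [← gvv, h.lc.symm p v v₀, hv1, map_add, map_smul, hηξ, ηv, smul_zero, add_zero]
  have guv' : g p u₀ v₀ = -(a * b) := by
    rw [← gvu, h.lc.symm p v u₀, hv1, map_add, map_smul, hηξ, ηu, smul_zero, add_zero]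
  have hHx : ∀ x, g p (flatH Γ φ ξ p x) (ξ p) = 0 := fun x ↦ by rw [hηξ, h.ηH]
  have hφx : ∀ x, g p (φ p x) (ξ p) = 0 := fun x ↦ by rw [hηξ, h.ηφ]
  have k1 : ∀ x, g p (flatH Γ φ ξ p x) u₀ = g p (flatH Γ φ ξ p x) u := fun x ↦ by
    rw [hu₀, map_sub, map_smul, hHx, smul_zero, sub_zero]
  have k2 : ∀ x, g p (flatH Γ φ ξ p x) v₀ = g p (flatH Γ φ ξ p x) v := fun x ↦ by
    rw [hv₀, map_sub, map_smul, hHx, smul_zero, sub_zero]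
  have k3 : ∀ x, g p (φ p x) u₀ = g p (φ p x) u := fun x ↦ by
    rw [hu₀, map_sub, map_smul, hφx, smul_zero, sub_zero]
  have k4 : ∀ x, g p (φ p x) v₀ = g p (φ p x) v := fun x ↦ by
    rw [hv₀, map_sub, map_smul, hφx, smul_zero, sub_zero]
  have k5 : g p u₀ (φ p v) = g p u (φ p v) := by rw [h.lc.symm, k3, h.lc.symm]
  rw [e1, e2, h.curv_contact hc ηu ηv, hRξ, hRξ, guu', gvv', guv', hHu, hHv, hφv, guu, gvu, guv,
    gvv, ← ha, ← hb, k1, k2, k2, k3, k4, k4, k5, k1, h.H_symm v u]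
  ring

end FlatKappaMu
end FlatContactSection

/-! ### From the manifold structure to its chart expression -/

section Transfer
variable {d : ℕ} {N : Type*} [TopologicalSpace N] [ChartedSpace (E d) N] [IsManifold (𝓡 d) ∞ N]

/-- A field of endomorphisms in the chart at `x`. -/
def chartEnd (x : N) (φ : Π y : N, T d y →L[ℝ] T d y) (e : E d) : E d →L[ℝ] E d :=
  toModel x ((ch d x).symm e) ∘L φ ((ch d x).symm e) ∘L ofModel x ((ch d x).symm e)

lemma chartEnd_toModel {x y : N} (hy : y ∈ (ch d x).source) (φ : Π y : N, T d y →L[ℝ] T d y)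
    (v : T d y) : chartEnd x φ (ch d x y) (toModel x y v) = toModel x y (φ y v) := by
  rw [chartEnd, ch_left hy, ContinuousLinearMap.comp_apply, ContinuousLinearMap.comp_apply,
    ofModel_toModel hy]

lemma rep_clm_apply {x : N} (φ : Π y : N, T d y →L[ℝ] T d y) (V : Π y : N, T d y) {e : E d}
    (he : e ∈ (ch d x).target) : rep x (fun z ↦ φ z (V z)) e = chartEnd x φ e (rep x V e) := by
  have hy := (ch d x).map_target he
  rw [chartEnd, rep, rep, ContinuousLinearMap.comp_apply, ContinuousLinearMap.comp_apply,
    ofModel_toModel hy]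

lemma contDiffAt_chartEnd (x : N) {φ : Π y : N, T d y →L[ℝ] T d y}
    (hφ : ContMDiff (𝓡 d) ((𝓡 d).prod 𝓘(ℝ, E d →L[ℝ] E d)) ∞
    (fun x ↦ (⟨x, φ x⟩ : TotalSpace (E d →L[ℝ] E d)
      (fun x : N ↦ TangentSpace (𝓡 d) x →L[ℝ] TangentSpace (𝓡 d) x)))) :
    ContDiffAt ℝ ∞ (chartEnd x φ) (ch d x x) := by
  have h3 := hφ x
  rw [contMDiffAt_hom_bundle] at h3
  exact contDiffAt_comp_symm (mem_ch_self x) h3.2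

lemma contDiffAt_rep' {x y : N} (hy : y ∈ (ch d x).source) (V : Π y : N, T d y)
    (hV : ContMDiffAt (𝓡 d) ((𝓡 d).prod 𝓘(ℝ, E d)) ∞
      (fun z ↦ (⟨z, V z⟩ : TotalSpace (E d) (fun z : N ↦ TangentSpace (𝓡 d) z))) y) :
    ContDiffAt ℝ ∞ (rep x V) (ch d x y) := by
  rw [(trivializationAt (E d) (fun z : N ↦ TangentSpace (𝓡 d) z) x).contMDiffAt_section_iff
    (mem_base hy)] at hV
  refine (contDiffAt_comp_symm hy hV).congr_of_eventuallyEq ?_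
  filter_upwards [ch_target_mem hy] with e he
  rw [rep, Function.comp_apply, triv_snd ((ch d x).map_target he)]

lemma HasChristoffel.covVec {D : Nabla d N} {x : N} {Γ : E d → E d →L[ℝ] E d →L[ℝ] E d}
    (h : HasChristoffel D x Γ) {y : N} (hy : y ∈ (ch d x).source) {V : Π z : N, T d z}
    (hV : VDiffAt V y) (v : T d y) :
    toModel x y (D V y v) = ChenKappaMu.covVec Γ (rep x V) (ch d x y) (toModel x y v) :=
  h y hy V hV v

variable [RiemannianBundle (fun x : N ↦ TangentSpace (𝓡 d) x)]
  [IsContMDiffRiemannianBundle (𝓡 d) ∞ (E d) (fun x : N ↦ TangentSpace (𝓡 d) x)]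

lemma IsLeviCivita.mlieBracket_eq {cov : Connection d N} (hcov : IsLeviCivita cov) {y : N}
    {U V : Π z : N, T d z} (hU : VDiffAt U y) (hV : VDiffAt V y) :
    VectorField.mlieBracket (𝓡 d) U V y = cov V y (U y) - cov U y (V y) := by
  have h1 := CovariantDerivative.torsion_apply cov hU hV
  rw [hcov.torsion_free] at h1
  exact (sub_eq_zero.1 h1.symm).symm

/-- Here y need not be the centre of the chart, so the extensions at y are not constant in the chart
at x. Zero torsion turns the bracket into covariant derivatives that cancel the unwanted terms, and
the Ricci identity does the rest. This makes the nullity condition available on a neighbourhood,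
where it can be differentiated. -/
lemma IsLeviCivita.toModel_curvature {cov : Connection d N} (hcov : IsLeviCivita cov) {x y : N}
    (hy : y ∈ (ch d x).source) (hΓ : DifferentiableAt ℝ (christoffel cov x) (ch d x y))
    (ht : ∀ a b, christoffel cov x (ch d x y) a b = christoffel cov x (ch d x y) b a)
    (u v w : T d y) :
    toModel x y (curvature cov.nabla y u v w)
      = flatCurv (christoffel cov x) (ch d x y) (toModel x y u) (toModel x y v) (toModel x y w) :=
          by
  have hc := hasChristoffel cov x
  have hsm : ∀ u : T d y, ContDiffAt ℝ ∞ (rep x (extendField u)) (ch d x y) := fun u ↦ by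
    rw [extendField_eq]
    exact contDiffAt_rep' hy _ (contMDiffAt_constField (mem_ch_self y) _)
  have hrep : ∀ u : T d y, rep x (extendField u) (ch d x y) = toModel x y u := fun u ↦ by
    rw [rep_apply hy, extendField_self]
  have hsm2 : ContDiffAt ℝ 2 (rep x (extendField w)) (ch d x y) :=
    (hsm w).of_le (WithTop.coe_le_coe.2 le_top)
  have hA := differentiableAt_covVec hsm2 hΓ
  have key : ∀ u v : T d y, toModel x y
      (cov (fun z ↦ cov (extendField w) z (extendField v z)) y u)
      = covEnd (christoffel cov x) (covVec (christoffel cov x) (rep x (extendField w))) (ch d x y)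
          (toModel x y u) (toModel x y v)
        + covVec (christoffel cov x) (rep x (extendField w)) (ch d x y)
          (toModel x y (cov (extendField v) y u)) := by
    intro u v
    have h1 : rep x (fun z ↦ cov (extendField w) z (extendField v z)) =ᶠ[𝓝 (ch d x y)]
        fun e ↦ covVec (christoffel cov x) (rep x (extendField w)) e (rep x (extendField v) e) := by
      have hev : ∀ᶠ e in 𝓝 (ch d x y), (ch d x).symm e ∈ (ch d y).source := by
        have := (mdiff_symm hy).continuousAt
        refine this.eventually_mem ?_
        rw [ch_left hy]
        exact extChartAt_source_mem_nhds y
      filter_upwards [hev, ch_target_mem hy] with e he1 he2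
      have hz := (ch d x).map_target he2
      have hw : VDiffAt (extendField w) ((ch d x).symm e) := by
        rw [extendField_eq]; exact vdiffAt_constField he1 _
      have := hc.covVec hz hw (extendField v ((ch d x).symm e))
      rw [(ch d x).right_inv he2] at this
      exact this
    have h2 : VDiffAt (fun z ↦ cov (extendField w) z (extendField v z)) y := by
      rw [vdiffAt_iff hy]
      exact (hA.clm_apply ((hsm v).differentiableAt (by simp))).congr_of_eventuallyEq h1
    have h3 := hc.covVec hy h2 u
    rw [covVec_congr h1, covVec_clm hA ((hsm v).differentiableAt (by simp)), hrep v,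
      ← hc.covVec hy (vdiffAt_extendField v)] at h3
    exact h3
  have h4 : toModel x y (cov (extendField w) y
      (VectorField.mlieBracket (𝓡 d) (extendField u) (extendField v) y))
      = covVec (christoffel cov x) (rep x (extendField w)) (ch d x y)
          (toModel x y (cov (extendField v) y u))
        - covVec (christoffel cov x) (rep x (extendField w)) (ch d x y)
          (toModel x y (cov (extendField u) y v)) := by
    have := hc.covVec hy (vdiffAt_extendField w)
      (VectorField.mlieBracket (𝓡 d) (extendField u) (extendField v) y)
    refine this.trans ?_
    rw [hcov.mlieBracket_eq (vdiffAt_extendField u) (vdiffAt_extendField v), extendField_self,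
      extendField_self, map_sub, map_sub]
  have h5 := covEnd_covVec_sub hsm2 hΓ ht (toModel x y u) (toModel x y v)
  rw [hrep] at h5
  rw [← h5]
  have h6 : curvature cov.nabla y u v w
      = cov (fun z ↦ cov (extendField w) z (extendField v z)) y u
        - cov (fun z ↦ cov (extendField w) z (extendField u z)) y v
        - cov (extendField w) y (VectorField.mlieBracket (𝓡 d) (extendField u) (extendField v) y) :=
    rfl
  rw [h6, map_sub, map_sub, key, key, h4]
  abel

namespace AlmostContactMetric
variable {S : AlmostContactMetric d N} {cov : Connection d N}

omit [IsContMDiffRiemannianBundle (𝓡 d) ∞ (E d) (fun x : N ↦ TangentSpace (𝓡 d) x)] in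
lemma vdiffAt_ξ (y : N) : VDiffAt S.ξ y := (S.smooth_ξ y).mdifferentiableAt (by simp)

/-- Zero torsion gives (L_ξ φ)U = (∇_ξ φ)U − ∇_{φU} ξ + φ∇_U ξ, in which the derivatives of the
extension of U no longer occur. -/
lemma toModel_hTensor (hcov : IsLeviCivita cov) {x y : N} (hy : y ∈ (ch d x).source)
    (hφ : DifferentiableAt ℝ (chartEnd x S.φ) (ch d x y)) (u : T d y) :
    toModel x y (S.hTensor y u) = flatH (christoffel cov x) (chartEnd x S.φ) (rep x S.ξ) (ch d x y)
      (toModel x y u) := by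
  have hc := hasChristoffel cov x
  have hu := vdiffAt_extendField u
  have hu' := (vdiffAt_iff hy _).1 hu
  have h1 : rep x (fun z ↦ S.φ z (extendField u z)) =ᶠ[𝓝 (ch d x y)]
      fun e ↦ chartEnd x S.φ e (rep x (extendField u) e) := by
    filter_upwards [ch_target_mem hy] with e he using rep_clm_apply _ _ he
  have h2 : VDiffAt (fun z ↦ S.φ z (extendField u z)) y := by
    rw [vdiffAt_iff hy]
    exact (hφ.clm_apply hu').congr_of_eventuallyEq h1
  have hrep : rep x (extendField u) (ch d x y) = toModel x y u := by
    rw [rep_apply hy, extendField_self]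
  have e1 : toModel x y (cov (fun z ↦ S.φ z (extendField u z)) y (S.ξ y)) = _ :=
    hc.covVec hy h2 (S.ξ y)
  have e2 : toModel x y (cov (extendField u) y (S.ξ y)) = _ := hc.covVec hy hu (S.ξ y)
  have e3 : ∀ v, toModel x y (cov S.ξ y v) = _ := hc.covVec hy (vdiffAt_ξ y)
  rw [covVec_congr h1, covVec_clm hφ hu', hrep, ← e2] at e1
  rw [hTensor, hcov.mlieBracket_eq (vdiffAt_ξ y) h2, hcov.mlieBracket_eq (vdiffAt_ξ y) hu,
    extendField_self, map_smul, map_sub, map_sub, map_sub, map_sub, e1, e3, flatH,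
    ← chartEnd_toModel hy S.φ, ← chartEnd_toModel hy S.φ, ← chartEnd_toModel hy S.φ, e3,
    rep_apply hy]
  module

/-- For a torsion-free metric connection, 2dη(u, v) = g(∇_u ξ, v) − g(∇_v ξ, u), the factor 2 coming
from the convention for dη. -/
lemma IsContactMetric.cov_ξ (hS : S.IsContactMetric) (hcov : IsLeviCivita cov) (y : N)
    (u v : T d y) : (inner ℝ (cov S.ξ y u) v : ℝ) - inner ℝ (cov S.ξ y v) u
      = 2 * inner ℝ u (S.φ y v) := by
  have h0 := hS y u v
  have h1 : ∀ u v : T d y, mvfderiv (𝓡 d) (fun z ↦ S.η z (extendField v z)) y u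
      = inner ℝ (cov (extendField v) y u) (S.ξ y) + inner ℝ v (cov S.ξ y u) := by
    intro u v
    have h2 := hcov.metric.mvfderiv_inner_eq (extendField u) (vdiffAt_extendField v)
      (vdiffAt_ξ (S := S) y)
    have h3 : (fun z ↦ S.η z (extendField v z))
        = fun z ↦ (inner ℝ (extendField v z) (S.ξ z) : ℝ) := by
      funext z; rw [S.inner_ξ]
    rw [h3]
    simp only [extendField_self] at h2
    exact h2
  rw [extDerivOneForm, h1, h1, hcov.mlieBracket_eq (vdiffAt_extendField u) (vdiffAt_extendField v),
    ← S.inner_ξ, inner_sub_left, extendField_self, extendField_self,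
    real_inner_comm (cov S.ξ y u), real_inner_comm (cov S.ξ y v)] at h0
  linarith

lemma IsKappaMuSpaceForm.flatKappaMu {κ μ c : ℝ} (hN : S.IsKappaMuSpaceForm cov κ μ c)
    (hcov : IsLeviCivita cov) (x : N) :
    FlatKappaMu (chartMetric x) (christoffel cov x) (chartEnd x S.φ) (rep x S.ξ) κ μ
      (ch d x x) := by
  have hlc := isFlatLC hcov x
  have hφ : ContDiffAt ℝ 2 (chartEnd x S.φ) (ch d x x) :=
    (contDiffAt_chartEnd x S.smooth_φ).of_le (WithTop.coe_le_coe.2 le_top)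
  have hξ : ContDiffAt ℝ 2 (rep x S.ξ) (ch d x x) :=
    (contDiffAt_rep S.ξ (S.smooth_ξ x)).of_le (WithTop.coe_le_coe.2 le_top)
  have hc := hasChristoffel cov x
  have transfer : ∀ {p : E d → Prop}, (∀ y ∈ (ch d x).source, p (ch d x y)) →
      ∀ᶠ e in 𝓝 (ch d x x), p e := by
    intro p hp
    filter_upwards [ch_target_mem (mem_ch_self x)] with e he
    have := hp _ ((ch d x).map_target he)
    rwa [(ch d x).right_inv he] at this
  have hsurj : ∀ y ∈ (ch d x).source, ∀ a : E d, ∃ u : T d y, toModel x y u = a :=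
    fun y hy a ↦ ⟨ofModel x y a, toModel_ofModel hy a⟩
  have hηe : ∀ y ∈ (ch d x).source, ∀ u : T d y,
      chartMetric x (ch d x y) (rep x S.ξ (ch d x y)) (toModel x y u) = S.η y u := by
    intro y hy u
    rw [rep_apply hy, chartMetric_toModel hy, real_inner_comm, S.inner_ξ]
  have hξξ : ∀ᶠ e in 𝓝 (ch d x x), chartMetric x e (rep x S.ξ e) (rep x S.ξ e) = 1 :=
    transfer fun y hy ↦ by
      have := hηe y hy (S.ξ y)
      rwa [S.η_ξ, ← rep_apply hy S.ξ] at this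
  refine ⟨⟨hlc, hφ, hξ, ?_, hξξ, ?_, ?_, ?_, ?_⟩, ?_⟩
  · refine transfer fun y hy a ↦ ?_
    obtain ⟨u, rfl⟩ := hsurj y hy a
    rw [chartEnd_toModel hy, chartEnd_toModel hy, hηe y hy, S.φ_φ, map_add, map_neg, map_smul,
      rep_apply hy]
  · refine transfer fun y hy ↦ ?_
    rw [rep_apply hy, chartEnd_toModel hy, S.φ_ξ, map_zero]
  · refine transfer fun y hy a b ↦ ?_
    obtain ⟨u, rfl⟩ := hsurj y hy a
    obtain ⟨v, rfl⟩ := hsurj y hy b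
    rw [chartEnd_toModel hy, chartEnd_toModel hy, chartMetric_toModel hy, chartMetric_toModel hy,
      S.inner_φ, neg_neg]
  · filter_upwards [hξξ.eventually_nhds, hlc.metric, hlc.smooth_g.eventually (by simp),
      hξ.eventually (by simp)] with e h1 h2 h3 h4 a
    have h5 := fderiv_metric (h3.differentiableAt (by simp)) h2 (h4.differentiableAt (by simp))
      (h4.differentiableAt (by simp)) a
    have h6 : (fun e ↦ chartMetric x e (rep x S.ξ e) (rep x S.ξ e)) =ᶠ[𝓝 e] fun _ ↦ 1 := h1
    rw [h6.fderiv_eq, fderiv_fun_const, Pi.zero_apply, zero_apply, hlc.symm e (rep x S.ξ e)] at h5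
    linarith
  · refine transfer fun y hy a b ↦ ?_
    obtain ⟨u, rfl⟩ := hsurj y hy a
    obtain ⟨v, rfl⟩ := hsurj y hy b
    have e3 : ∀ v, toModel x y (cov S.ξ y v) = _ := hc.covVec hy (vdiffAt_ξ y)
    rw [← e3, ← e3, chartEnd_toModel hy, chartMetric_toModel hy, chartMetric_toModel hy,
      chartMetric_toModel hy, hN.contact.cov_ξ hcov]
  · have h0 : ∀ᶠ e in 𝓝 (ch d x x), DifferentiableAt ℝ (christoffel cov x) e ∧
        (∀ a b, christoffel cov x e a b = christoffel cov x e b a) ∧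
        DifferentiableAt ℝ (chartEnd x S.φ) e ∧ e ∈ (ch d x).target := by
      filter_upwards [hlc.smooth_Γ.eventually (by simp), hlc.torsion, hφ.eventually (by simp),
        ch_target_mem (mem_ch_self x)] with e h1 h2 h3 h4
      exact ⟨h1.differentiableAt (by simp), h2, h3.differentiableAt (by simp), h4⟩
    filter_upwards [h0] with e he a b
    obtain ⟨h1, h2, h3, h4⟩ := he
    obtain ⟨y, hy, rfl⟩ : ∃ y ∈ (ch d x).source, ch d x y = e :=
      ⟨_, (ch d x).map_target h4, (ch d x).right_inv h4⟩
    obtain ⟨u, rfl⟩ := hsurj y hy a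
    obtain ⟨v, rfl⟩ := hsurj y hy b
    rw [rep_apply hy, ← hcov.toModel_curvature hy h1 h2, hN.nullity_ξ y u v,
      ← rep_apply hy S.ξ, ← toModel_hTensor hcov hy h3, ← toModel_hTensor hcov hy h3, rep_apply hy,
      chartMetric_toModel hy, chartMetric_toModel hy, real_inner_comm v, real_inner_comm u (S.ξ y)]
    simp only [map_add, map_sub, map_smul]

/-- The sectional curvature of a `(κ, μ)`-contact space form. -/
lemma IsKappaMuSpaceForm.curvature₄_eq {κ μ c : ℝ} (hN : S.IsKappaMuSpaceForm cov κ μ c)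
    (hcov : IsLeviCivita cov) (x : N) {u v : T d x} (hu : (inner ℝ u u : ℝ) = 1)
    (hv : (inner ℝ v v : ℝ) = 1) (huv : (inner ℝ u v : ℝ) = 0) :
    curvature₄ cov.nabla x u v v u = (c + 3) / 4 + 3 * (c - 1) / 4 * inner ℝ u (S.φ x v) ^ 2
      - (c + 3 - 4 * κ) / 4 * (S.η x u ^ 2 + S.η x v ^ 2)
      + 1 / 2 * (inner ℝ (S.hTensor x u) u * inner ℝ (S.hTensor x v) v - inner ℝ (S.hTensor x u) v
          ^ 2
        - inner ℝ (S.φ x (S.hTensor x u)) u * inner ℝ (S.φ x (S.hTensor x v)) v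
        + inner ℝ (S.φ x (S.hTensor x u)) v ^ 2)
      + inner ℝ (S.hTensor x u) u + inner ℝ (S.hTensor x v) v
      + (μ - 1) * (S.η x v ^ 2 * inner ℝ (S.hTensor x u) u + S.η x u ^ 2 * inner ℝ (S.hTensor x v) v
        - 2 * S.η x u * S.η x v * inner ℝ (S.hTensor x u) v) := by
  have hf := hN.flatKappaMu hcov x
  have hx := mem_ch_self (d := d) x
  have hh := toModel_hTensor (S := S) hcov hx hf.diff_φ
  have hR := hcov.toModel_curvature hx hf.diff_Γ hf.lc.torsion.self_of_nhds
  have hη : ∀ u : T d x,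
      chartMetric x (ch d x x) (rep x S.ξ (ch d x x)) (toModel x x u) = S.η x u := by
    intro u
    rw [rep_apply hx, chartMetric_toModel hx, real_inner_comm, S.inner_ξ]
  have hcx : ∀ a, chartMetric x (ch d x x) (rep x S.ξ (ch d x x)) a = 0 →
      chartMetric x (ch d x x) a a = 1 → chartMetric x (ch d x x) (flatCurv (christoffel cov x)
        (ch d x x) a (chartEnd x S.φ (ch d x x) a) (chartEnd x S.φ (ch d x x) a)) a = c := by
    intro a h1 h2
    obtain ⟨w, rfl⟩ : ∃ w : T d x, toModel x x w = a := ⟨ofModel x x a, toModel_ofModel hx a⟩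
    rw [hη] at h1
    rw [chartMetric_toModel hx] at h2
    rw [chartEnd_toModel hx, ← hR, chartMetric_toModel hx]
    refine hN.φ_sectional x w ?_ (by rw [S.inner_ξ, h1])
    rw [norm_eq_sqrt_real_inner, h2, Real.sqrt_one]
  have := hf.sectional_eq hcx (u := toModel x x u) (v := toModel x x v)
    (by rwa [chartMetric_toModel hx]) (by rwa [chartMetric_toModel hx])
    (by rwa [chartMetric_toModel hx])
  simp only [← hh, ← hR, hη, chartEnd_toModel hx, chartMetric_toModel hx] at this
  exact this

lemma IsKappaMuSpaceForm.inner_hTensor_comm {κ μ c : ℝ} (hN : S.IsKappaMuSpaceForm cov κ μ c)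
    (hcov : IsLeviCivita cov) (x : N) (u v : T d x) :
    (inner ℝ (S.hTensor x u) v : ℝ) = inner ℝ (S.hTensor x v) u := by
  have hf := hN.flatKappaMu hcov x
  have hx := mem_ch_self (d := d) x
  have := hf.H_symm (toModel x x u) (toModel x x v)
  simpa only [← toModel_hTensor (S := S) hcov hx hf.diff_φ, chartMetric_toModel hx] using this

end AlmostContactMetric
end Transfer

/-! ### The Gauss equation in charts -/

section FlatGauss
variable {A B : Type*} [NormedAddCommGroup A] [NormedSpace ℝ A] [NormedAddCommGroup B]
  [NormedSpace ℝ B]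

/-- The covariant Hessian `∇dF` of an immersion, without the tangential correction. -/
def flatHess (F : A → B) (Γ : B → B →L[ℝ] B →L[ℝ] B) (e v w : A) : B :=
  fderiv ℝ (fderiv ℝ F) e v w + Γ (F e) (fderiv ℝ F e v) (fderiv ℝ F e w)

/-- The second fundamental form in a chart. -/
def flatFF (F : A → B) (Γ : B → B →L[ℝ] B →L[ℝ] B) (Γ' : A → A →L[ℝ] A →L[ℝ] A) (e v w : A) : B :=
  flatHess F Γ e v w - fderiv ℝ F e (Γ' e v w)

variable {F : A → B} {Γ : B → B →L[ℝ] B →L[ℝ] B} {Γ' : A → A →L[ℝ] A →L[ℝ] A} {p : A}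

lemma hasFDerivAt_flatHess (hF : ContDiffAt ℝ 3 F p) (hΓ : DifferentiableAt ℝ Γ (F p))
    (v w : A) : ∃ L : A →L[ℝ] B, HasFDerivAt (fun e ↦ flatHess F Γ e v w) L p ∧
      ∀ u, L u = fderiv ℝ (fderiv ℝ (fderiv ℝ F)) p u v w
        + (fderiv ℝ Γ (F p) (fderiv ℝ F p u) (fderiv ℝ F p v) (fderiv ℝ F p w)
          + Γ (F p) (fderiv ℝ (fderiv ℝ F) p u v) (fderiv ℝ F p w)
          + Γ (F p) (fderiv ℝ F p v) (fderiv ℝ (fderiv ℝ F) p u w)) := by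
  have h0 : DifferentiableAt ℝ F p := hF.differentiableAt (by simp)
  have h1c : ContDiffAt ℝ 2 (fderiv ℝ F) p := hF.fderiv_right (m := 2) (by norm_num)
  have h1 := h1c.differentiableAt (by simp)
  have h2 : DifferentiableAt ℝ (fderiv ℝ (fderiv ℝ F)) p :=
    (h1c.fderiv_right (m := 1) le_rfl).differentiableAt (by simp)
  have hc : ∀ v : A, HasFDerivAt (fun _ : A ↦ v) (0 : A →L[ℝ] A) p := fun v ↦ hasFDerivAt_const v p
  have e1 := (h2.hasFDerivAt.clm_apply (hc v)).clm_apply (hc w)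
  have hG : HasFDerivAt (fun e ↦ Γ (F e)) (fderiv ℝ Γ (F p) ∘L fderiv ℝ F p) p :=
    HasFDerivAt.comp (g := Γ) (f := F) p hΓ.hasFDerivAt h0.hasFDerivAt
  have e2 := (hG.clm_apply (h1.hasFDerivAt.clm_apply (hc v))).clm_apply
    (h1.hasFDerivAt.clm_apply (hc w))
  refine ⟨_, e1.fun_add e2, fun u ↦ ?_⟩
  simp only [add_apply, ContinuousLinearMap.comp_apply, ContinuousLinearMap.flip_apply, zero_apply,
    map_zero, zero_add]
  abel

lemma hasFDerivAt_flatFF (hF : ContDiffAt ℝ 3 F p) (hΓ : DifferentiableAt ℝ Γ (F p))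
    (hΓ' : DifferentiableAt ℝ Γ' p)
    (v w : A) : ∃ L : A →L[ℝ] B, HasFDerivAt (fun e ↦ flatFF F Γ Γ' e v w) L p ∧
      ∀ u, L u = fderiv ℝ (fderiv ℝ (fderiv ℝ F)) p u v w
        + (fderiv ℝ Γ (F p) (fderiv ℝ F p u) (fderiv ℝ F p v) (fderiv ℝ F p w)
          + Γ (F p) (fderiv ℝ (fderiv ℝ F) p u v) (fderiv ℝ F p w)
          + Γ (F p) (fderiv ℝ F p v) (fderiv ℝ (fderiv ℝ F) p u w))
        - (fderiv ℝ F p (fderiv ℝ Γ' p u v w) + fderiv ℝ (fderiv ℝ F) p u (Γ' p v w)) := by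
  have h1c : ContDiffAt ℝ 2 (fderiv ℝ F) p := hF.fderiv_right (m := 2) (by norm_num)
  have h1 := h1c.differentiableAt (by simp)
  have hc : ∀ v : A, HasFDerivAt (fun _ : A ↦ v) (0 : A →L[ℝ] A) p := fun v ↦ hasFDerivAt_const v p
  obtain ⟨L, hL, hLu⟩ := hasFDerivAt_flatHess hF hΓ v w
  have e1 := h1.hasFDerivAt.clm_apply ((hΓ'.hasFDerivAt.clm_apply (hc v)).clm_apply (hc w))
  refine ⟨_, hL.fun_sub e1, fun u ↦ ?_⟩
  rw [sub_apply, hLu]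
  simp only [add_apply, ContinuousLinearMap.comp_apply, ContinuousLinearMap.flip_apply,
    zero_apply, map_zero, zero_add]

/-- The Gauss equation in a chart. -/
lemma flat_gauss {g : B → B →L[ℝ] B →L[ℝ] ℝ} (hg : DifferentiableAt ℝ g (F p)) (hF : ContDiffAt ℝ 3
    F p)
    (hΓ : DifferentiableAt ℝ Γ (F p)) (hΓ' : DifferentiableAt ℝ Γ' p)
    (hn : ∀ᶠ e in 𝓝 p, ∀ v w z, g (F e) (flatFF F Γ Γ' e v w) (fderiv ℝ F e z) = 0)
    (hm : ∀ u z b, (∀ c, g (F p) b (fderiv ℝ F p c) = 0) →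
      fderiv ℝ g (F p) (fderiv ℝ F p u) b (fderiv ℝ F p z)
        = g (F p) (Γ (F p) (fderiv ℝ F p u) b) (fderiv ℝ F p z)
          + g (F p) b (Γ (F p) (fderiv ℝ F p u) (fderiv ℝ F p z)))
    (u v w z : A) :
    g (F p) (fderiv ℝ F p (flatCurv Γ' p u v w)) (fderiv ℝ F p z)
      = g (F p) (flatCurv Γ (F p) (fderiv ℝ F p u) (fderiv ℝ F p v) (fderiv ℝ F p w))
          (fderiv ℝ F p z)
        + g (F p) (flatFF F Γ Γ' p v w) (flatFF F Γ Γ' p u z)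
        - g (F p) (flatFF F Γ Γ' p u w) (flatFF F Γ Γ' p v z) := by
  have h0 : DifferentiableAt ℝ F p := hF.differentiableAt (by simp)
  have h1c : ContDiffAt ℝ 2 (fderiv ℝ F) p := hF.fderiv_right (m := 2) (by norm_num)
  have h1 := h1c.differentiableAt (by simp)
  have hc : ∀ v : A, HasFDerivAt (fun _ : A ↦ v) (0 : A →L[ℝ] A) p := fun v ↦ hasFDerivAt_const v p
  have hn0 := hn.self_of_nhds
  -- D is the derivative along u of the normal field B(v, w), so D plus its Γ-term is the ambient
  -- covariant derivative of that field. Its tangential part is −⟨B(v, w), B(u, z)⟩.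
  have key : ∀ u v w, ∃ D : B,
      D + Γ (F p) (fderiv ℝ F p u) (flatFF F Γ Γ' p v w)
          + flatFF F Γ Γ' p u (Γ' p v w)
          + fderiv ℝ F p (fderiv ℝ Γ' p u v w + Γ' p u (Γ' p v w))
        = fderiv ℝ (fderiv ℝ (fderiv ℝ F)) p u v w
          + (fderiv ℝ Γ (F p) (fderiv ℝ F p u) (fderiv ℝ F p v) (fderiv ℝ F p w)
            + Γ (F p) (fderiv ℝ (fderiv ℝ F) p u v) (fderiv ℝ F p w)
            + Γ (F p) (fderiv ℝ F p v) (fderiv ℝ (fderiv ℝ F) p u w))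
          + Γ (F p) (fderiv ℝ F p u) (flatHess F Γ p v w) ∧
      ∀ z, g (F p) (D + Γ (F p) (fderiv ℝ F p u) (flatFF F Γ Γ' p v w)) (fderiv ℝ F p z)
        = -g (F p) (flatFF F Γ Γ' p v w) (flatFF F Γ Γ' p u z) := by
    intro u v w
    obtain ⟨L, hL, hLu⟩ := hasFDerivAt_flatFF hF hΓ hΓ' v w
    refine ⟨L u, ?_, fun z ↦ ?_⟩
    · rw [hLu]
      simp only [flatFF, flatHess, map_sub, map_add]
      abel
    · have hG : HasFDerivAt (fun e ↦ g (F e)) (fderiv ℝ g (F p) ∘L fderiv ℝ F p) p :=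
        HasFDerivAt.comp (g := g) (f := F) p hg.hasFDerivAt h0.hasFDerivAt
      have e3 := (hG.clm_apply hL).clm_apply (h1.hasFDerivAt.clm_apply (hc z))
      have e4 : (fun e ↦ g (F e) (flatFF F Γ Γ' e v w) (fderiv ℝ F e z)) =ᶠ[𝓝 p] fun _ ↦ 0 := by
        filter_upwards [hn] with e he using he v w z
      have e5 := congrArg (fun L : A →L[ℝ] ℝ ↦ L u) (e3.fderiv.symm.trans e4.fderiv_eq)
      -- The only use of metric compatibility: one argument normal, the other tangent. A connection
      -- that is not metric may still satisfy this.
      have e6 := hm u z (flatFF F Γ Γ' p v w) (hn0 v w)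
      have e7 : flatHess F Γ p u z = flatFF F Γ Γ' p u z + fderiv ℝ F p (Γ' p u z) := by
        rw [flatFF]; abel
      have e8 := congrArg (g (F p) (flatFF F Γ Γ' p v w)) e7
      rw [map_add, hn0, flatHess, map_add] at e8
      simp only [add_apply, ContinuousLinearMap.comp_apply, ContinuousLinearMap.flip_apply,
        zero_apply, map_zero, zero_add, fderiv_fun_const, Pi.zero_apply] at e5
      rw [map_add, add_apply]
      linarith
  obtain ⟨D1, hD1, hD1z⟩ := key u v w
  obtain ⟨D2, hD2, hD2z⟩ := key v u w
  -- Third derivatives of F, and the terms with its second derivative in the directions u, v, cancel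
  -- when u and v are exchanged and the results subtracted.
  have hs3 := congrArg (fun L : A →L[ℝ] B ↦ L w) (fderiv_fderiv_comm h1c u v)
  have hs2 := fderiv_fderiv_comm (hF.of_le (by norm_num) : ContDiffAt ℝ 2 F p) u v
  rw [hs3, hs2] at hD1
  have e1 : fderiv ℝ F p (flatCurv Γ' p u v w)
      = flatCurv Γ (F p) (fderiv ℝ F p u) (fderiv ℝ F p v) (fderiv ℝ F p w)
        - (D1 + Γ (F p) (fderiv ℝ F p u) (flatFF F Γ Γ' p v w))
        + (D2 + Γ (F p) (fderiv ℝ F p v) (flatFF F Γ Γ' p u w))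
        - flatFF F Γ Γ' p u (Γ' p v w) + flatFF F Γ Γ' p v (Γ' p u w) := by
    have e2 := congrArg₂ (fun a b : B ↦ a - b) hD1 hD2
    rw [← sub_eq_zero] at e2 ⊢
    rw [← e2, flatCurv, flatCurv]
    simp only [flatHess, map_add, map_sub]
    abel
  rw [e1]
  simp only [map_add (g (F p)), map_sub (g (F p)), add_apply, sub_apply, hn0] at hD1z hD2z ⊢
  linarith [hD1z z, hD2z z]

end FlatGauss

/-! ### Derivatives of vector fields along an immersion -/

section Immersion
variable {n d : ℕ}
  {M : Type*} [TopologicalSpace M] [ChartedSpace (E n) M] [IsManifold (𝓡 n) ∞ M]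
  {N : Type*} [TopologicalSpace N] [ChartedSpace (E d) N] [IsManifold (𝓡 d) ∞ N]

/-- The expression of `f` in the charts at `x` and `f x`. -/
def chartMap (f : M → N) (x : M) (e : E n) : E d := ch d (f x) (f ((ch n x).symm e))

/-- The expression in charts of a vector field along `f`. -/
def repAlong (f : M → N) (x : M) (V : Π y : M, T d (f y)) (e : E n) : E d :=
  toModel (f x) (f ((ch n x).symm e)) (V ((ch n x).symm e))

omit [IsManifold (𝓡 n) ∞ M] [IsManifold (𝓡 d) ∞ N] in
lemma chartMap_ch (f : M → N) {x y : M} (hy : y ∈ (ch n x).source) :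
    chartMap (d := d) f x (ch n x y) = ch d (f x) (f y) := by
  rw [chartMap, ch_left hy]

/-- The points near `x` at which the charts at `x` and `f x` can be used. -/
def chartDom (n d : ℕ) {M : Type*} [TopologicalSpace M] [ChartedSpace (E n) M]
    {N : Type*} [TopologicalSpace N] [ChartedSpace (E d) N] (f : M → N) (x : M) : Set M :=
  {y | y ∈ (ch n x).source ∧ f y ∈ (ch d (f x)).source}

variable {f : M → N} (hf : ContMDiff (𝓡 n) (𝓡 d) ∞ f)
include hf

omit [IsManifold (𝓡 n) ∞ M] [IsManifold (𝓡 d) ∞ N] in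
lemma chartDom_mem_nhds {x y : M} (hy : y ∈ chartDom n d f x) : chartDom n d f x ∈ 𝓝 y := by
  filter_upwards [extChartAt_source_mem_nhds' hy.1,
    hf.continuous.continuousAt (extChartAt_source_mem_nhds' hy.2)] with z h1 h2 using ⟨h1, h2⟩

omit hf [IsManifold (𝓡 n) ∞ M] [IsManifold (𝓡 d) ∞ N] in
lemma mem_chartDom_self (x : M) : x ∈ chartDom n d f x := ⟨mem_ch_self x, mem_ch_self (f x)⟩

omit [IsManifold (𝓡 d) ∞ N] in
lemma eventually_chartDom {x y : M} (hy : y ∈ chartDom n d f x) :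
    ∀ᶠ e in 𝓝 (ch n x y), (ch n x).symm e ∈ chartDom n d f x ∧ e ∈ (ch n x).target := by
  have h1 := (mdiff_symm hy.1).continuousAt
  have h2 : chartDom n d f x ∈ 𝓝 ((ch n x).symm (ch n x y)) := by
    rw [ch_left hy.1]; exact chartDom_mem_nhds hf hy
  filter_upwards [h1.eventually_mem h2, ch_target_mem hy.1] with e h3 h4 using ⟨h3, h4⟩

omit [IsManifold (𝓡 n) ∞ M] in
lemma contMDiffAt_ch_comp {x y : M} (hy : y ∈ chartDom n d f x) :
    ContMDiffAt (𝓡 n) 𝓘(ℝ, E d) ∞ (ch d (f x) ∘ f) y :=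
  ContMDiffAt.comp y (mdiff_ch hy.2) (hf y)

lemma contDiffAt_chartMap {x y : M} (hy : y ∈ chartDom n d f x) :
    ContDiffAt ℝ ∞ (chartMap (d := d) f x) (ch n x y) :=
  contDiffAt_comp_symm hy.1 (contMDiffAt_ch_comp hf hy)

lemma toModel_df {x y : M} (hy : y ∈ chartDom n d f x) (v : T n y) :
    toModel (f x) (f y) (df f y v)
      = fderiv ℝ (chartMap (d := d) f x) (ch n x y) (toModel x y v) := by
  have h1 := mvfderiv_eq hy.1 ((contMDiffAt_ch_comp hf hy).mdifferentiableAt (by simp)) v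
  have h2 := mvfderiv_eq hy.2 ((mdiff_ch hy.2).mdifferentiableAt (by simp)) (df f y v)
  have h3 : mvfderiv (𝓡 n) (ch d (f x) ∘ f) y v = mvfderiv (𝓡 d) (ch d (f x)) (f y) (df f y v) := by
    have := mfderiv_comp (I := 𝓡 n) (I' := 𝓡 d) (I'' := 𝓘(ℝ, E d)) y
      ((mdiff_ch hy.2).mdifferentiableAt (by simp)) ((hf y).mdifferentiableAt (by simp))
    exact congrArg (fun L ↦ L v) this
  have h4 : (ch d (f x)) ∘ (ch d (f x)).symm =ᶠ[𝓝 (ch d (f x) (f y))] id := by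
    filter_upwards [ch_target_mem hy.2] with e he using (ch d (f x)).right_inv he
  rw [h4.fderiv_eq, fderiv_id] at h2
  exact (h2.symm.trans h3.symm).trans h1

omit hf in
lemma contDiffAt_toModel {x b y : N} (hx : y ∈ (ch d x).source) (hb : y ∈ (ch d b).source)
    {W : Π z : N, T d z} (hW : ContMDiffAt (𝓡 d) ((𝓡 d).prod 𝓘(ℝ, E d)) ∞
      (fun z ↦ (⟨z, W z⟩ : TotalSpace (E d) (fun z : N ↦ TangentSpace (𝓡 d) z))) y) :
    ContDiffAt ℝ ∞ (fun e ↦ toModel b ((ch d x).symm e) (W ((ch d x).symm e))) (ch d x y) := by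
  rw [(trivializationAt (E d) (fun z : N ↦ TangentSpace (𝓡 d) z) b).contMDiffAt_section_iff
    (mem_base hb)] at hW
  refine (contDiffAt_comp_symm hx hW).congr_of_eventuallyEq ?_
  have h1 := (mdiff_symm hx).continuousAt
  have h2 : (ch d b).source ∈ 𝓝 ((ch d x).symm (ch d x y)) := by
    rw [ch_left hx]; exact extChartAt_source_mem_nhds' hb
  filter_upwards [h1.eventually_mem h2] with e he
  rw [Function.comp_apply, triv_snd he]

omit hf in
/-- The change of trivialization is smooth. -/
lemma contDiffAt_toModel_ofModel {x a b y : N} (hx : y ∈ (ch d x).source)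
    (ha : y ∈ (ch d a).source) (hb : y ∈ (ch d b).source) :
    ContDiffAt ℝ ∞ (fun e ↦ toModel b ((ch d x).symm e) ∘L ofModel (d := d) a ((ch d x).symm e))
      (ch d x y) := by
  refine contDiffAt_clm_of_apply fun c ↦ ?_
  refine (contDiffAt_toModel hx hb (contMDiffAt_constField ha c)).congr_of_eventuallyEq ?_
  have h1 := (mdiff_symm hx).continuousAt
  have h2 : (ch d a).source ∈ 𝓝 ((ch d x).symm (ch d x y)) := by
    rw [ch_left hx]; exact extChartAt_source_mem_nhds' ha
  filter_upwards [h1.eventually_mem h2] with e he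
  rw [constField_apply he, ContinuousLinearMap.comp_apply]

/-- The definition at y uses the trivialization at f y, while this formula uses the one at f x. The
derivative of the transition map occurs both in D of the extended vector and in the derivative of
the components of V, in the same form. -/
lemma toModel_nablaAlong {D : Nabla d N} {x : M}
    {Γ : E d → E d →L[ℝ] E d →L[ℝ] E d}
    (h : HasChristoffel D (f x) Γ) {y : M} (hy : y ∈ chartDom n d f x)
    {V : Π z : M, T d (f z)}
    (hV : DifferentiableAt ℝ (repAlong (n := n) f x V) (ch n x y)) (v : T n y) :
    toModel (f x) (f y) (nablaAlong D f V y v)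
      = fderiv ℝ (repAlong (n := n) f x V) (ch n x y) (toModel x y v)
        + Γ (ch d (f x) (f y)) (fderiv ℝ (chartMap (d := d) f x) (ch n x y) (toModel x y v))
          (toModel (f x) (f y) (V y)) := by
  set F := chartMap (n := n) (d := d) f x with hFdef
  set p := ch n x y with hp
  have hFp : F p = ch d (f x) (f y) := chartMap_ch (n := n) f hy.1
  have hF : DifferentiableAt ℝ F p := (contDiffAt_chartMap hf hy).differentiableAt (by simp)
  set Φ : E d → E d →L[ℝ] E d := fun e ↦ toModel (f x) ((ch d (f x)).symm e) ∘L
    ofModel (f y) ((ch d (f x)).symm e) with hΦdef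
  set Ψ : E d → E d →L[ℝ] E d := fun e ↦ toModel (f y) ((ch d (f x)).symm e) ∘L
    ofModel (f x) ((ch d (f x)).symm e) with hΨdef
  have hΦ : DifferentiableAt ℝ Φ (F p) := by
    rw [hFp]
    exact (contDiffAt_toModel_ofModel hy.2 (mem_ch_self _) hy.2).differentiableAt (by simp)
  have hΨ : DifferentiableAt ℝ Ψ (F p) := by
    rw [hFp]
    exact (contDiffAt_toModel_ofModel hy.2 hy.2 (mem_ch_self _)).differentiableAt (by simp)
  set c : M → E d := fun z ↦ (trivializationAt (E d) (fun z : N ↦ TangentSpace (𝓡 d) z) (f y)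
    ⟨f z, V z⟩).2 with hcdef
  have hnear : ∀ᶠ e in 𝓝 p, (ch n x).symm e ∈ chartDom n d f x
      ∧ f ((ch n x).symm e) ∈ (ch d (f y)).source := by
    have h1 := (mdiff_symm hy.1).continuousAt
    have h2 : f ⁻¹' (ch d (f y)).source ∈ 𝓝 ((ch n x).symm p) := by
      rw [ch_left hy.1]; exact hf.continuous.continuousAt (extChartAt_source_mem_nhds _)
    filter_upwards [eventually_chartDom hf hy, h1.eventually_mem h2] with e h3 h4 using ⟨h3.1, h4⟩
  have hFe : ∀ e, (ch n x).symm e ∈ chartDom n d f x →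
      (ch d (f x)).symm (F e) = f ((ch n x).symm e) := by
    intro e he
    rw [hFdef, chartMap, ch_left he.2]
  have hcΨ : c ∘ (ch n x).symm =ᶠ[𝓝 p] fun e ↦ Ψ (F e) (repAlong f x V e) := by
    filter_upwards [hnear] with e he
    simp only [hΨdef, hcdef, Function.comp_apply]
    rw [hFe e he.1, triv_snd he.2, ContinuousLinearMap.comp_apply, repAlong,
      ofModel_toModel he.1.2]
  have hcd : DifferentiableAt ℝ (c ∘ (ch n x).symm) p :=
    (DifferentiableAt.clm_apply (hΨ.comp p hF) hV).congr_of_eventuallyEq hcΨ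
  have hVΦ : repAlong f x V =ᶠ[𝓝 p] fun e ↦ Φ (F e) ((c ∘ (ch n x).symm) e) := by
    filter_upwards [hnear] with e he
    simp only [hΦdef, hcdef, Function.comp_apply]
    rw [hFe e he.1, triv_snd he.2, ContinuousLinearMap.comp_apply, repAlong,
      ofModel_toModel he.2]
  have hcp : (c ∘ (ch n x).symm) p = toModel (f y) (f y) (V y) := by
    rw [Function.comp_apply, hp, ch_left hy.1, hcdef]
    exact triv_snd (mem_ch_self (f y)) _
  have hΦF : HasFDerivAt (fun e ↦ Φ (F e)) (fderiv ℝ Φ (F p) ∘L fderiv ℝ F p) p :=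
    HasFDerivAt.comp (g := Φ) (f := F) p hΦ.hasFDerivAt hF.hasFDerivAt
  have hΦp : ∀ a, Φ (F p) a = toModel (f x) (f y) (ofModel (f y) (f y) a) := by
    intro a
    simp only [hΦdef]
    rw [hFp, ch_left hy.2, ContinuousLinearMap.comp_apply]
  have e1 : fderiv ℝ (repAlong (n := n) f x V) p (toModel x y v)
      = fderiv ℝ Φ (F p) (fderiv ℝ F p (toModel x y v)) (toModel (f y) (f y) (V y))
        + Φ (F p) (fderiv ℝ (c ∘ (ch n x).symm) p (toModel x y v)) := by
    rw [hVΦ.fderiv_eq, (hΦF.clm_apply hcd.hasFDerivAt).fderiv, ← hcp]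
    simp only [add_apply, ContinuousLinearMap.comp_apply, ContinuousLinearMap.flip_apply]
    abel
  have e2 : toModel (f x) (f y) (D (extendField (V y)) (f y) (df f y v))
      = fderiv ℝ Φ (F p) (fderiv ℝ F p (toModel x y v)) (toModel (f y) (f y) (V y))
        + Γ (F p) (fderiv ℝ F p (toModel x y v)) (toModel (f x) (f y) (V y)) := by
    have e3 : rep (f x) (extendField (V y)) =ᶠ[𝓝 (F p)]
        fun e ↦ Φ e (toModel (f y) (f y) (V y)) := by
      have h1 := (mdiff_symm hy.2).continuousAt
      have h2 : (ch d (f y)).source ∈ 𝓝 ((ch d (f x)).symm (ch d (f x) (f y))) := by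
        rw [ch_left hy.2]; exact extChartAt_source_mem_nhds _
      rw [hFp]
      filter_upwards [h1.eventually_mem h2] with e he
      rw [rep, extendField_eq, constField_apply he]
      rfl
    rw [h (f y) hy.2 _ (vdiffAt_extendField (V y)), ← hFp, e3.fderiv_eq, fderiv_apply₁ hΦ,
      e3.eq_of_nhds, hΦp, ofModel_toModel (mem_ch_self _), toModel_df hf hy]
  have e4 : toModel (f x) (f y) ((trivializationAt (E d) (fun z : N ↦ TangentSpace (𝓡 d) z)
      (f y)).symm (f y) (mvfderiv (𝓡 n) c y v))
      = Φ (F p) (fderiv ℝ (c ∘ (ch n x).symm) p (toModel x y v)) := by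
    rw [triv_symm (mem_ch_self (f y)), hΦp,
      mvfderiv_eq hy.1 (mdifferentiableAt_of_comp_symm hy.1 hcd)]
  have e5 : nablaAlong D f V y v = D (extendField (V y)) (f y) (df f y v)
      + (trivializationAt (E d) (fun z : N ↦ TangentSpace (𝓡 d) z)
      (f y)).symm (f y) (mvfderiv (𝓡 n) c y v) := rfl
  rw [e5, map_add, e2, e4, e1, ← hFp]
  abel

end Immersion

lemma isInvertible_of_pos {A : Type*} [NormedAddCommGroup A] [NormedSpace ℝ A]
    [FiniteDimensional ℝ A] {G : A →L[ℝ] A →L[ℝ] ℝ} (hG : ∀ a, a ≠ 0 → 0 < G a a) :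
    G.IsInvertible := by
  have hinj : Function.Injective G.toLinearMap := by
    rw [injective_iff_map_eq_zero]
    intro a ha
    by_contra hne
    have h1 := hG a hne
    have h2 : G a = 0 := ha
    rw [h2] at h1
    simp at h1
  have hfin : Module.finrank ℝ A = Module.finrank ℝ (A →L[ℝ] ℝ) := by
    rw [← LinearEquiv.finrank_eq (LinearMap.toContinuousLinearMap (𝕜 := ℝ) (E := A) (F' := ℝ))]
    exact (Subspace.dual_finrank_eq (K := ℝ) (V := A)).symm
  refine ⟨(LinearMap.linearEquivOfInjective G.toLinearMap hinj hfin).toContinuousLinearEquiv, ?_⟩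
  ext a
  rfl

/-- The Hessian of `f` in charts, as a bilinear map. -/
def flatHessL {A B : Type*} [NormedAddCommGroup A] [NormedSpace ℝ A] [NormedAddCommGroup B]
    [NormedSpace ℝ B] (F : A → B) (Γ : B → B →L[ℝ] B →L[ℝ] B) (e : A) : A →L[ℝ] A →L[ℝ] B :=
  fderiv ℝ (fderiv ℝ F) e + (Γ (F e)).bilinearComp (fderiv ℝ F e) (fderiv ℝ F e)

lemma differentiableAt_clmInverse {A B C : Type*} [NormedAddCommGroup A] [NormedSpace ℝ A]
    [NormedAddCommGroup B] [NormedSpace ℝ B] [CompleteSpace B] [NormedAddCommGroup C]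
    [NormedSpace ℝ C] {G : A → B →L[ℝ] C} {a : A} (hG : DifferentiableAt ℝ G a) {L : B ≃L[ℝ] C}
    (hL : G a = L) : DifferentiableAt ℝ (fun e ↦ (G e).inverse) a := by
  refine DifferentiableAt.comp (g := ContinuousLinearMap.inverse) (f := G) _ ?_ hG
  rw [hL]
  exact (contDiffAt_map_inverse (n := 1) L).differentiableAt (by simp)

lemma differentiableAt_compL {A B C D : Type*} [NormedAddCommGroup A] [NormedSpace ℝ A]
    [NormedAddCommGroup B] [NormedSpace ℝ B] [NormedAddCommGroup C] [NormedSpace ℝ C]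
    [NormedAddCommGroup D] [NormedSpace ℝ D] {G : A → B →L[ℝ] C} {a : A}
    (hG : DifferentiableAt ℝ G a) :
    DifferentiableAt ℝ (fun e ↦ ContinuousLinearMap.compL ℝ D B C (G e)) a :=
  DifferentiableAt.comp (g := ContinuousLinearMap.compL ℝ D B C) (f := G) a
    (ContinuousLinearMap.compL ℝ D B C).differentiableAt hG

/-! ### Tangential and normal parts -/

section Induced
variable {n d : ℕ}
  {M : Type*} [TopologicalSpace M] [ChartedSpace (E n) M] [IsManifold (𝓡 n) ∞ M]
  [RiemannianBundle (fun x : M ↦ TangentSpace (𝓡 n) x)]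
  {N : Type*} [TopologicalSpace N] [ChartedSpace (E d) N] [IsManifold (𝓡 d) ∞ N]
  [RiemannianBundle (fun x : N ↦ TangentSpace (𝓡 d) x)]

omit [IsManifold (𝓡 n) ∞ M] [IsManifold (𝓡 d) ∞ N] in
lemma inner_tangential (f : M → N) (x : M) (w : T d (f x)) (u : T n x) :
    (inner ℝ (tangential (n := n) f x w) u : ℝ) = inner ℝ w (df f x u) :=
  LinearMap.adjoint_inner_left _ _ _

variable {f : M → N} (hf : IsIsometricImmersion (n := n) (d := d) f)
include hf

omit [IsManifold (𝓡 n) ∞ M] [IsManifold (𝓡 d) ∞ N] in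
lemma IsIsometricImmersion.tangential_df (x : M) (u : T n x) :
    tangential (n := n) f x (df (d := d) f x u) = u := by
  refine ext_inner_right ℝ fun v ↦ ?_
  rw [inner_tangential, hf.isometric]

omit [IsManifold (𝓡 n) ∞ M] [IsManifold (𝓡 d) ∞ N] in
lemma IsIsometricImmersion.normal_df (x : M) (u : T n x) :
    normal (n := n) f x (df (d := d) f x u) = 0 := by
  rw [normal, hf.tangential_df, sub_self]

omit hf [IsManifold (𝓡 n) ∞ M] [IsManifold (𝓡 d) ∞ N] in
lemma normal_add (x : M) (v w : T d (f x)) :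
    normal (n := n) f x (v + w) = normal (n := n) f x v + normal (n := n) f x w := by
  simp only [normal, map_add]
  abel

omit [IsManifold (𝓡 n) ∞ M] [IsManifold (𝓡 d) ∞ N] in
lemma IsIsometricImmersion.inner_normal_df (x : M) (w : T d (f x)) (u : T n x) :
    (inner ℝ (normal (n := n) f x w) (df f x u) : ℝ) = 0 := by
  rw [normal, inner_sub_left, hf.isometric, inner_tangential, sub_self]

/-- The semi-symmetric connection has the same second fundamental form as the Levi-Civita
connection if `P` is tangent to the submanifold. -/
lemma IsIsometricImmersion.secondFF_semiSymmetric (cov : Connection d N) {P : Π z : N, T d z}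
    (lam₁ lam₂ : ℝ) {x : M} (hP : ∃ u : T n x, df f x u = P (f x)) (u v : T n x) :
    secondFF (semiSymmetric cov P lam₁ lam₂) f x u v = secondFF cov.nabla f x u v := by
  obtain ⟨w, hw⟩ := hP
  -- The two connections differ by a combination of df u and P, both tangent, which the normal
  -- projection kills.
  have h1 : nablaAlong (semiSymmetric cov P lam₁ lam₂) f (fun y ↦ df f y (extendField v y)) x u
      = nablaAlong cov.nabla f (fun y ↦ df f y (extendField v y)) x u
        + df f x ((lam₁ * inner ℝ (P (f x)) (df (d := d) f x v)) • u
          + (-(lam₂ * inner ℝ (df (d := d) f x u) (df f x v))) • w) := by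
    rw [map_add, map_smul, map_smul, hw]
    simp only [nablaAlong, semiSymmetric, Connection.nabla, extendField_self]
    rw [neg_smul]
    abel
  rw [secondFF, h1, normal_add, hf.normal_df, add_zero, secondFF]

end Induced

/-! ### The induced connection and the Gauss equation -/

section InducedChart
variable {n d : ℕ}
  {M : Type*} [TopologicalSpace M] [ChartedSpace (E n) M] [IsManifold (𝓡 n) ∞ M]
  [RiemannianBundle (fun x : M ↦ TangentSpace (𝓡 n) x)]
  {N : Type*} [TopologicalSpace N] [ChartedSpace (E d) N] [IsManifold (𝓡 d) ∞ N]
  [RiemannianBundle (fun x : N ↦ TangentSpace (𝓡 d) x)]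

/-- The tangential part in charts. -/
def chartTan (n : ℕ) {d : ℕ} {M : Type*} [TopologicalSpace M] [ChartedSpace (E n) M]
    [IsManifold (𝓡 n) ∞ M] [RiemannianBundle (fun x : M ↦ TangentSpace (𝓡 n) x)]
    {N : Type*} [TopologicalSpace N] [ChartedSpace (E d) N] [IsManifold (𝓡 d) ∞ N]
    [RiemannianBundle (fun x : N ↦ TangentSpace (𝓡 d) x)] (f : M → N) (x : M) (e : E n) :
    E d →L[ℝ] E n :=
  toModel x ((ch n x).symm e) ∘L
    (tangential (n := n) (d := d) f ((ch n x).symm e)).toContinuousLinearMap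
    ∘L ofModel (f x) (f ((ch n x).symm e))

/-- The Christoffel symbol of the induced connection. -/
def inducedChristoffel (f : M → N) (Γ : E d → E d →L[ℝ] E d →L[ℝ] E d) (x : M) (e : E n) :
    E n →L[ℝ] E n →L[ℝ] E n :=
  (ContinuousLinearMap.compL ℝ (E n) (E d) (E n) (chartTan n f x e)) ∘L
    flatHessL (chartMap (d := d) f x) Γ e

lemma inducedChristoffel_apply (f : M → N) (Γ : E d → E d →L[ℝ] E d →L[ℝ] E d) (x : M)
    (e a b : E n) : inducedChristoffel (n := n) (d := d) f Γ x e a b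
      = chartTan n (d := d) f x e (flatHess (chartMap (n := n) (d := d) f x) Γ e a b) := rfl

lemma chartTan_toModel (f : M → N) {x y : M} (hy : y ∈ chartDom n d f x) (w : T d (f y)) :
    chartTan n (d := d) f x (ch n x y) (toModel (f x) (f y) w)
      = toModel x y (tangential (n := n) f y w) := by
  rw [chartTan, ch_left hy.1]
  simp only [ContinuousLinearMap.comp_apply]
  rw [ofModel_toModel hy.2]
  rfl

variable {f : M → N} (hf : IsIsometricImmersion (n := n) (d := d) f)
include hf

omit [IsManifold (𝓡 d) ∞ N] [RiemannianBundle (fun x : M ↦ TangentSpace (𝓡 n) x)]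
  [RiemannianBundle (fun x : N ↦ TangentSpace (𝓡 d) x)] hf in
lemma transfer_chartDom (hf : ContMDiff (𝓡 n) (𝓡 d) ∞ f) (x : M) {p : E n → Prop}
    (hp : ∀ y ∈ chartDom n d f x, p (ch n x y)) : ∀ᶠ e in 𝓝 (ch n x x), p e := by
  filter_upwards [eventually_chartDom hf (mem_chartDom_self x)] with e he
  have := hp _ he.1
  rwa [(ch n x).right_inv he.2] at this

lemma chartMetric_chartTan {x y : M} (hy : y ∈ chartDom n d f x) (b : E d) (a : E n) :
    chartMetric x (ch n x y) (chartTan n (d := d) f x (ch n x y) b) a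
      = chartMetric (f x) (chartMap (n := n) (d := d) f x (ch n x y)) b (fderiv ℝ (chartMap (n :=
          n) (d := d) f x) (ch n x y) a) := by
  obtain ⟨w, rfl⟩ : ∃ w : T d (f y), toModel (f x) (f y) w = b := ⟨_, toModel_ofModel hy.2 b⟩
  obtain ⟨u, rfl⟩ : ∃ u : T n y, toModel x y u = a := ⟨_, toModel_ofModel hy.1 a⟩
  rw [chartTan_toModel f hy, chartMetric_toModel hy.1, chartMap_ch f hy.1, ← toModel_df hf.smooth
      hy,
    chartMetric_toModel hy.2, inner_tangential]

lemma chartTan_fderiv {x y : M} (hy : y ∈ chartDom n d f x) (a : E n) :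
    chartTan n (d := d) f x (ch n x y) (fderiv ℝ (chartMap (n := n) (d := d) f x) (ch n x y) a) = a
        := by
  obtain ⟨u, rfl⟩ : ∃ u : T n y, toModel x y u = a := ⟨_, toModel_ofModel hy.1 a⟩
  rw [← toModel_df hf.smooth hy, chartTan_toModel f hy, hf.tangential_df]

/-- Differentiating dF·V gives dF(dV) plus the Hessian of F with its Γ-term. The tangential part
inverts dF on the first summand, so the Christoffel symbol is the tangential part of the second. -/
lemma hasChristoffelAt_induced {D : Nabla d N} {x : M} {Γ : E d → E d →L[ℝ] E d →L[ℝ] E d}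
    (h : HasChristoffel D (f x) Γ) {y : M} (hy : y ∈ chartDom n d f x) :
    HasChristoffelAt (induced D f) x (inducedChristoffel (n := n) (d := d) f Γ x) y := by
  intro V hV v
  have hV' := (vdiffAt_iff hy.1 V).1 hV
  have hF := contDiffAt_chartMap hf.smooth hy
  have hdF : DifferentiableAt ℝ (fderiv ℝ (chartMap (n := n) (d := d) f x)) (ch n x y) :=
    (hF.fderiv_right (m := 1) (WithTop.coe_le_coe.2 le_top)).differentiableAt (by simp)
  have h1 : repAlong f x (fun z ↦ df (n := n) (d := d) f z (V z)) =ᶠ[𝓝 (ch n x y)]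
      fun e ↦ fderiv ℝ (chartMap (n := n) (d := d) f x) e (rep x V e) := by
    filter_upwards [eventually_chartDom hf.smooth hy] with e he
    rw [repAlong, toModel_df hf.smooth he.1, (ch n x).right_inv he.2, rep]
  have h2 : DifferentiableAt ℝ (repAlong f x (fun z ↦ df (n := n) (d := d) f z (V z)))
      (ch n x y) := (hdF.clm_apply hV').congr_of_eventuallyEq h1
  have h3 := toModel_nablaAlong hf.smooth h hy h2 v
  rw [h1.fderiv_eq, (hdF.hasFDerivAt.clm_apply hV'.hasFDerivAt).fderiv, toModel_df hf.smooth hy,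
    ← chartMap_ch f hy.1] at h3
  have h4 : induced D f V y v
      = tangential f y (nablaAlong D f (fun z ↦ df (n := n) (d := d) f z (V z)) y v) := rfl
  rw [h4, ← chartTan_toModel f hy, h3, inducedChristoffel_apply, flatHess, rep_apply hy.1]
  simp only [add_apply, ContinuousLinearMap.comp_apply, ContinuousLinearMap.flip_apply, map_add,
    chartTan_fderiv hf hy]
  abel

lemma toModel_secondFF {D : Nabla d N} {x : M} {Γ : E d → E d →L[ℝ] E d →L[ℝ] E d}
    (h : HasChristoffel D (f x) Γ) (u v : T n x) :
    toModel (f x) (f x) (secondFF D f x u v)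
      = flatFF (chartMap (n := n) (d := d) f x) Γ (inducedChristoffel (n := n) (d := d) f Γ x) (ch
          n x x) (toModel x x u)
        (toModel x x v) := by
  have hy := mem_chartDom_self (n := n) (d := d) (f := f) x
  have hF := contDiffAt_chartMap hf.smooth hy
  have hdF : DifferentiableAt ℝ (fderiv ℝ (chartMap (n := n) (d := d) f x)) (ch n x x) :=
    (hF.fderiv_right (m := 1) (WithTop.coe_le_coe.2 le_top)).differentiableAt (by simp)
  have h1 : repAlong f x (fun z ↦ df (n := n) (d := d) f z (extendField v z)) =ᶠ[𝓝 (ch n x x)]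
      fun e ↦ fderiv ℝ (chartMap (n := n) (d := d) f x) e (toModel x x v) := by
    filter_upwards [eventually_chartDom hf.smooth hy] with e he
    rw [repAlong, toModel_df hf.smooth he.1, (ch n x).right_inv he.2, extendField_eq,
      constField_apply he.1.1, toModel_ofModel he.1.1]
  have h2 : DifferentiableAt ℝ (repAlong f x (fun z ↦ df (n := n) (d := d) f z (extendField v z)))
      (ch n x x) :=
    (hdF.clm_apply (differentiableAt_const _)).congr_of_eventuallyEq h1
  have h3 := toModel_nablaAlong hf.smooth h hy h2 u
  rw [h1.fderiv_eq, fderiv_apply₁ hdF, extendField_self, toModel_df hf.smooth hy,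
    ← chartMap_ch f hy.1] at h3
  rw [secondFF, normal, map_sub, toModel_df hf.smooth hy, ← chartTan_toModel f hy, h3, flatFF,
    inducedChristoffel_apply]
  rfl

variable [IsContMDiffRiemannianBundle (𝓡 n) ∞ (E n) (fun x : M ↦ TangentSpace (𝓡 n) x)]
  [IsContMDiffRiemannianBundle (𝓡 d) ∞ (E d) (fun x : N ↦ TangentSpace (𝓡 d) x)]

/-- The tangential part is the inverse of the metric of M applied to the form g(·, dF ·). Inversion
is differentiable at an invertible operator, and positivity gives invertibility. -/
lemma differentiableAt_chartTan (x : M) :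
    DifferentiableAt ℝ (chartTan n (d := d) f x) (ch n x x) := by
  have hy := mem_chartDom_self (n := n) (d := d) (f := f) x
  have hF := contDiffAt_chartMap hf.smooth hy
  have hF0 : DifferentiableAt ℝ (chartMap (n := n) (d := d) f x) (ch n x x) :=
    hF.differentiableAt (by simp)
  have hdF : DifferentiableAt ℝ (fderiv ℝ (chartMap (n := n) (d := d) f x)) (ch n x x) :=
    (hF.fderiv_right (m := 1) (WithTop.coe_le_coe.2 le_top)).differentiableAt (by simp)
  have hG : DifferentiableAt ℝ (chartMetric x) (ch n x x) :=
    (contDiffAt_chartMetric x).differentiableAt (by simp)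
  have hg : DifferentiableAt ℝ (fun e ↦ chartMetric (f x) (chartMap (n := n) (d := d) f x e)) (ch n
      x x) := by
    refine DifferentiableAt.comp (g := chartMetric (f x)) (f := chartMap (n := n) (d := d) f x) _
        ?_ hF0
    rw [chartMap_ch f hy.1]
    exact (contDiffAt_chartMetric (f x)).differentiableAt (by simp)
  have hinv : ∀ y ∈ chartDom n d f x, (chartMetric x (ch n x y)).IsInvertible := by
    intro y hy
    refine isInvertible_of_pos fun a ha ↦ ?_
    obtain ⟨u, rfl⟩ : ∃ u : T n y, toModel x y u = a := ⟨_, toModel_ofModel hy.1 a⟩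
    rw [chartMetric_toModel hy.1, real_inner_self_eq_norm_sq]
    have : u ≠ 0 := fun h ↦ ha (by rw [h, map_zero])
    positivity
  have h1 : chartTan n (d := d) f x =ᶠ[𝓝 (ch n x x)] fun e ↦ (chartMetric x e).inverse ∘L
      (chartMetric (f x) (chartMap (n := n) (d := d) f x e)).flip.flip.bilinearComp
        (ContinuousLinearMap.id ℝ (E d)) (fderiv ℝ (chartMap (n := n) (d := d) f x) e) := by
    refine transfer_chartDom hf.smooth x fun y hy ↦ ?_
    ext1 b
    rw [ContinuousLinearMap.comp_apply, ← (hinv y hy).inverse_apply_self (chartTan n (d := d) f x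
        (ch n x y) b)]
    congr 1
    ext1 a
    rw [chartMetric_chartTan hf hy]
    rfl
  refine DifferentiableAt.congr_of_eventuallyEq ?_ h1
  have h2 : DifferentiableAt ℝ (fun e ↦ (chartMetric x e).inverse) (ch n x x) := by
    obtain ⟨L, hL⟩ := hinv x hy
    exact differentiableAt_clmInverse hG hL.symm
  have h3 : ContDiffAt ℝ 1 (fun e ↦ chartMetric (f x) (chartMap (n := n) (d := d) f x e)) (ch n x
      x) := by
    refine ContDiffAt.comp (g := chartMetric (f x)) (f := chartMap (n := n) (d := d) f x) _ ?_
      (hF.of_le (by norm_num))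
    rw [chartMap_ch f hy.1]
    exact (contDiffAt_chartMetric (f x)).of_le (by norm_num)
  have h4 : ContDiffAt ℝ 1 (fderiv ℝ (chartMap (n := n) (d := d) f x)) (ch n x x) :=
    hF.fderiv_right (m := 1) (WithTop.coe_le_coe.2 le_top)
  have h5 : ContDiffAt ℝ 1 (fun e ↦
      (chartMetric (f x) (chartMap (n := n) (d := d) f x e)).flip.flip.bilinearComp
        (ContinuousLinearMap.id ℝ (E d)) (fderiv ℝ (chartMap (n := n) (d := d) f x) e)) (ch n x x)
            := by
    refine contDiffAt_clm_of_apply fun b ↦ contDiffAt_clm_of_apply fun a ↦ ?_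
    exact (h3.clm_apply contDiffAt_const).clm_apply (h4.clm_apply contDiffAt_const)
  exact h2.clm_comp (h5.differentiableAt (by simp))

lemma differentiableAt_inducedChristoffel {x : M} {Γ : E d → E d →L[ℝ] E d →L[ℝ] E d}
    (hΓ : ContDiffAt ℝ 1 Γ (ch d (f x) (f x))) :
    DifferentiableAt ℝ (inducedChristoffel (n := n) (d := d) f Γ x) (ch n x x) := by
  have hy := mem_chartDom_self (n := n) (d := d) (f := f) x
  have hF := contDiffAt_chartMap hf.smooth hy
  have h4 : ContDiffAt ℝ 1 (fderiv ℝ (chartMap (n := n) (d := d) f x)) (ch n x x) :=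
    hF.fderiv_right (m := 1) (WithTop.coe_le_coe.2 le_top)
  have h5 : ContDiffAt ℝ 1 (fderiv ℝ (fderiv ℝ (chartMap (n := n) (d := d) f x))) (ch n x x) :=
    (hF.fderiv_right (m := 2) (WithTop.coe_le_coe.2 le_top)).fderiv_right (m := 1) (by norm_num)
  have h3 : ContDiffAt ℝ 1 (fun e ↦ Γ (chartMap (n := n) (d := d) f x e)) (ch n x x) := by
    refine ContDiffAt.comp (g := Γ) (f := chartMap (n := n) (d := d) f x) _ ?_ (hF.of_le (by
        norm_num))
    rwa [chartMap_ch f hy.1]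
  have h6 : ContDiffAt ℝ 1 (flatHessL (chartMap (n := n) (d := d) f x) Γ) (ch n x x) := by
    refine contDiffAt_clm_of_apply fun b ↦ contDiffAt_clm_of_apply fun a ↦ ?_
    exact ((h5.clm_apply contDiffAt_const).clm_apply contDiffAt_const).add
      ((h3.clm_apply (h4.clm_apply contDiffAt_const)).clm_apply (h4.clm_apply contDiffAt_const))
  have h7 : DifferentiableAt ℝ (fun e ↦ ContinuousLinearMap.compL ℝ (E n) (E d) (E n)
      (chartTan n (d := d) f x e)) (ch n x x) :=
    differentiableAt_compL (differentiableAt_chartTan hf x)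
  exact h7.clm_comp (h6.differentiableAt (by simp))

/-- The Gauss equation. -/
lemma gauss {D : Nabla d N} {x : M} {Γ : E d → E d →L[ℝ] E d →L[ℝ] E d}
    (h : HasChristoffel D (f x) Γ) (hΓ : ContDiffAt ℝ 1 Γ (ch d (f x) (f x)))
    (hm : ∀ (u z : T n x) (b : T d (f x)), (∀ c : T n x, (inner ℝ b (df f x c) : ℝ) = 0) →
      fderiv ℝ (chartMetric (f x)) (ch d (f x) (f x)) (toModel (f x) (f x) (df f x u))
          (toModel (f x) (f x) b) (toModel (f x) (f x) (df f x z))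
        = chartMetric (f x) (ch d (f x) (f x)) (Γ (ch d (f x) (f x))
            (toModel (f x) (f x) (df f x u)) (toModel (f x) (f x) b))
            (toModel (f x) (f x) (df f x z))
          + chartMetric (f x) (ch d (f x) (f x)) (toModel (f x) (f x) b) (Γ (ch d (f x) (f x))
            (toModel (f x) (f x) (df f x u)) (toModel (f x) (f x) (df f x z))))
    (u v w z : T n x) :
    curvature₄ (induced D f) x u v w z
      = curvature₄ D (f x) (df f x u) (df f x v) (df f x w) (df f x z)
        + inner ℝ (secondFF D f x v w) (secondFF D f x u z)
        - inner ℝ (secondFF D f x u w) (secondFF D f x v z) := by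
  have hy := mem_chartDom_self (n := n) (d := d) (f := f) x
  have hF := contDiffAt_chartMap hf.smooth hy
  have hFp := chartMap_ch (d := d) f hy.1
  have hg : DifferentiableAt ℝ (chartMetric (f x)) (chartMap (n := n) (d := d) f x (ch n x x)) := by
    rw [hFp]
    exact (contDiffAt_chartMetric (f x)).differentiableAt (by simp)
  have hΓd : DifferentiableAt ℝ Γ (chartMap (n := n) (d := d) f x (ch n x x)) := by
    rw [hFp]
    exact hΓ.differentiableAt (by simp)
  have hΓ' := differentiableAt_inducedChristoffel hf hΓ
  have hsurj : ∀ a : E n, ∃ u : T n x, toModel x x u = a := fun a ↦ ⟨_, toModel_ofModel hy.1 a⟩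
  have hG := flat_gauss (g := chartMetric (f x)) (Γ := Γ) (Γ' := inducedChristoffel (n := n) (d :=
      d) f Γ x) hg
    (hF.of_le (WithTop.coe_le_coe.2 le_top)) hΓd hΓ' ?_ ?_
    (toModel x x u) (toModel x x v) (toModel x x w) (toModel x x z)
  · have hc1 : ∀ᶠ y in 𝓝 x, HasChristoffelAt (induced D f) x (inducedChristoffel (n := n) (d := d)
        f Γ x) y := by
      filter_upwards [chartDom_mem_nhds hf.smooth hy] with y hy using
        hasChristoffelAt_induced hf h hy
    have hc2 : ∀ᶠ y in 𝓝 (f x), HasChristoffelAt D (f x) Γ y := by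
      filter_upwards [extChartAt_source_mem_nhds (I := 𝓡 d) (f x)] with y hy using h y hy
    have hR1 := toModel_curvature hc1 hΓ'
    have hR2 := toModel_curvature hc2 (hΓ.differentiableAt (by simp))
    have hs := toModel_secondFF hf h
    rw [← hR1, ← toModel_df hf.smooth hy, ← toModel_df hf.smooth hy, ← toModel_df hf.smooth hy,
      ← toModel_df hf.smooth hy, ← toModel_df hf.smooth hy, hFp, ← hR2, ← hs, ← hs, ← hs, ← hs,
      chartMetric_toModel hy.2, chartMetric_toModel hy.2, chartMetric_toModel hy.2,
      chartMetric_toModel hy.2, hf.isometric] at hG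
    exact hG
  -- Normality of the second fundamental form: subtracting the tangential part leaves a vector
  -- orthogonal to the image of dF.
  · refine transfer_chartDom hf.smooth x fun y hy a b c ↦ ?_
    have h1 := chartMetric_chartTan hf hy
      (fderiv ℝ (chartMap (n := n) (d := d) f x) (ch n x y) (inducedChristoffel (n := n) (d := d) f
          Γ x (ch n x y) a b)) c
    rw [chartTan_fderiv hf hy, inducedChristoffel_apply, chartMetric_chartTan hf hy] at h1
    rw [flatFF, map_sub, sub_apply, sub_eq_zero, h1, inducedChristoffel_apply]
  · intro a c b hb
    obtain ⟨u', rfl⟩ := hsurj a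
    obtain ⟨z', rfl⟩ := hsurj c
    obtain ⟨b', rfl⟩ : ∃ b' : T d (f x), toModel (f x) (f x) b' = b :=
      ⟨_, toModel_ofModel hy.2 b⟩
    rw [← toModel_df hf.smooth hy, ← toModel_df hf.smooth hy, hFp]
    refine hm u' z' b' fun c ↦ ?_
    have := hb (toModel x x c)
    rwa [← toModel_df hf.smooth hy, hFp, chartMetric_toModel hy.2] at this

end InducedChart

/-! ### Curvature of the semi-symmetric connection in a chart -/

section FlatSemiSymmetric
variable {F : Type*} [NormedAddCommGroup F] [NormedSpace ℝ F]

/-- The Christoffel symbol of the semi-symmetric connection in a chart. -/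
def semiChristoffel (g : F → F →L[ℝ] F →L[ℝ] ℝ) (Γ : F → F →L[ℝ] F →L[ℝ] F) (P : F → F)
    (lam₁ lam₂ : ℝ) (e : F) : F →L[ℝ] F →L[ℝ] F :=
  Γ e + lam₁ • ContinuousLinearMap.smulRightL ℝ F F (g e (P e))
    - lam₂ • ((ContinuousLinearMap.smulRightL ℝ F F).flip (P e)) ∘L g e

variable {g : F → F →L[ℝ] F →L[ℝ] ℝ} {Γ : F → F →L[ℝ] F →L[ℝ] F} {P : F → F} {lam₁ lam₂ : ℝ} {p : F}

lemma semiChristoffel_apply (e a b : F) : semiChristoffel g Γ P lam₁ lam₂ e a b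
    = Γ e a b + (lam₁ * g e (P e) b) • a - (lam₂ * g e a b) • P e := by
  simp [semiChristoffel, mul_smul]

lemma contDiffAt_semiChristoffel [FiniteDimensional ℝ F] {k : ℕ∞ω} (hg : ContDiffAt ℝ k g p) (hΓ :
    ContDiffAt ℝ k Γ p)
    (hP : ContDiffAt ℝ k P p) : ContDiffAt ℝ k (semiChristoffel g Γ P lam₁ lam₂) p := by
  refine contDiffAt_clm_of_apply₂ fun a b ↦ ?_
  simp only [semiChristoffel_apply]
  refine ((ContDiffAt.clm_apply (hΓ.clm_apply contDiffAt_const) contDiffAt_const).add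
    (ContDiffAt.smul (contDiffAt_const.mul ?_) contDiffAt_const)).sub
    (ContDiffAt.smul (contDiffAt_const.mul ?_) hP)
  · exact (hg.clm_apply hP).clm_apply contDiffAt_const
  · exact (hg.clm_apply contDiffAt_const).clm_apply contDiffAt_const

lemma fderiv_semiChristoffel [FiniteDimensional ℝ F] (hL : IsFlatLC g Γ p) (hP : ContDiffAt ℝ 2 P
    p) (u v w : F) :
    fderiv ℝ (semiChristoffel g Γ P lam₁ lam₂) p u v w
      = fderiv ℝ Γ p u v w
        + (lam₁ * (g p (covVec Γ P p u) w + g p (P p) (Γ p u w))) • v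
        - ((lam₂ * (g p (Γ p u v) w + g p v (Γ p u w))) • P p
          + (lam₂ * g p v w) • (covVec Γ P p u - Γ p u (P p))) := by
  have hg := hL.smooth_g.differentiableAt (by simp)
  have hΓ := hL.smooth_Γ.differentiableAt (by simp)
  have hPd := hP.differentiableAt (by simp)
  have hc : ∀ a : F, DifferentiableAt ℝ (fun _ : F ↦ a) p := fun a ↦ differentiableAt_const a
  have hm := hL.metric.self_of_nhds
  have hcov : ∀ a u : F, covVec Γ (fun _ ↦ a) p u = Γ p u a := fun a u ↦ by simp [covVec_apply]
  have hd : DifferentiableAt ℝ (semiChristoffel g Γ P lam₁ lam₂) p :=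
    (contDiffAt_semiChristoffel hL.smooth_g hL.smooth_Γ hP).differentiableAt (by simp)
  have e1 : fderiv ℝ (semiChristoffel g Γ P lam₁ lam₂) p u v w
      = fderiv ℝ (fun e ↦ semiChristoffel g Γ P lam₁ lam₂ e v w) p u := by
    rw [fderiv_apply₂ hd]
  have hgP : DifferentiableAt ℝ (fun e ↦ g e (P e) w) p := (hg.clm_apply hPd).clm_apply (hc w)
  have hgv : DifferentiableAt ℝ (fun e ↦ g e v w) p := (hg.clm_apply (hc v)).clm_apply (hc w)
  have hΓv : DifferentiableAt ℝ (fun e ↦ Γ e v w) p := (hΓ.clm_apply (hc v)).clm_apply (hc w)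
  have h1 := fderiv_metric hg hm hPd (hc w) u
  have h2 := fderiv_metric hg hm (hc v) (hc w) u
  rw [hcov] at h1
  rw [hcov, hcov] at h2
  have e2 := (hΓv.hasFDerivAt.fun_add ((hgP.hasFDerivAt.const_mul lam₁).smul_const v)).fun_sub
    ((hgv.hasFDerivAt.const_mul lam₂).fun_smul hPd.hasFDerivAt)
  simp only [semiChristoffel_apply] at e1
  rw [e1, e2.fderiv]
  have h3 : fderiv ℝ (fun e ↦ Γ e v w) p u = fderiv ℝ Γ p u v w := fderiv_apply₂ hΓ _ _ _
  have h4 : covVec Γ P p u - Γ p u (P p) = fderiv ℝ P p u := by rw [covVec_apply]; abel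
  simp only [add_apply, sub_apply, smul_apply, ContinuousLinearMap.smulRight_apply, h1, h2, h3, h4,
    smul_eq_mul]
  module

/-- For Γ plus a tensor, the curvature changes by the antisymmetrised covariant derivative of the
tensor and its commutator with itself. The remaining Γ-terms cancel by symmetry of Γ. -/
lemma flatCurv_semiChristoffel [FiniteDimensional ℝ F] (hL : IsFlatLC g Γ p) (hP : ContDiffAt ℝ 2 P
    p) (u v w : F) :
    flatCurv (semiChristoffel g Γ P lam₁ lam₂) p u v w
      = flatCurv Γ p u v w
        + (lam₁ * g p (covVec Γ P p u) w) • v - (lam₁ * g p (covVec Γ P p v) w) • u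
        - ((lam₂ * g p v w) • covVec Γ P p u - (lam₂ * g p u w) • covVec Γ P p v)
        + ((lam₁ * (lam₁ * g p (P p) w * g p (P p) v - lam₂ * g p v w * g p (P p) (P p))) • u
          - (lam₂ * (lam₁ * g p (P p) w * g p u v - lam₂ * g p v w * g p u (P p))) • P p)
        - ((lam₁ * (lam₁ * g p (P p) w * g p (P p) u - lam₂ * g p u w * g p (P p) (P p))) • v
          - (lam₂ * (lam₁ * g p (P p) w * g p v u - lam₂ * g p u w * g p v (P p))) • P p) := by
  rw [flatCurv, flatCurv, fderiv_semiChristoffel hL hP, fderiv_semiChristoffel hL hP,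
    hL.torsion.self_of_nhds v u]
  simp only [semiChristoffel_apply, map_add, map_sub, map_smul]
  rw [hL.torsion.self_of_nhds v u]
  module

end FlatSemiSymmetric

/-! ### Curvature of the semi-symmetric connection -/

section SemiSymmetric
variable {d : ℕ} {N : Type*} [TopologicalSpace N] [ChartedSpace (E d) N] [IsManifold (𝓡 d) ∞ N]
  [RiemannianBundle (fun x : N ↦ TangentSpace (𝓡 d) x)]
  [IsContMDiffRiemannianBundle (𝓡 d) ∞ (E d) (fun x : N ↦ TangentSpace (𝓡 d) x)]
  {cov : Connection d N} {P : Π z : N, T d z} {lam₁ lam₂ : ℝ}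

omit [IsContMDiffRiemannianBundle (𝓡 d) ∞ (E d) (fun x : N ↦ TangentSpace (𝓡 d) x)] in
lemma hasChristoffel_semiSymmetric (cov : Connection d N) (P : Π z : N, T d z) (lam₁ lam₂ : ℝ)
    (x : N) : HasChristoffel (semiSymmetric cov P lam₁ lam₂) x
      (semiChristoffel (chartMetric x) (christoffel cov x) (rep x P) lam₁ lam₂) := by
  intro y hy V hV v
  have h1 := hasChristoffel cov x y hy V hV v
  have h2 : semiSymmetric cov P lam₁ lam₂ V y v = cov.nabla V y v
    + (lam₁ * inner ℝ (P y) (V y)) • v - (lam₂ * inner ℝ v (V y)) • P y := rfl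
  rw [h2, semiChristoffel_apply, rep_apply hy, rep_apply hy, chartMetric_toModel hy,
    chartMetric_toModel hy, map_sub, map_add, map_smul, map_smul, h1, rep_apply hy]
  abel

variable (hP : ContMDiff (𝓡 d) ((𝓡 d).prod 𝓘(ℝ, E d)) ∞
  (fun z ↦ (⟨z, P z⟩ : TotalSpace (E d) (fun z : N ↦ TangentSpace (𝓡 d) z))))
  (hcov : IsLeviCivita cov)
include hP hcov

lemma contDiffAt_semiSymmetric (lam₁ lam₂ : ℝ) (x : N) : ContDiffAt ℝ 1
    (semiChristoffel (chartMetric x) (christoffel cov x) (rep x P) lam₁ lam₂) (ch d x x) :=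
  contDiffAt_semiChristoffel ((contDiffAt_chartMetric x).of_le (WithTop.coe_le_coe.2 le_top))
    ((contDiffAt_christoffel cov hcov.smooth x).of_le (WithTop.coe_le_coe.2 le_top))
    ((contDiffAt_rep' (mem_ch_self x) P (hP x)).of_le (WithTop.coe_le_coe.2 le_top))

lemma nablaPi_eq (x : N) (u v : T d x) : nablaPi cov P x u v = inner ℝ (cov P x u) v := by
  have hPd : VDiffAt P x := (hP x).mdifferentiableAt (by simp)
  have h1 := hcov.metric.mvfderiv_inner_eq (extendField u) hPd (vdiffAt_extendField v)
  simp only [extendField_self] at h1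
  rw [nablaPi, h1]
  ring

/-- The λ-terms are not symmetric in u and v; this asymmetry is what the averaged definition of K
removes. -/
lemma curvature₄_semiSymmetric {x : N} {u v : T d x} (hu : (inner ℝ u u : ℝ) = 1)
    (hv : (inner ℝ v v : ℝ) = 1) (huv : (inner ℝ u v : ℝ) = 0) :
    curvature₄ (semiSymmetric cov P lam₁ lam₂) x u v v u
      = curvature₄ cov.nabla x u v v u - lam₁ * nablaPi cov P x v v - lam₂ * nablaPi cov P x u u
        + lam₁ ^ 2 * inner ℝ (P x) v ^ 2 - lam₁ * lam₂ * inner ℝ (P x) (P x)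
        + lam₂ ^ 2 * inner ℝ (P x) u ^ 2 := by
  have hx := mem_ch_self (d := d) x
  have hL := isFlatLC hcov x
  have hP2 : ContDiffAt ℝ 2 (rep x P) (ch d x x) :=
    (contDiffAt_rep' hx P (hP x)).of_le (WithTop.coe_le_coe.2 le_top)
  have hPd : VDiffAt P x := (hP x).mdifferentiableAt (by simp)
  have hR1 := toModel_curvature (D := semiSymmetric cov P lam₁ lam₂) (x := x)
    (by filter_upwards [extChartAt_source_mem_nhds (I := 𝓡 d) x] with y hy using
        hasChristoffel_semiSymmetric cov P lam₁ lam₂ x y hy)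
    ((contDiffAt_semiSymmetric hP hcov lam₁ lam₂ x).differentiableAt (by simp)) u v v
  have hR2 := toModel_curvature (D := cov.nabla) (x := x)
    (by filter_upwards [extChartAt_source_mem_nhds (I := 𝓡 d) x] with y hy using
        hasChristoffel cov x y hy) (hL.smooth_Γ.differentiableAt (by simp)) u v v
  have hcv : ∀ w : T d x, ChenKappaMu.covVec (christoffel cov x) (rep x P) (ch d x x) (toModel x x
      w)
      = toModel x x (cov P x w) := fun w ↦ ((hasChristoffel cov x).covVec hx hPd w).symm
  rw [curvature₄, curvature₄, ← chartMetric_toModel hx, ← chartMetric_toModel hx, hR1, hR2,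
    flatCurv_semiChristoffel hL hP2, nablaPi_eq hP hcov, nablaPi_eq hP hcov]
  have huv' : (inner ℝ v u : ℝ) = 0 := by rw [real_inner_comm, huv]
  simp only [map_add, map_sub, map_smul, add_apply, sub_apply, smul_apply, smul_eq_mul, hcv,
    rep_apply hx, chartMetric_toModel hx, hu, hv, huv, huv', real_inner_comm (P x) u]
  ring

/-- Skewness in the first pair holds for every connection. It makes K(u ∧ v) the mean of R(u,v,v,u)
and R(v,u,u,v). -/
lemma sectional_semiSymmetric_aux {x : N} (u v : T d x) :
    curvature₄ (semiSymmetric cov P lam₁ lam₂) x u v u v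
      = -curvature₄ (semiSymmetric cov P lam₁ lam₂) x v u u v := by
  have hx := mem_ch_self (d := d) x
  have hR := toModel_curvature (D := semiSymmetric cov P lam₁ lam₂) (x := x)
    (by filter_upwards [extChartAt_source_mem_nhds (I := 𝓡 d) x] with y hy using
        hasChristoffel_semiSymmetric cov P lam₁ lam₂ x y hy)
    ((contDiffAt_semiSymmetric hP hcov lam₁ lam₂ x).differentiableAt (by simp))
  rw [curvature₄, curvature₄, ← chartMetric_toModel hx, ← chartMetric_toModel hx, hR, hR,
    flatCurv_swap, map_neg, neg_apply]

end SemiSymmetric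

/-! ### Sectional curvature of the induced connection -/

section SubmanifoldSemi
variable {n d : ℕ}
  {M : Type*} [TopologicalSpace M] [ChartedSpace (E n) M] [IsManifold (𝓡 n) ∞ M]
  [RiemannianBundle (fun x : M ↦ TangentSpace (𝓡 n) x)]
  {N : Type*} [TopologicalSpace N] [ChartedSpace (E d) N] [IsManifold (𝓡 d) ∞ N]
  [RiemannianBundle (fun x : N ↦ TangentSpace (𝓡 d) x)]
  {f : M → N} (hf : IsIsometricImmersion (n := n) (d := d) f)
include hf

/-- The second fundamental form as a bilinear map. -/
lemma exists_bilin_secondFF {D : Nabla d N} {x : M} {Γ : E d → E d →L[ℝ] E d →L[ℝ] E d}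
    (h : HasChristoffel D (f x) Γ) :
    ∃ B : T n x →ₗ[ℝ] T n x →ₗ[ℝ] T d (f x), ∀ u v, secondFF D f x u v = B u v := by
  have hs := toModel_secondFF hf h
  have hinj : Function.Injective (toModel (d := d) (f x) (f x)) :=
    Function.LeftInverse.injective (ofModel_toModel (mem_ch_self (f x)))
  refine ⟨LinearMap.mk₂ ℝ (secondFF D f x) ?_ ?_ ?_ ?_, fun u v ↦ rfl⟩
  · intro u u' v
    apply hinj
    simp only [map_add, hs, flatFF, flatHess, add_apply]
    abel
  · intro c u v
    apply hinj
    simp only [map_smul, hs, flatFF, flatHess, smul_apply, smul_add, smul_sub]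
  · intro u u' v
    apply hinj
    simp only [map_add, hs, flatFF, flatHess]
    abel
  · intro c u v
    apply hinj
    simp only [map_smul, hs, flatFF, flatHess, smul_add, smul_sub]

lemma secondFF_comm {D : Nabla d N} {x : M} {Γ : E d → E d →L[ℝ] E d →L[ℝ] E d}
    (h : HasChristoffel D (f x) Γ) (ht : ∀ a b, Γ (ch d (f x) (f x)) a b = Γ (ch d (f x) (f x)) b a)
    (u v : T n x) : secondFF D f x u v = secondFF D f x v u := by
  have hy := mem_chartDom_self (n := n) (d := d) (f := f) x
  have hs := toModel_secondFF hf h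
  have hF := contDiffAt_chartMap hf.smooth hy
  have hF2 : ContDiffAt ℝ 2 (chartMap (n := n) (d := d) f x) (ch n x x) :=
    hF.of_le (WithTop.coe_le_coe.2 le_top)
  have hinj : Function.Injective (toModel (d := d) (f x) (f x)) :=
    Function.LeftInverse.injective (ofModel_toModel (mem_ch_self (f x)))
  apply hinj
  have key : ∀ a b, flatHess (chartMap (n := n) (d := d) f x) Γ (ch n x x) a b
      = flatHess (chartMap (n := n) (d := d) f x) Γ (ch n x x) b a := by
    intro a b
    rw [flatHess, flatHess, (hF2.isSymmSndFDerivAt (by simp)).eq a b, chartMap_ch f hy.1, ht]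
  rw [hs, hs, flatFF, flatFF, inducedChristoffel_apply, inducedChristoffel_apply, key]

variable [IsContMDiffRiemannianBundle (𝓡 n) ∞ (E n) (fun x : M ↦ TangentSpace (𝓡 n) x)]
  [IsContMDiffRiemannianBundle (𝓡 d) ∞ (E d) (fun x : N ↦ TangentSpace (𝓡 d) x)]

/-- Gauss equation for both orders of u, v, then averaging: the λ-terms of the ambient curvature
combine into α and β evaluated on u and on v. -/
lemma sectional_induced {cov : Connection d N} {P : Π z : N, T d z} {lam₁ lam₂ : ℝ}
    (hP : ContMDiff (𝓡 d) ((𝓡 d).prod 𝓘(ℝ, E d)) ∞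
      (fun z ↦ (⟨z, P z⟩ : TotalSpace (E d) (fun z : N ↦ TangentSpace (𝓡 d) z))))
    (hcov : IsLeviCivita cov) {x : M} (hPt : ∃ u : T n x, df f x u = P (f x))
    {u v : T n x} (hu : (inner ℝ u u : ℝ) = 1) (hv : (inner ℝ v v : ℝ) = 1)
    (huv : (inner ℝ u v : ℝ) = 0) (K : ℝ)
    (hK1 : curvature₄ cov.nabla (f x) (df f x u) (df f x v) (df f x v) (df f x u) = K)
    (hK2 : curvature₄ cov.nabla (f x) (df f x v) (df f x u) (df f x u) (df f x v) = K) :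
    sectional (induced (semiSymmetric cov P lam₁ lam₂) f) x u v
      = K - (lam₁ + lam₂) / 2 * (alpha cov P lam₁ lam₂ (f x) (df f x u) (df f x u)
          + alpha cov P lam₁ lam₂ (f x) (df f x v) (df f x v))
        - lam₂ * (lam₁ - lam₂) / 2 * (beta P (f x) (df f x u) (df f x u)
          + beta P (f x) (df f x v) (df f x v))
        + (inner ℝ (secondFF cov.nabla f x u u) (secondFF cov.nabla f x v v)
          - inner ℝ (secondFF cov.nabla f x u v) (secondFF cov.nabla f x u v)) := by
  have hx := mem_ch_self (d := d) (f x)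
  have hL := isFlatLC hcov (f x)
  have hG := gauss hf (hasChristoffel_semiSymmetric cov P lam₁ lam₂ (f x))
    (contDiffAt_semiSymmetric hP hcov lam₁ lam₂ (f x)) (by
      -- The terms by which the semi-symmetric connection fails to be metric all contain the product
      -- of the normal b with a or with P, and P is tangent.
      intro a z b hb
      obtain ⟨w, hw⟩ := hPt
      have hPb : (inner ℝ (P (f x)) b : ℝ) = 0 := by rw [← hw, real_inner_comm, hb]
      have hab : (inner ℝ (df f x a) b : ℝ) = 0 := by rw [real_inner_comm, hb]
      have hbP : (inner ℝ b (P (f x)) : ℝ) = 0 := by rw [← hw, hb]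
      rw [hL.metric.self_of_nhds, semiChristoffel_apply, semiChristoffel_apply, rep_apply hx]
      simp only [map_add, map_sub, map_smul, add_apply, sub_apply, smul_apply, smul_eq_mul,
        chartMetric_toModel hx, hPb, hab, hb, hbP]
      ring)
  have hh := hf.secondFF_semiSymmetric cov lam₁ lam₂ hPt
  have hsym := secondFF_comm hf (hasChristoffel cov (f x)) hL.torsion.self_of_nhds
  have hu' : (inner ℝ (df (n := n) (d := d) f x u) (df f x u) : ℝ) = 1 := by rw [hf.isometric, hu]
  have hv' : (inner ℝ (df (n := n) (d := d) f x v) (df f x v) : ℝ) = 1 := by rw [hf.isometric, hv]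
  have huv' : (inner ℝ (df (n := n) (d := d) f x u) (df f x v) : ℝ) = 0 := by
    rw [hf.isometric, huv]
  have hvu' : (inner ℝ (df (n := n) (d := d) f x v) (df f x u) : ℝ) = 0 := by
    rw [real_inner_comm, huv']
  rw [sectional, hG, hG, sectional_semiSymmetric_aux hP hcov,
    curvature₄_semiSymmetric hP hcov hu' hv' huv', curvature₄_semiSymmetric hP hcov hv' hu' hvu',
    hK1, hK2]
  simp only [hh, alpha, beta, hu', hv', hsym v u]
  rw [real_inner_comm (secondFF cov.nabla f x u u)]
  ring

end SubmanifoldSemi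

/-! ### Traces and norms independent of the basis -/

section Traces
variable {V W ι ι' : Type*} [NormedAddCommGroup V] [InnerProductSpace ℝ V] [Fintype ι] [Fintype ι']

/-- Expand the second basis in the first and use Parseval. The index types may differ because the
standard basis is indexed by the rank of the space, not by n. -/
lemma sum_apply_self_eq [AddCommGroup W] [Module ℝ W] (B : V →ₗ[ℝ] V →ₗ[ℝ] W)
    (b : OrthonormalBasis ι ℝ V) (b' : OrthonormalBasis ι' ℝ V) :
    ∑ i, B (b i) (b i) = ∑ j, B (b' j) (b' j) := by
  classical
  have h1 : ∀ j, B (b' j) (b' j)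
      = ∑ i, ∑ k, ((inner ℝ (b i) (b' j) : ℝ) * inner ℝ (b' j) (b k)) • B (b i) (b k) := by
    intro j
    conv_lhs => rw [← b.sum_repr' (b' j)]
    simp only [map_sum, LinearMap.sum_apply, map_smul, LinearMap.smul_apply,
      real_inner_comm (b' j)]
    rw [Finset.sum_comm]
    refine Finset.sum_congr rfl fun i _ ↦ ?_
    rw [Finset.smul_sum]
    refine Finset.sum_congr rfl fun k _ ↦ ?_
    rw [smul_smul, mul_comm]
  simp only [h1]
  rw [Finset.sum_comm]
  refine Finset.sum_congr rfl fun i _ ↦ ?_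
  rw [Finset.sum_comm]
  simp only [← Finset.sum_smul, b'.sum_inner_mul_inner, orthonormal_iff_ite.1 b.orthonormal,
    ite_smul, one_smul, zero_smul]
  simp

variable [NormedAddCommGroup W] [InnerProductSpace ℝ W]

lemma sum_norm_sq_eq (B : V →ₗ[ℝ] V →ₗ[ℝ] W) (b : OrthonormalBasis ι ℝ V)
    (b' : OrthonormalBasis ι' ℝ V) :
    ∑ i, ∑ j, ‖B (b i) (b j)‖ ^ 2 = ∑ i, ∑ j, ‖B (b' i) (b' j)‖ ^ 2 := by
  have h1 : ∀ v : V, ∑ j, ‖B v (b j)‖ ^ 2 = ∑ j, ‖B v (b' j)‖ ^ 2 := by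
    intro v
    have := sum_apply_self_eq ((innerₗ W).compl₁₂ (B v) (B v)) b b'
    simpa [LinearMap.compl₁₂_apply, innerₗ_apply_apply] using this
  have h2 : ∀ v : V, ∑ j, ‖B (b j) v‖ ^ 2 = ∑ j, ‖B (b' j) v‖ ^ 2 := by
    intro v
    have := sum_apply_self_eq ((innerₗ W).compl₁₂ (B.flip v) (B.flip v)) b b'
    simpa [LinearMap.compl₁₂_apply, innerₗ_apply_apply] using this
  rw [Finset.sum_congr rfl fun i _ ↦ h1 (b i), Finset.sum_comm,
    Finset.sum_congr rfl fun j _ ↦ h2 (b' j), Finset.sum_comm]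

/-- Twice this quantity is ‖tr B‖² minus the squared norm of B, and both are independent of the
basis. -/
lemma plane_defect_eq (B : V →ₗ[ℝ] V →ₗ[ℝ] W) (hB : ∀ u v, B u v = B v u)
    (q q' : OrthonormalBasis (Fin 2) ℝ V) :
    (inner ℝ (B (q 0) (q 0)) (B (q 1) (q 1)) : ℝ) - ‖B (q 0) (q 1)‖ ^ 2
      = inner ℝ (B (q' 0) (q' 0)) (B (q' 1) (q' 1)) - ‖B (q' 0) (q' 1)‖ ^ 2 := by
  have h1 := sum_apply_self_eq B q q'
  have h2 := sum_norm_sq_eq B q q'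
  have h3 := congrArg (fun w ↦ ‖w‖ ^ 2) h1
  simp only [Fin.sum_univ_two, norm_add_sq_real, hB (q 1) (q 0), hB (q' 1) (q' 0)] at h2 h3
  linarith

end Traces

/-! ### The defect as a sum of squares -/

section Defect
variable {W : Type*} [NormedAddCommGroup W] [InnerProductSpace ℝ W]

/-- The quantity that measures the failure of equality in Chen's inequality. -/
def chenDefect {n : ℕ} (hn : 3 ≤ n) (B : Fin n → Fin n → W) : ℝ :=
  1 / 2 * (∑ i, ∑ j, ‖B i j‖ ^ 2 - ‖∑ i, B i i‖ ^ 2 / ((n : ℝ) - 1))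
    + (inner ℝ (B (fst hn) (fst hn)) (B (snd hn) (snd hn)) - ‖B (fst hn) (snd hn)‖ ^ 2)

/-- The variance identity for k + 1 vectors with mean m. -/
lemma sum_norm_sub_mean {k : ℕ} (a₀ : W) (a : Fin k → W) {m : W}
    (hm : ((k : ℝ) + 1) • m = a₀ + ∑ i, a i) :
    ‖a₀ - m‖ ^ 2 + ∑ i, ‖a i - m‖ ^ 2
      = ‖a₀‖ ^ 2 + ∑ i, ‖a i‖ ^ 2 - ‖a₀ + ∑ i, a i‖ ^ 2 / ((k : ℝ) + 1) := by
  have hk : (k : ℝ) + 1 ≠ 0 := by positivity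
  have h1 : (inner ℝ (a₀ + ∑ i, a i) m : ℝ) = inner ℝ a₀ m + ∑ i, inner ℝ (a i) m := by
    rw [inner_add_left, sum_inner]
  have h2 : (inner ℝ (((k : ℝ) + 1) • m) m : ℝ) = ((k : ℝ) + 1) * ‖m‖ ^ 2 := by
    rw [inner_smul_left, real_inner_self_eq_norm_sq]; simp
  rw [hm, h1] at h2
  have h3 : ‖a₀ + ∑ i, a i‖ ^ 2 / ((k : ℝ) + 1) = ((k : ℝ) + 1) * ‖m‖ ^ 2 := by
    rw [← hm, norm_smul, Real.norm_of_nonneg (by positivity)]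
    field_simp
  rw [h3]
  simp only [norm_sub_sq_real, Finset.sum_add_distrib, Finset.sum_sub_distrib, ← Finset.mul_sum,
    Finset.sum_const, Finset.card_univ, Fintype.card_fin, nsmul_eq_mul]
  linarith

/-- The plane terms complete ‖B₁₁‖² + ‖B₂₂‖² to ‖B₁₁+B₂₂‖² and cancel the (1,2) entries. What
remains is the squares of the other off-diagonal entries and the variance of B₁₁+B₂₂, B₃₃, …, B_nn;
these are n−1 vectors, which explains the divisor n−1. -/
lemma chenDefect_eq_zero_iff {n : ℕ} (hn : 3 ≤ n) (B : Fin n → Fin n → W)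
    (hB : ∀ i j, B i j = B j i) :
    chenDefect hn B = 0 ↔ (∀ i j, i ≠ j → 2 ≤ j.val → B i j = 0) ∧
      ∀ i, 2 ≤ i.val → B i i = B (fst hn) (fst hn) + B (snd hn) (snd hn) := by
  obtain ⟨k, rfl⟩ : ∃ k, n = k + 2 := ⟨n - 2, by omega⟩
  have e0 : fst hn = (0 : Fin (k + 2)) := rfl
  have e1 : snd hn = (1 : Fin (k + 2)) := rfl
  rw [chenDefect, e0, e1]
  have hk : (k : ℝ) + 1 ≠ 0 := by positivity
  set a₀ := B 0 0 + B 1 1 with ha₀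
  set a : Fin k → W := fun i ↦ B i.succ.succ i.succ.succ with ha
  set m : W := ((k : ℝ) + 1)⁻¹ • (a₀ + ∑ i, a i) with hm
  have hm' : ((k : ℝ) + 1) • m = a₀ + ∑ i, a i := by
    rw [hm, smul_smul, mul_inv_cancel₀ hk, one_smul]
  have key : 1 / 2 * (∑ i, ∑ j, ‖B i j‖ ^ 2 - ‖∑ i, B i i‖ ^ 2 / (((k + 2 : ℕ) : ℝ) - 1))
      + ((inner ℝ (B 0 0) (B 1 1) : ℝ) - ‖B 0 1‖ ^ 2)
      = ∑ j : Fin k, (‖B 0 j.succ.succ‖ ^ 2 + ‖B 1 j.succ.succ‖ ^ 2)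
        + 1 / 2 * ∑ i : Fin k, ∑ j : Fin k, (if i = j then 0 else ‖B i.succ.succ j.succ.succ‖ ^ 2)
        + 1 / 2 * (‖a₀ - m‖ ^ 2 + ∑ i, ‖a i - m‖ ^ 2) := by
    have hs : ∑ i, B i i = a₀ + ∑ i, a i := by
      rw [Fin.sum_univ_succ, Fin.sum_univ_succ, ← add_assoc]
      rfl
    have hk2 : ((k + 2 : ℕ) : ℝ) - 1 = (k : ℝ) + 1 := by push_cast; ring
    have hd : ∀ i : Fin k, ∑ j : Fin k, ‖B i.succ.succ j.succ.succ‖ ^ 2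
        = ∑ j : Fin k, (if i = j then 0 else ‖B i.succ.succ j.succ.succ‖ ^ 2) + ‖a i‖ ^ 2 := by
      intro i
      have : ‖a i‖ ^ 2 = ∑ j : Fin k, (if i = j then ‖B i.succ.succ j.succ.succ‖ ^ 2 else 0) := by
        simp [ha]
      rw [this, ← Finset.sum_add_distrib]
      refine Finset.sum_congr rfl fun j _ ↦ ?_
      split_ifs <;> simp
    have hS : ∑ i, ∑ j, ‖B i j‖ ^ 2 = ‖B 0 0‖ ^ 2 + ‖B 1 1‖ ^ 2 + 2 * ‖B 0 1‖ ^ 2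
        + 2 * ∑ j : Fin k, (‖B 0 j.succ.succ‖ ^ 2 + ‖B 1 j.succ.succ‖ ^ 2)
        + ∑ i : Fin k, ∑ j : Fin k, (if i = j then 0 else ‖B i.succ.succ j.succ.succ‖ ^ 2)
        + ∑ i, ‖a i‖ ^ 2 := by
      have hsum : ∀ g : Fin (k + 2) → ℝ, ∑ i, g i = g 0 + (g 1 + ∑ i : Fin k, g i.succ.succ) :=
        fun g ↦ by rw [Fin.sum_univ_succ, Fin.sum_univ_succ]; rfl
      simp only [hsum]
      simp only [Finset.sum_add_distrib, hd, hB 1 0]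
      simp only [fun i : Fin k ↦ hB i.succ.succ 0, fun i : Fin k ↦ hB i.succ.succ 1]
      ring
    have ha₀' : ‖a₀‖ ^ 2 = ‖B 0 0‖ ^ 2 + 2 * inner ℝ (B 0 0) (B 1 1) + ‖B 1 1‖ ^ 2 := by
      rw [ha₀, norm_add_sq_real]
    rw [sum_norm_sub_mean a₀ a hm', hs, hk2, hS, ha₀']
    generalize ‖a₀ + ∑ i, a i‖ ^ 2 / ((k : ℝ) + 1) = z
    ring
  rw [key]
  have hsucc : ∀ i : Fin (k + 2), 2 ≤ i.val → ∃ j : Fin k, i = j.succ.succ := by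
    intro i hi
    refine ⟨⟨i.val - 2, by omega⟩, Fin.ext ?_⟩
    simp only [Fin.val_succ]; omega
  constructor
  · intro h
    have n1 : 0 ≤ ∑ j : Fin k, (‖B 0 j.succ.succ‖ ^ 2 + ‖B 1 j.succ.succ‖ ^ 2) := by positivity
    have n2' : ∀ i : Fin k, 0 ≤ ∑ j : Fin k,
        (if i = j then 0 else ‖B i.succ.succ j.succ.succ‖ ^ 2) := fun i ↦
      Finset.sum_nonneg fun j _ ↦ by split_ifs <;> positivity
    have n2 := Finset.sum_nonneg fun (i : Fin k) (_ : i ∈ Finset.univ) ↦ n2' i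
    have n3 : 0 ≤ ∑ i, ‖a i - m‖ ^ 2 := by positivity
    have n4 : 0 ≤ ‖a₀ - m‖ ^ 2 := by positivity
    have z1 : ∑ j : Fin k, (‖B 0 j.succ.succ‖ ^ 2 + ‖B 1 j.succ.succ‖ ^ 2) = 0 := by linarith
    have z2 : ∑ i : Fin k, ∑ j : Fin k,
        (if i = j then 0 else ‖B i.succ.succ j.succ.succ‖ ^ 2) = 0 := by linarith
    have z3 : ∑ i, ‖a i - m‖ ^ 2 = 0 := by linarith
    have z4 : ‖a₀ - m‖ ^ 2 = 0 := by linarith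
    rw [Finset.sum_eq_zero_iff_of_nonneg fun _ _ ↦ by positivity] at z1 z3
    rw [Finset.sum_eq_zero_iff_of_nonneg fun i _ ↦ n2' i] at z2
    have w4 : a₀ = m := by simpa [sub_eq_zero] using z4
    have w3 : ∀ i, a i = m := fun i ↦ by simpa [sub_eq_zero] using z3 i (Finset.mem_univ i)
    have w1 : ∀ j : Fin k, B 0 j.succ.succ = 0 ∧ B 1 j.succ.succ = 0 := by
      intro j
      have h0 := z1 j (Finset.mem_univ j)
      constructor
      · have : ‖B 0 j.succ.succ‖ ^ 2 = 0 := by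
          linarith [sq_nonneg ‖B 0 j.succ.succ‖, sq_nonneg ‖B 1 j.succ.succ‖]
        simpa using this
      · have : ‖B 1 j.succ.succ‖ ^ 2 = 0 := by
          linarith [sq_nonneg ‖B 0 j.succ.succ‖, sq_nonneg ‖B 1 j.succ.succ‖]
        simpa using this
    have w2 : ∀ i j : Fin k, i ≠ j → B i.succ.succ j.succ.succ = 0 := by
      intro i j hij
      have h0 := z2 i (Finset.mem_univ i)
      rw [Finset.sum_eq_zero_iff_of_nonneg fun j _ ↦ by split_ifs <;> positivity] at h0
      have := h0 j (Finset.mem_univ j)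
      rw [if_neg hij] at this
      simpa using this
    refine ⟨fun i j hij hj ↦ ?_, fun i hi ↦ ?_⟩
    · obtain ⟨j, rfl⟩ := hsucc j hj
      rcases Nat.lt_or_ge i.val 2 with hi | hi
      · rcases (by omega : i.val = 0 ∨ i.val = 1) with h | h
        · rw [show i = 0 from Fin.ext h]; exact (w1 j).1
        · rw [show i = 1 from Fin.ext h]; exact (w1 j).2
      · obtain ⟨i, rfl⟩ := hsucc i hi
        exact w2 i j fun h ↦ hij (by rw [h])
    · obtain ⟨i, rfl⟩ := hsucc i hi
      exact (w3 i).trans w4.symm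
  · rintro ⟨h1, h2⟩
    have ha' : ∀ i, a i = a₀ := fun i ↦ h2 _ (by simp)
    have hma : m = a₀ := by
      rw [hm]
      simp only [ha', Finset.sum_const, Finset.card_univ, Fintype.card_fin]
      rw [← Nat.cast_smul_eq_nsmul ℝ, inv_smul_eq_iff₀ hk]
      module
    have w1 : ∀ j : Fin k, B 0 j.succ.succ = 0 := fun j ↦
      h1 _ _ (Fin.succ_ne_zero _).symm (by simp)
    have w1' : ∀ j : Fin k, B 1 j.succ.succ = 0 := fun j ↦
      h1 _ _ (fun h ↦ by simpa using congrArg Fin.val h) (by simp)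
    have w2 : ∀ i j : Fin k, (if i = j then 0 else ‖B i.succ.succ j.succ.succ‖ ^ 2) = 0 := by
      intro i j
      split_ifs with h
      · rfl
      · rw [h1 _ _ (fun h' ↦ h (by simpa using h')) (by simp), norm_zero]
        simp
    simp [w1, w1', w2, ha', hma]

end Defect

/-! ### Adapted orthonormal bases -/

section Bases
variable {V : Type*} [NormedAddCommGroup V] [InnerProductSpace ℝ V] [FiniteDimensional ℝ V]

/-- A symmetric bilinear form on a plane is diagonal in some orthonormal basis. -/
lemma exists_orthonormalBasis_diag (B : V →ₗ[ℝ] V →ₗ[ℝ] ℝ) (hB : ∀ u v, B u v = B v u)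
    (hV : Module.finrank ℝ V = 2) :
    ∃ q : OrthonormalBasis (Fin 2) ℝ V, B (q 0) (q 1) = 0 := by
  let b := stdOrthonormalBasis ℝ V
  let A : V →ₗ[ℝ] V := ∑ i, (B (b i)).smulRight (b i)
  have hA : ∀ u v, (inner ℝ (A u) v : ℝ) = B u v := by
    intro u v
    conv_rhs => rw [← b.sum_repr' v]
    simp [A, sum_inner, inner_smul_left, hB u, mul_comm]
  have hs : A.IsSymmetric := fun u v ↦ by rw [hA, real_inner_comm, hA, hB]
  refine ⟨hs.eigenvectorBasis hV, ?_⟩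
  rw [← hA, hs.apply_eigenvectorBasis, inner_smul_left]
  simp [orthonormal_iff_ite.1 (hs.eigenvectorBasis hV).orthonormal]

lemma exists_orthonormalBasis_plane {n : ℕ} (hn : 3 ≤ n) (hV : Module.finrank ℝ V = n)
    {Pl : Submodule ℝ V} (q : OrthonormalBasis (Fin 2) ℝ Pl) :
    ∃ e : OrthonormalBasis (Fin n) ℝ V, e (fst hn) = q 0 ∧ e (snd hn) = q 1 := by
  classical
  let v : Fin n → V := fun i ↦ if i.val = 0 then q 0 else q 1
  have hne : fst hn ≠ snd hn := fun h ↦ by simpa [fst, snd] using congrArg Fin.val h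
  have hq := q.orthonormal.comp_linearIsometry Pl.subtypeₗᵢ
  rw [orthonormal_iff_ite] at hq
  have h0 : v (fst hn) = q 0 := by simp [v, fst]
  have h1 : v (snd hn) = q 1 := by simp [v, snd]
  have hv : Orthonormal ℝ (({fst hn, snd hn} : Set (Fin n)).domRestrict v) := by
    rw [orthonormal_iff_ite]
    have h00 := hq 0 0
    have h01 := hq 0 1
    have h10 := hq 1 0
    have h11 := hq 1 1
    simp only [Function.comp_apply, Submodule.coe_subtypeₗᵢ, Submodule.subtype_apply]
      at h00 h01 h10 h11
    rintro ⟨i, rfl | rfl⟩ ⟨j, rfl | rfl⟩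
    · simpa [Set.domRestrict_apply, h0] using h00
    · rw [if_neg fun h ↦ hne (congrArg Subtype.val h)]
      simpa [Set.domRestrict_apply, h0, h1] using h01
    · rw [if_neg fun h ↦ hne (congrArg Subtype.val h).symm]
      simpa [Set.domRestrict_apply, h0, h1] using h10
    · simpa [Set.domRestrict_apply, h1] using h11
  obtain ⟨e, he⟩ := hv.exists_orthonormalBasis_extension_of_card_eq (by simpa using hV)
  exact ⟨e, (he _ (by simp)).trans h0, (he _ (by simp)).trans h1⟩

lemma span_eq_of_mem {n : ℕ} (hn : 3 ≤ n) {Pl : Submodule ℝ V} (hPl : Module.finrank ℝ Pl = 2)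
    (e : OrthonormalBasis (Fin n) ℝ V) (h0 : e (fst hn) ∈ Pl) (h1 : e (snd hn) ∈ Pl) :
    Submodule.span ℝ {e (fst hn), e (snd hn)} = Pl := by
  have hne : fst hn ≠ snd hn := fun h ↦ by simpa [fst, snd] using congrArg Fin.val h
  refine Submodule.eq_of_le_of_finrank_eq (Submodule.span_le.2 ?_) ?_
  · rintro _ (rfl | rfl)
    · exact h0
    · exact h1
  · have hli : LinearIndependent ℝ ![e (fst hn), e (snd hn)] := by
      have := e.toBasis.linearIndependent.comp ![fst hn, snd hn] (by
        intro i j; fin_cases i <;> fin_cases j <;> simp [hne, hne.symm])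
      have hfun : ![e (fst hn), e (snd hn)] = e.toBasis ∘ ![fst hn, snd hn] := by
        funext i; fin_cases i <;> simp
      rwa [hfun]
    have := finrank_span_eq_card hli
    rw [Matrix.range_cons_cons_empty] at this
    rw [hPl, this]
    simp

lemma exists_orthonormalBasis_of_span {n : ℕ} (hn : 3 ≤ n) {Pl : Submodule ℝ V}
    (e : OrthonormalBasis (Fin n) ℝ V) (h : Submodule.span ℝ {e (fst hn), e (snd hn)} = Pl)
    (hPl : Module.finrank ℝ Pl = 2) :
    ∃ q : OrthonormalBasis (Fin 2) ℝ Pl, (q 0 : V) = e (fst hn) ∧ (q 1 : V) = e (snd hn) := by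
  have hne : fst hn ≠ snd hn := fun h ↦ by simpa [fst, snd] using congrArg Fin.val h
  have h0 : e (fst hn) ∈ Pl := h ▸ Submodule.subset_span (by simp)
  have h1 : e (snd hn) ∈ Pl := h ▸ Submodule.subset_span (by simp)
  have hq : Orthonormal ℝ (![⟨e (fst hn), h0⟩, ⟨e (snd hn), h1⟩] : Fin 2 → Pl) := by
    have hon := orthonormal_iff_ite.1 e.orthonormal
    rw [orthonormal_iff_ite]
    intro i j
    fin_cases i <;> fin_cases j <;> simp [hon, hne, hne.symm]
  have hq' : Orthonormal ℝ ((Set.univ : Set (Fin 2)).domRestrict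
      (![⟨e (fst hn), h0⟩, ⟨e (snd hn), h1⟩] : Fin 2 → Pl)) :=
    hq.comp _ Subtype.val_injective
  obtain ⟨q, hq⟩ := hq'.exists_orthonormalBasis_extension_of_card_eq (by simpa using hPl)
  exact ⟨q, by simp [hq], by simp [hq]⟩

end Bases

/-! ### The equality case as linear algebra -/

section Equality
variable {V W : Type*} [NormedAddCommGroup V] [InnerProductSpace ℝ V] [FiniteDimensional ℝ V]
  [NormedAddCommGroup W] [InnerProductSpace ℝ W] [FiniteDimensional ℝ W]
  {n p : ℕ} {i : V →ₗ[ℝ] W} (hi : ∀ u v, (inner ℝ (i u) (i v) : ℝ) = inner ℝ u v)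
  (hV : Module.finrank ℝ V = n) (hW : Module.finrank ℝ W = n + p)
include hi hV hW

/-- The image of an orthonormal basis of V together with ν is an orthonormal family of n + p
vectors, hence spans W. -/
lemma eq_zero_of_inner_normal {ν : Fin p → W} (hν : Orthonormal ℝ ν)
    (hνi : ∀ r u, (inner ℝ (ν r) (i u) : ℝ) = 0) {w : W} (hw : ∀ u, (inner ℝ w (i u) : ℝ) = 0)
    (hwν : ∀ r, (inner ℝ w (ν r) : ℝ) = 0) : w = 0 := by
  let e := (stdOrthonormalBasis ℝ V).reindex (finCongr hV)
  have hon : Orthonormal ℝ (Sum.elim (fun j ↦ i (e j)) ν) := by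
    have h1 := orthonormal_iff_ite.1 e.orthonormal
    have h2 := orthonormal_iff_ite.1 hν
    rw [orthonormal_iff_ite]
    rintro (j | r) (j' | r')
    · simp [hi, h1]
    · simp [real_inner_comm, hνi]
    · simp [hνi]
    · simp [h2]
  have hcard : Fintype.card (Fin n ⊕ Fin p) = Module.finrank ℝ W := by simp [hW]
  have hspan := hon.linearIndependent.span_eq_top_of_card_eq_finrank' hcard
  refine ext_inner_right ℝ fun z ↦ ?_
  rw [inner_zero_left]
  have hz : z ∈ Submodule.span ℝ (Set.range (Sum.elim (fun j ↦ i (e j)) ν)) := by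
    rw [hspan]; trivial
  induction hz using Submodule.span_induction with
  | mem z hz =>
    obtain ⟨j | r, rfl⟩ := hz
    · exact hw _
    · exact hwν _
  | zero => exact inner_zero_right _
  | add a b _ _ ha hb => rw [inner_add_right, ha, hb, add_zero]
  | smul c a _ ha => rw [inner_smul_right, ha, mul_zero]

omit [FiniteDimensional ℝ V] in
/-- An orthonormal basis of the normal space whose other members are orthogonal to `t`. -/
lemma exists_normal_basis (t : W) (ht : ∀ u, (inner ℝ t (i u) : ℝ) = 0) :
    ∃ ν : Fin p → W, Orthonormal ℝ ν ∧ (∀ r u, (inner ℝ (ν r) (i u) : ℝ) = 0) ∧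
      ∀ r, r.val ≠ 0 → (inner ℝ t (ν r) : ℝ) = 0 := by
  classical
  have hker : LinearMap.ker i = ⊥ := by
    rw [LinearMap.ker_eq_bot']
    intro u hu
    have := hi u u
    rw [hu, inner_zero_left] at this
    exact inner_self_eq_zero.1 this.symm
  have hr : Module.finrank ℝ (LinearMap.range i) = n := by
    rw [LinearMap.finrank_range_of_inj (LinearMap.ker_eq_bot.1 hker), hV]
  have hNp : Module.finrank ℝ (LinearMap.range i)ᗮ = p := by
    have := Submodule.finrank_add_finrank_orthogonal (LinearMap.range i)
    omega
  have hmem : ∀ w : W, w ∈ (LinearMap.range i)ᗮ ↔ ∀ u, (inner ℝ w (i u) : ℝ) = 0 := by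
    intro w
    rw [Submodule.mem_orthogonal']
    exact ⟨fun h u ↦ h _ ⟨u, rfl⟩, by rintro h _ ⟨u, rfl⟩; exact h u⟩
  let t' : (LinearMap.range i)ᗮ := ⟨t, (hmem t).2 ht⟩
  obtain ⟨ν, hν⟩ : ∃ ν : OrthonormalBasis (Fin p) ℝ (LinearMap.range i)ᗮ,
      ∀ r, r.val ≠ 0 → (inner ℝ t' (ν r) : ℝ) = 0 := by
    -- If t is nonzero, its normalisation is the vector with index 0 and is extended to a basis; if
    -- t is zero, any basis works. For p = 0 the set of prescribed vectors is empty.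
    by_cases ht0 : t' = 0
    · exact ⟨(stdOrthonormalBasis ℝ _).reindex (finCongr hNp), fun r _ ↦ by rw [ht0,
          inner_zero_left]⟩
    · have hs : Orthonormal ℝ (({r | r.val = 0} : Set (Fin p)).domRestrict
          fun _ ↦ (‖t'‖⁻¹ : ℝ) • t') := by
        rw [orthonormal_iff_ite]
        rintro ⟨r, hr⟩ ⟨r', hr'⟩
        have : r = r' := Fin.ext (hr.trans hr'.symm)
        subst this
        simp only [Set.domRestrict_apply, if_true, inner_smul_left, inner_smul_right,
          real_inner_self_eq_norm_sq]
        have : ‖t'‖ ≠ 0 := norm_ne_zero_iff.2 ht0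
        simp only [map_inv₀, conj_trivial]
        field_simp
      obtain ⟨ν, hν⟩ := hs.exists_orthonormalBasis_extension_of_card_eq (by simpa using hNp)
      refine ⟨ν, fun r hr ↦ ?_⟩
      let z : Fin p := ⟨0, by have := r.2; omega⟩
      have h1 := hν z rfl
      have h2 : (inner ℝ (ν z) (ν r) : ℝ) = 0 :=
        ν.orthonormal.2 fun h ↦ hr (by rw [← h])
      rw [h1, inner_smul_left] at h2
      have : ‖t'‖ ≠ 0 := norm_ne_zero_iff.2 ht0
      simpa [ht0] using h2
  refine ⟨fun r ↦ ν r, ν.orthonormal.comp_linearIsometry (Submodule.subtypeₗᵢ _), fun r u ↦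
    (hmem _).1 (ν r).2 u, fun r hr ↦ hν r hr⟩

/-- The equality case of Chen's inequality, for a symmetric bilinear map with normal values. -/
theorem chenDefect_equality (hn : 3 ≤ n) (B : V →ₗ[ℝ] V →ₗ[ℝ] W) (hB : ∀ u v, B u v = B v u)
    (hBi : ∀ u v z, (inner ℝ (B u v) (i z) : ℝ) = 0) {Pl : Submodule ℝ V}
    (hPl : Module.finrank ℝ Pl = 2) {ι : Type*} [Fintype ι] (b : OrthonormalBasis ι ℝ V)
    (q : OrthonormalBasis (Fin 2) ℝ Pl) :
    1 / 2 * (∑ j, ∑ k, ‖B (b j) (b k)‖ ^ 2 - ‖∑ j, B (b j) (b j)‖ ^ 2 / ((n : ℝ) - 1))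
        + ((inner ℝ (B (q 0) (q 0)) (B (q 1) (q 1)) : ℝ) - ‖B (q 0) (q 1)‖ ^ 2) = 0 ↔
      ∃ (e : OrthonormalBasis (Fin n) ℝ V) (ν : Fin p → W),
        Orthonormal ℝ ν ∧ (∀ r u, (inner ℝ (ν r) (i u) : ℝ) = 0) ∧
        Submodule.span ℝ {e (fst hn), e (snd hn)} = Pl ∧
        ∀ r : Fin p,
          (r.val = 0 → ∀ j k, (inner ℝ (B (e j) (e k)) (ν r) : ℝ) = diagForm n
              (inner ℝ (B (e (fst hn)) (e (fst hn))) (ν r))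
              (inner ℝ (B (e (snd hn)) (e (snd hn))) (ν r)) j k) ∧
          (r.val ≠ 0 → ∀ j k, (inner ℝ (B (e j) (e k)) (ν r) : ℝ) = blockForm n
              (inner ℝ (B (e (fst hn)) (e (fst hn))) (ν r))
              (inner ℝ (B (e (fst hn)) (e (snd hn))) (ν r)) j k) := by
  -- The defect may be computed in any basis adapted to the plane, which leaves a rotation of Π free
  -- to diagonalise one shape operator.
  have hdef : ∀ (e : OrthonormalBasis (Fin n) ℝ V) (q' : OrthonormalBasis (Fin 2) ℝ Pl),
      (q' 0 : V) = e (fst hn) → (q' 1 : V) = e (snd hn) →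
      1 / 2 * (∑ j, ∑ k, ‖B (b j) (b k)‖ ^ 2 - ‖∑ j, B (b j) (b j)‖ ^ 2 / ((n : ℝ) - 1))
        + ((inner ℝ (B (q 0) (q 0)) (B (q 1) (q 1)) : ℝ) - ‖B (q 0) (q 1)‖ ^ 2)
      = chenDefect hn fun j k ↦ B (e j) (e k) := by
    intro e q' h0 h1
    have := plane_defect_eq (B.domRestrict₁₂ Pl Pl) (fun u v ↦ hB u v) q q'
    simp only [LinearMap.domRestrict₁₂_apply] at this
    rw [chenDefect, this, sum_norm_sq_eq B b e, sum_apply_self_eq B b e, h0, h1]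
  have v0 : (fst hn).val = 0 := rfl
  have v1 : (snd hn).val = 1 := rfl
  constructor
  · intro h
    -- Only the first normal direction may see the trace of B, that is, the mean curvature.
    obtain ⟨ν, hν, hνi, hνt⟩ := exists_normal_basis (p := p) hi hV hW (∑ j, B (b j) (b j))
      (fun u ↦ by rw [sum_inner]; simp [hBi])
    obtain ⟨q', hq'⟩ : ∃ q' : OrthonormalBasis (Fin 2) ℝ Pl, ∀ r : Fin p, r.val = 0 →
        (inner ℝ (B (q' 0) (q' 1)) (ν r) : ℝ) = 0 := by
      by_cases hp : p = 0
      · exact ⟨q, fun r ↦ absurd r.2 (by omega)⟩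
      · let z : Fin p := ⟨0, by omega⟩
        obtain ⟨q', hq'⟩ := exists_orthonormalBasis_diag
          ((B.domRestrict₁₂ Pl Pl).compr₂ (innerₗ W (ν z))) (fun u v ↦ by
            simp only [LinearMap.compr₂_apply, LinearMap.domRestrict₁₂_apply]; rw [hB]) hPl
        refine ⟨q', fun r hr ↦ ?_⟩
        rw [show r = z from Fin.ext hr, real_inner_comm]
        exact hq'
    obtain ⟨e, he0, he1⟩ := exists_orthonormalBasis_plane hn hV q'
    rw [hdef e q' he0.symm he1.symm, chenDefect_eq_zero_iff hn _ fun j k ↦ hB _ _] at h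
    obtain ⟨h1, h2⟩ := h
    refine ⟨e, ν, hν, hνi, span_eq_of_mem hn hPl e (he0 ▸ (q' 0).2) (he1 ▸ (q' 1).2),
      fun r ↦ ⟨fun hr j k ↦ ?_, fun hr j k ↦ ?_⟩⟩
    · have h01 := hq' r hr
      rw [← he0, ← he1] at h01
      rw [diagForm, Matrix.diagonal_apply]
      split_ifs with hjk hj hj
      · subst hjk
        rw [show j = fst hn from Fin.ext hj]
      · subst hjk
        rw [show j = snd hn from Fin.ext hj]
      · subst hjk
        rw [h2 j (by omega), inner_add_left]
      · rcases Nat.lt_or_ge k.val 2 with hk | hk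
        · rcases Nat.lt_or_ge j.val 2 with hj | hj
          · have hjk' : j.val ≠ k.val := fun h ↦ hjk (Fin.ext h)
            rcases (by omega : j.val = 0 ∧ k.val = 1 ∨ j.val = 1 ∧ k.val = 0) with h | h
            · rw [show j = fst hn from Fin.ext h.1, show k = snd hn from Fin.ext h.2, h01]
            · rw [show j = snd hn from Fin.ext h.1, show k = fst hn from Fin.ext h.2, hB, h01]
          · rw [hB, h1 k j (Ne.symm hjk) hj, inner_zero_left]
        · rw [h1 j k hjk hk, inner_zero_left]
    -- Vanishing of the defect makes the trace a nonzero multiple of B₁₁ + B₂₂. The later ν are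
    -- orthogonal to it, so their blocks on Π are trace-free and their remaining diagonal entries
    -- vanish.
    · have htr : ∑ j, B (b j) (b j) = ((n : ℝ) - 1) •
          (B (e (fst hn)) (e (fst hn)) + B (e (snd hn)) (e (snd hn))) := by
        rw [sum_apply_self_eq B b e]
        have : ∀ j, B (e j) (e j) = (B (e (fst hn)) (e (fst hn)) + B (e (snd hn)) (e (snd hn)))
            - ((if j = fst hn then B (e (snd hn)) (e (snd hn)) else 0)
              + (if j = snd hn then B (e (fst hn)) (e (fst hn)) else 0)) := by
          intro j
          have hne : fst hn ≠ snd hn := fun h ↦ by simpa [fst, snd] using congrArg Fin.val h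
          by_cases hj0 : j = fst hn
          · simp [hj0, hne]
          · by_cases hj1 : j = snd hn
            · simp [hj1, hne.symm]
            · rw [if_neg hj0, if_neg hj1, h2 j, add_zero, sub_zero]
              have a0 : j.val ≠ 0 := fun h ↦ hj0 (Fin.ext h)
              have a1 : j.val ≠ 1 := fun h ↦ hj1 (Fin.ext h)
              omega
        rw [Finset.sum_congr rfl fun j _ ↦ this j, Finset.sum_sub_distrib, Finset.sum_add_distrib,
          Finset.sum_add_distrib]
        rw [Fintype.sum_ite_eq' (fst hn) fun _ ↦ B (e (snd hn)) (e (snd hn)),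
          Fintype.sum_ite_eq' (snd hn) fun _ ↦ B (e (fst hn)) (e (fst hn))]
        simp only [Finset.sum_const, Finset.card_univ, Fintype.card_fin, ← Nat.cast_smul_eq_nsmul ℝ]
        module
      have hn1 : (n : ℝ) - 1 ≠ 0 := by
        have : (3 : ℝ) ≤ n := by exact_mod_cast hn
        linarith
      have hz := hνt r hr
      rw [htr, inner_smul_left] at hz
      have hz' : (inner ℝ (B (e (fst hn)) (e (fst hn)) + B (e (snd hn)) (e (snd hn))) (ν r) : ℝ) =
          0 := by
        simpa [hn1] using hz
      have hz2 := hz'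
      rw [inner_add_left] at hz2
      rw [blockForm, Matrix.of_apply]
      split_ifs with c1 c2 c3
      · rw [show j = fst hn from Fin.ext c1.1, show k = fst hn from Fin.ext c1.2]
      · rw [show j = snd hn from Fin.ext c2.1, show k = snd hn from Fin.ext c2.2]
        linarith
      · rcases c3 with h | h
        · rw [show j = fst hn from Fin.ext h.1, show k = snd hn from Fin.ext h.2]
        · rw [show j = snd hn from Fin.ext h.1, show k = fst hn from Fin.ext h.2, hB]
      · rcases eq_or_ne j k with rfl | hjk
        · rw [h2 j (by omega), hz']
        · have hjk' : j.val ≠ k.val := fun h ↦ hjk (Fin.ext h)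
          rcases Nat.lt_or_ge k.val 2 with hk | hk
          · rw [hB, h1 k j (Ne.symm hjk) (by omega), inner_zero_left]
          · rw [h1 j k hjk hk, inner_zero_left]
  · rintro ⟨e, ν, hν, hνi, hspan, hr⟩
    obtain ⟨q', h0, h1⟩ := exists_orthonormalBasis_of_span hn e hspan hPl
    rw [hdef e q' h0 h1, chenDefect_eq_zero_iff hn _ fun j k ↦ hB _ _]
    constructor
    · intro j k hjk hk
      -- The values of B are normal, so they may be tested against the ν alone; for p = 0 this
      -- already forces B = 0.
      refine eq_zero_of_inner_normal hi hV hW hν hνi (hBi _ _) fun r ↦ ?_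
      by_cases h : r.val = 0
      · rw [(hr r).1 h, diagForm, Matrix.diagonal_apply, if_neg hjk]
      · rw [(hr r).2 h, blockForm, Matrix.of_apply, if_neg (by omega), if_neg (by omega),
          if_neg (by omega)]
    · intro j hj
      rw [← sub_eq_zero]
      refine eq_zero_of_inner_normal hi hV hW hν hνi (fun u ↦ ?_) fun r ↦ ?_
      · simp [inner_sub_left, inner_add_left, hBi]
      · rw [inner_sub_left, inner_add_left]
        by_cases h : r.val = 0
        · rw [(hr r).1 h j j, diagForm, Matrix.diagonal_apply, if_pos rfl, if_neg (by omega),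
            if_neg (by omega), sub_self]
        · rw [(hr r).2 h j j, (hr r).2 h (snd hn) (snd hn)]
          simp [blockForm, v1, show j.val ≠ 0 by omega, show j.val ≠ 1 by omega]

end Equality

/-! ### Symmetry of φh' -/

section ContactSymm
variable {d : ℕ} {N : Type*} [TopologicalSpace N] [ChartedSpace (E d) N] [IsManifold (𝓡 d) ∞ N]
  [RiemannianBundle (fun x : N ↦ TangentSpace (𝓡 d) x)]
  [IsContMDiffRiemannianBundle (𝓡 d) ∞ (E d) (fun x : N ↦ TangentSpace (𝓡 d) x)]
  {S : AlmostContactMetric d N} {cov : Connection d N}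

/-- In the chart φh' = −∇ξ − φ, which is self-adjoint by `S_symm`. -/
lemma AlmostContactMetric.IsKappaMuSpaceForm.inner_φ_hTensor_comm {κ μ c : ℝ}
    (hN : S.IsKappaMuSpaceForm cov κ μ c) (hcov : IsLeviCivita cov) (x : N) (u v : T d x) :
    (inner ℝ (S.φ x (S.hTensor x u)) v : ℝ) = inner ℝ (S.φ x (S.hTensor x v)) u := by
  have hf := hN.flatKappaMu hcov x
  have hx := mem_ch_self (d := d) x
  have hφH : ∀ a, chartEnd x S.φ (ch d x x)
      (flatH (christoffel cov x) (chartEnd x S.φ) (rep x S.ξ) (ch d x x) a)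
      = -ChenKappaMu.covVec (christoffel cov x) (rep x S.ξ) (ch d x x) a
        - chartEnd x S.φ (ch d x x) a := by
    intro a
    rw [hf.flatH_eq, map_add, hf.φφ_of_η (hf.ηA a), hf.φφ_of_η (hf.ηφ _), sub_eq_add_neg]
  have h1 := hf.S_symm (toModel x x u) (toModel x x v)
  rw [hf.lc.symm _ (toModel x x u), ← hφH, ← hφH] at h1
  simpa only [← AlmostContactMetric.toModel_hTensor (S := S) hcov hx hf.diff_φ,
    chartEnd_toModel hx, chartMetric_toModel hx] using h1

end ContactSymm

/-! ### Summation over pairs of basis vectors -/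

section Sums
variable {m : ℕ} {W : Type*} [NormedAddCommGroup W] [InnerProductSpace ℝ W]

lemma sum_sum_Ioi_eq (g : Fin m → Fin m → ℝ) (hg : ∀ i j, g i j = g j i) :
    ∑ i, ∑ j ∈ Finset.Ioi i, g i j = 1 / 2 * (∑ i, ∑ j, g i j - ∑ i, g i i) := by
  have h1 : ∀ i, ∑ j ∈ Finset.Ioi i, g i j = ∑ j, if i < j then g i j else 0 := by
    intro i
    rw [← Finset.sum_filter]
    congr 1
    ext j
    simp
  have h2 : ∑ i, ∑ j, (if i < j then g i j else 0) = ∑ i, ∑ j, (if j < i then g i j else 0) := by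
    rw [Finset.sum_comm]
    simp only [hg]
  have h3 : ∀ i, g i i = ∑ j, if i = j then g i j else 0 := fun i ↦ by simp
  have h4 : ∑ i, ∑ j, g i j = ∑ i, ∑ j, (if i < j then g i j else 0)
      + ∑ i, ∑ j, (if j < i then g i j else 0) + ∑ i, g i i := by
    simp only [h3, ← Finset.sum_add_distrib]
    refine Finset.sum_congr rfl fun i _ ↦ Finset.sum_congr rfl fun j _ ↦ ?_
    rcases lt_trichotomy i j with h | h | h
    · simp [h, h.not_gt, h.ne]
    · simp [h]
    · simp [h, h.not_gt, h.ne']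
  simp only [h1]
  linarith

/-- The sum of the sectional curvatures in terms of traces and norms. -/
lemma sum_sectional_eq (x h s : Fin m → Fin m → ℝ) (η α β : Fin m → ℝ) (B : Fin m → Fin m → W)
    (C₁ C₂ C₃ ν L₁ L₂ : ℝ) (hx : ∀ i j, x i j = -x j i) (hh : ∀ i j, h i j = h j i)
    (hs : ∀ i j, s i j = s j i) (hB : ∀ i j, B i j = B j i) :
    ∑ i, ∑ j ∈ Finset.Ioi i, (C₁ + C₂ * x i j ^ 2 - C₃ * (η i ^ 2 + η j ^ 2)
        + 1 / 2 * (h i i * h j j - h i j ^ 2 - s i i * s j j + s i j ^ 2) + h i i + h j j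
        + ν * (η j ^ 2 * h i i + η i ^ 2 * h j j - 2 * η i * η j * h i j)
        - L₁ * (α i + α j) - L₂ * (β i + β j)
        + (inner ℝ (B i i) (B j j) - inner ℝ (B i j) (B i j)))
      = m * (m - 1) / 2 * C₁ + C₂ / 2 * ∑ i, ∑ j, x i j ^ 2 - (m - 1) * C₃ * ∑ i, η i ^ 2
        + 1 / 4 * ((∑ i, h i i) ^ 2 - ∑ i, ∑ j, h i j ^ 2 - (∑ i, s i i) ^ 2
          + ∑ i, ∑ j, s i j ^ 2)
        + (m - 1) * ∑ i, h i i
        + ν * ((∑ i, η i ^ 2) * ∑ i, h i i - ∑ i, ∑ j, η i * η j * h i j)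
        - (m - 1) * L₁ * ∑ i, α i - (m - 1) * L₂ * ∑ i, β i
        + 1 / 2 * (‖∑ i, B i i‖ ^ 2 - ∑ i, ∑ j, ‖B i j‖ ^ 2) := by
  rw [sum_sum_Ioi_eq]
  · have hxx : ∀ i, x i i = 0 := fun i ↦ by linarith [hx i i]
    have e2 : ∑ i, ∑ j, η j ^ 2 * h i i = (∑ i, η i ^ 2) * ∑ i, h i i := by
      rw [Finset.sum_mul_sum, Finset.sum_comm]
    have e4 : ∑ i, ∑ j, (inner ℝ (B i i) (B j j) : ℝ) = ‖∑ i, B i i‖ ^ 2 := by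
      rw [← real_inner_self_eq_norm_sq, sum_inner]
      simp only [inner_sum]
    have e5 : ∑ i, ∑ j, 2 * η i * η j * h i j = 2 * ∑ i, ∑ j, η i * η j * h i j := by
      simp only [Finset.mul_sum, mul_assoc]
    have f2 : ∀ f : Fin m → ℝ, ∑ _i : Fin m, ∑ j : Fin m, f j = m * ∑ i, f i := fun f ↦ by
      simp
    have f4 : ∀ a : ℝ, ∑ _i : Fin m, a = m * a := fun a ↦ by simp
    -- The diagonal terms, to be removed from the full double sum: the quadratic expressions in h, s
    -- and B cancel and only linear terms survive, turning factors m into m − 1.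
    have hd : ∀ i, C₁ + C₂ * x i i ^ 2 - C₃ * (η i ^ 2 + η i ^ 2)
        + 1 / 2 * (h i i * h i i - h i i ^ 2 - s i i * s i i + s i i ^ 2) + h i i + h i i
        + ν * (η i ^ 2 * h i i + η i ^ 2 * h i i - 2 * η i * η i * h i i)
        - L₁ * (α i + α i) - L₂ * (β i + β i)
        + ((inner ℝ (B i i) (B i i) : ℝ) - inner ℝ (B i i) (B i i))
        = C₁ - 2 * C₃ * η i ^ 2 + 2 * h i i - 2 * L₁ * α i - 2 * L₂ * β i := by
      intro i
      rw [hxx]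
      ring
    simp only [hd]
    simp only [Finset.sum_add_distrib, Finset.sum_sub_distrib, ← Finset.mul_sum, f2, f4,
      e2, e4, e5, real_inner_self_eq_norm_sq]
    simp only [← Finset.sum_mul]
    ring
  · intro i j
    rw [hx i j, hh i j, hs i j, hB i j, real_inner_comm (B i i)]
    ring

end Sums

/-! ### The difference of the two sides of Chen's inequality -/

section ChenIdentity
variable {n d : ℕ}
  {M : Type*} [TopologicalSpace M] [ChartedSpace (E n) M] [IsManifold (𝓡 n) ∞ M]
  [RiemannianBundle (fun x : M ↦ TangentSpace (𝓡 n) x)]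
  {N : Type*} [TopologicalSpace N] [ChartedSpace (E d) N] [IsManifold (𝓡 d) ∞ N]
  [RiemannianBundle (fun x : N ↦ TangentSpace (𝓡 d) x)]
  {f : M → N}

omit [IsManifold (𝓡 n) ∞ M] [IsManifold (𝓡 d) ∞ N] in
lemma inner_compress (x : M) (A : T d (f x) → T d (f x)) (u v : T n x) :
    (inner ℝ u (compress f x A v) : ℝ) = inner ℝ (df f x u) (A (df f x v)) := by
  rw [compress, real_inner_comm, inner_tangential, real_inner_comm]

omit [IsManifold (𝓡 d) ∞ N] [RiemannianBundle (fun x : N ↦ TangentSpace (𝓡 d) x)] in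
lemma finrank_tangentSpace (x : N) : Module.finrank ℝ (T d x) = d :=
  finrank_euclideanSpace_fin (𝕜 := ℝ) (n := d)

lemma shapeMatrix_apply {D : Nabla d N} {x : M} {B : T n x →ₗ[ℝ] T n x →ₗ[ℝ] T d (f x)}
    (hB : ∀ u v, secondFF D f x u v = B u v) (e : Fin n → T n x) (ν : T d (f x)) (j k : Fin n) :
    shapeMatrix D f x e ν j k = inner ℝ (B (e k) (e j)) ν := by
  have h1 : ∀ u v : T n x, (inner ℝ v (shapeOperator D f x ν u) : ℝ) = inner ℝ (B u v) ν := by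
    intro u v
    conv_rhs => rw [← (stdOrthonormalBasis ℝ (T n x)).sum_repr' v]
    simp only [shapeOperator, inner_sum, inner_smul_right, map_sum, map_smul, sum_inner,
      inner_smul_left, hB, conj_trivial]
    refine Finset.sum_congr rfl fun i _ ↦ ?_
    rw [real_inner_comm v, mul_comm]
  rw [shapeMatrix, Matrix.of_apply, h1]

variable (hf : IsIsometricImmersion (n := n) (d := d) f)
  [IsContMDiffRiemannianBundle (𝓡 n) ∞ (E n) (fun x : M ↦ TangentSpace (𝓡 n) x)]
  [IsContMDiffRiemannianBundle (𝓡 d) ∞ (E d) (fun x : N ↦ TangentSpace (𝓡 d) x)]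
  {S : AlmostContactMetric d N} {cov : Connection d N} {P : Π z : N, T d z}
  {lam₁ lam₂ κ μ c : ℝ}
include hf

/-- The sectional curvature of the induced connection. -/
lemma sectional_eq (hcov : IsLeviCivita cov) (hN : S.IsKappaMuSpaceForm cov κ μ c)
    (hP : ContMDiff (𝓡 d) ((𝓡 d).prod 𝓘(ℝ, E d)) ∞
      (fun z ↦ (⟨z, P z⟩ : TotalSpace (E d) (fun z : N ↦ TangentSpace (𝓡 d) z))))
    {x : M} (hPt : ∃ u : T n x, df f x u = P (f x)) {u v : T n x} (hu : (inner ℝ u u : ℝ) = 1)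
    (hv : (inner ℝ v v : ℝ) = 1) (huv : (inner ℝ u v : ℝ) = 0) :
    sectional (induced (semiSymmetric cov P lam₁ lam₂) f) x u v
      = (c + 3) / 4 + 3 * (c - 1) / 4 * inner ℝ (df f x u) (S.φ (f x) (df f x v)) ^ 2
        - (c + 3 - 4 * κ) / 4 * (S.η (f x) (df f x u) ^ 2 + S.η (f x) (df f x v) ^ 2)
        + 1 / 2 * (inner ℝ (df f x u) (S.hTensor (f x) (df f x u))
            * inner ℝ (df f x v) (S.hTensor (f x) (df f x v))
          - inner ℝ (df f x u) (S.hTensor (f x) (df f x v)) ^ 2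
          - inner ℝ (df f x u) (S.φ (f x) (S.hTensor (f x) (df f x u)))
            * inner ℝ (df f x v) (S.φ (f x) (S.hTensor (f x) (df f x v)))
          + inner ℝ (df f x u) (S.φ (f x) (S.hTensor (f x) (df f x v))) ^ 2)
        + inner ℝ (df f x u) (S.hTensor (f x) (df f x u))
        + inner ℝ (df f x v) (S.hTensor (f x) (df f x v))
        + (μ - 1) * (S.η (f x) (df f x v) ^ 2 * inner ℝ (df f x u) (S.hTensor (f x) (df f x u))
          + S.η (f x) (df f x u) ^ 2 * inner ℝ (df f x v) (S.hTensor (f x) (df f x v))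
          - 2 * S.η (f x) (df f x u) * S.η (f x) (df f x v)
            * inner ℝ (df f x u) (S.hTensor (f x) (df f x v)))
        - (lam₁ + lam₂) / 2 * (alpha cov P lam₁ lam₂ (f x) (df f x u) (df f x u)
          + alpha cov P lam₁ lam₂ (f x) (df f x v) (df f x v))
        - lam₂ * (lam₁ - lam₂) / 2 * (beta P (f x) (df f x u) (df f x u)
          + beta P (f x) (df f x v) (df f x v))
        + (inner ℝ (secondFF cov.nabla f x u u) (secondFF cov.nabla f x v v)
          - inner ℝ (secondFF cov.nabla f x u v) (secondFF cov.nabla f x u v)) := by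
  have hu' : (inner ℝ (df (n := n) (d := d) f x u) (df f x u) : ℝ) = 1 := by rw [hf.isometric, hu]
  have hv' : (inner ℝ (df (n := n) (d := d) f x v) (df f x v) : ℝ) = 1 := by rw [hf.isometric, hv]
  have huv' : (inner ℝ (df (n := n) (d := d) f x u) (df f x v) : ℝ) = 0 := by
    rw [hf.isometric, huv]
  have hvu' : (inner ℝ (df (n := n) (d := d) f x v) (df f x u) : ℝ) = 0 := by
    rw [real_inner_comm, huv']
  have hh := hN.inner_hTensor_comm hcov (f x)
  have hs := hN.inner_φ_hTensor_comm hcov (f x)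
  have hφ : (inner ℝ (df (n := n) (d := d) f x v) (S.φ (f x) (df f x u)) : ℝ)
      = -inner ℝ (df f x u) (S.φ (f x) (df f x v)) := by
    rw [S.inner_φ, real_inner_comm]
  have h1 := hN.curvature₄_eq hcov (f x) hu' hv' huv'
  have h2 := hN.curvature₄_eq hcov (f x) hv' hu' hvu'
  rw [hφ, hh (df f x v) (df f x u), hs (df f x v) (df f x u)] at h2
  rw [sectional_induced hf hP hcov hPt hu hv huv _ h1 (h2.trans (by ring)),
    hh (df f x u) (df f x v), hs (df f x u) (df f x v)]
  simp only [real_inner_comm (df f x u), real_inner_comm (df f x v)]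

set_option maxHeartbeats 1000000 in
/-- The difference of the two sides of Chen's inequality. -/
lemma chenBound_sub_chenInvariant (hn : 3 ≤ n) (hcov : IsLeviCivita cov)
    (hN : S.IsKappaMuSpaceForm cov κ μ c)
    (hP : ContMDiff (𝓡 d) ((𝓡 d).prod 𝓘(ℝ, E d)) ∞
      (fun z ↦ (⟨z, P z⟩ : TotalSpace (E d) (fun z : N ↦ TangentSpace (𝓡 d) z))))
    {x : M} (hPt : ∃ u : T n x, df f x u = P (f x))
    (Pl : Submodule ℝ (TangentSpace (𝓡 n) x)) (hPl : Module.finrank ℝ Pl = 2)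
    {B : T n x →ₗ[ℝ] T n x →ₗ[ℝ] T d (f x)} (hB : ∀ u v, secondFF cov.nabla f x u v = B u v)
    (hBs : ∀ u v, B u v = B v u) (hBi : ∀ u v z : T n x, (inner ℝ (B u v) (df f x z) : ℝ) = 0) :
    chenBound S cov P lam₁ lam₂ κ μ c f x Pl hPl - chenInvariant cov P lam₁ lam₂ f x Pl hPl
      = 1 / 2 * (∑ j, ∑ k, ‖B (stdOrthonormalBasis ℝ (T n x) j)
            (stdOrthonormalBasis ℝ (T n x) k)‖ ^ 2
          - ‖∑ j, B (stdOrthonormalBasis ℝ (T n x) j) (stdOrthonormalBasis ℝ (T n x) j)‖ ^ 2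
            / ((n : ℝ) - 1))
        + ((inner ℝ (B (planeBasis hPl 0) (planeBasis hPl 0))
            (B (planeBasis hPl 1) (planeBasis hPl 1)) : ℝ)
          - ‖B (planeBasis hPl 0) (planeBasis hPl 1)‖ ^ 2) := by
  have hsec := @sectional_eq n d M _ _ _ _ N _ _ _ _ f hf _ _ S cov P lam₁ lam₂ κ μ c hcov hN hP x
    hPt
  have hhB : ∀ u v, secondFF (semiSymmetric cov P lam₁ lam₂) f x u v = B u v := fun u v ↦ by
    rw [hf.secondFF_semiSymmetric cov lam₁ lam₂ hPt, hB]
  have hh : ∀ u v : T n x, (inner ℝ (df f x u) (S.hTensor (f x) (df f x v)) : ℝ)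
      = inner ℝ (df f x v) (S.hTensor (f x) (df f x u)) := fun u v ↦ by
    rw [real_inner_comm, hN.inner_hTensor_comm hcov, real_inner_comm]
  have hs : ∀ u v : T n x, (inner ℝ (df f x u) (S.φ (f x) (S.hTensor (f x) (df f x v))) : ℝ)
      = inner ℝ (df f x v) (S.φ (f x) (S.hTensor (f x) (df f x u))) := fun u v ↦ by
    rw [real_inner_comm, hN.inner_φ_hTensor_comm hcov, real_inner_comm]
  have hφ : ∀ u v : T n x, (inner ℝ (df f x u) (S.φ (f x) (df f x v)) : ℝ)
      = -inner ℝ (df f x v) (S.φ (f x) (df f x u)) := fun u v ↦ by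
    rw [S.inner_φ, real_inner_comm]
  have hPB : ∀ u v, (inner ℝ (P (f x)) (B u v) : ℝ) = 0 := fun u v ↦ by
    obtain ⟨w, hw⟩ := hPt
    rw [← hw, real_inner_comm, hBi]
  -- The sum formula counts the standard basis by the rank of the tangent space, whereas the bound
  -- is written with n.
  have hfr : ((Module.finrank ℝ (T n x) : ℕ) : ℝ) = n := by rw [finrank_tangentSpace]
  set b := stdOrthonormalBasis ℝ (T n x) with hb
  have hon := orthonormal_iff_ite.1 b.orthonormal
  have hτ : scalarCurvature (induced (semiSymmetric cov P lam₁ lam₂) f) x = _ :=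
    (Finset.sum_congr rfl fun i _ ↦ Finset.sum_congr rfl fun j hj ↦ hsec
      ((hon i i).trans (if_pos rfl)) ((hon j j).trans (if_pos rfl))
      ((hon i j).trans (if_neg (Finset.mem_Ioi.1 hj).ne))).trans
    (sum_sectional_eq (fun i j ↦ inner ℝ (df f x (b i)) (S.φ (f x) (df f x (b j))))
      (fun i j ↦ inner ℝ (df f x (b i)) (S.hTensor (f x) (df f x (b j))))
      (fun i j ↦ inner ℝ (df f x (b i)) (S.φ (f x) (S.hTensor (f x) (df f x (b j)))))
      (fun i ↦ S.η (f x) (df f x (b i)))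
      (fun i ↦ alpha cov P lam₁ lam₂ (f x) (df f x (b i)) (df f x (b i)))
      (fun i ↦ beta P (f x) (df f x (b i)) (df f x (b i)))
      (fun i j ↦ secondFF cov.nabla f x (b i) (b j)) _ _ _ _ _ _
      (fun i j ↦ hφ _ _) (fun i j ↦ hh _ _) (fun i j ↦ hs _ _)
      (fun i j ↦ by rw [hB, hB, hBs]))
  have hq : ∀ i j, (inner ℝ (planeBasis hPl i) (planeBasis hPl j) : ℝ) = if i = j then 1 else 0 :=
    fun i j ↦ orthonormal_iff_ite.1 ((stdOrthonormalBasis ℝ Pl).reindex (finCongr hPl)).orthonormal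
      i j
  have hK := hsec ((hq 0 0).trans (if_pos rfl)) ((hq 1 1).trans (if_pos rfl))
    ((hq 0 1).trans (if_neg (by decide)))
  have hηξ : ∀ u : T n x, (inner ℝ u (tangential (n := n) f x (S.ξ (f x))) : ℝ)
      = S.η (f x) (df f x u) := fun u ↦ by
    rw [real_inner_comm, inner_tangential, real_inner_comm, S.inner_ξ]
  have hξ : ‖tangential (n := n) f x (S.ξ (f x))‖ ^ 2 = ∑ i, S.η (f x) (df f x (b i)) ^ 2 := by
    rw [← real_inner_self_eq_norm_sq, ← b.sum_inner_mul_inner]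
    refine Finset.sum_congr rfl fun i _ ↦ ?_
    rw [real_inner_comm, hηξ, sq]
  have hξh : (inner ℝ (tangential (n := n) f x (S.ξ (f x)))
      (compress f x (S.hTensor (f x)) (tangential (n := n) f x (S.ξ (f x)))) : ℝ)
      = ∑ i, ∑ j, S.η (f x) (df f x (b i)) * S.η (f x) (df f x (b j))
        * inner ℝ (df f x (b i)) (S.hTensor (f x) (df f x (b j))) := by
    rw [← b.sum_inner_mul_inner]
    refine Finset.sum_congr rfl fun i _ ↦ ?_
    rw [inner_compress, hh, ← inner_compress,
      ← b.sum_inner_mul_inner _ (compress f x (S.hTensor (f x)) (b i)), Finset.mul_sum]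
    refine Finset.sum_congr rfl fun j _ ↦ ?_
    rw [inner_compress, real_inner_comm, hηξ, real_inner_comm, hηξ, hh (b j) (b i)]
    ring
  have hH : meanCurvature (n := n) (semiSymmetric cov P lam₁ lam₂) f x
      = (1 / (n : ℝ)) • ∑ i, B (b i) (b i) := by
    simp only [meanCurvature, hhB, hb]
  have hPH : (inner ℝ (P (f x)) (meanCurvature (n := n) (semiSymmetric cov P lam₁ lam₂) f x) : ℝ)
      = 0 := by
    rw [hH, inner_smul_right, inner_sum]
    simp [hPB]
  have hn3 : (3 : ℝ) ≤ n := by exact_mod_cast hn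
  have hn0 : (n : ℝ) ≠ 0 := by linarith
  have hn1 : (n : ℝ) - 1 ≠ 0 := by linarith
  -- Since (n−2)/(n−1) = 1 − 1/(n−1), the mean curvature term splits into the ½‖tr B‖² of the Gauss
  -- equation and the part that stays in the defect.
  have hHn : (n : ℝ) ^ 2 * ((n : ℝ) - 2) / (2 * ((n : ℝ) - 1))
      * ‖meanCurvature (n := n) (semiSymmetric cov P lam₁ lam₂) f x‖ ^ 2
      = 1 / 2 * ‖∑ i, B (b i) (b i)‖ ^ 2 - 1 / 2 * (‖∑ i, B (b i) (b i)‖ ^ 2 / ((n : ℝ) - 1)) := by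
    rw [hH, norm_smul, mul_pow, Real.norm_eq_abs, sq_abs]
    field_simp
    ring
  have hBP : (inner ℝ (B (planeBasis hPl 0) (planeBasis hPl 0)
      + B (planeBasis hPl 1) (planeBasis hPl 1)) (P (f x)) : ℝ) = 0 := by
    rw [inner_add_left, real_inner_comm, hPB, real_inner_comm, hPB, add_zero]
  have hc : ∀ (A : T d (f x) → T d (f x)) (u v : T n x), (inner ℝ (compress f x A u) v : ℝ)
      = inner ℝ (df f x v) (A (df f x u)) := fun A u v ↦ by rw [real_inner_comm, inner_compress]
  have hdet : ∀ F : T n x → T n x → ℝ, detPlane (planeBasis hPl) F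
      = F (planeBasis hPl 0) (planeBasis hPl 0) * F (planeBasis hPl 1) (planeBasis hPl 1)
        - F (planeBasis hPl 0) (planeBasis hPl 1) * F (planeBasis hPl 1) (planeBasis hPl 0) :=
    fun F ↦ by rw [detPlane, Matrix.det_fin_two]; rfl
  simp only [chenBound, chenInvariant]
  rw [hτ, hK, hPH, hHn, hξh, hξ]
  simp only [hdet, hhB, hB, hBP, trOp, trForm, trPlane, normSqOp, inner_compress, hc, ← hb, hfr,
    hh (planeBasis hPl 1) (planeBasis hPl 0), hs (planeBasis hPl 1) (planeBasis hPl 0),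
    hφ (planeBasis hPl 1) (planeBasis hPl 0), real_inner_self_eq_norm_sq (B _ _)]
  ring

end ChenIdentity

end ChenKappaMu

end

/-! ### The corollary -/

open ChenKappaMu in
theorem corollary3p2
    {n m p : ℕ} (hn : 3 ≤ n) (hp : n + p = 2 * m + 1)
    -- the ambient Riemannian manifold `N`, of dimension `2m+1`
    {N : Type*} [TopologicalSpace N] [T2Space N] [ChartedSpace (E (2 * m + 1)) N]
    [IsManifold (𝓡 (2 * m + 1)) ∞ N]
    [RiemannianBundle (fun z : N ↦ TangentSpace (𝓡 (2 * m + 1)) z)]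
    [IsContMDiffRiemannianBundle (𝓡 (2 * m + 1)) ∞ (E (2 * m + 1))
      (fun z : N ↦ TangentSpace (𝓡 (2 * m + 1)) z)]
    -- `N` is a `(κ, μ)`-contact space form `N(c)`
    (S : AlmostContactMetric (2 * m + 1) N)
    (cov : Connection (2 * m + 1) N) (hcov : IsLeviCivita cov)
    (κ μ c : ℝ) (hN : S.IsKappaMuSpaceForm cov κ μ c)
    -- the data of the first generalized semi-symmetric non-metric connection
    (lam₁ lam₂ : ℝ) (P : Π z : N, TangentSpace (𝓡 (2 * m + 1)) z)
    (hP : ContMDiff (𝓡 (2 * m + 1)) ((𝓡 (2 * m + 1)).prod 𝓘(ℝ, E (2 * m + 1))) ∞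
      (fun z ↦ (⟨z, P z⟩ : TotalSpace (E (2 * m + 1))
        (fun z : N ↦ TangentSpace (𝓡 (2 * m + 1)) z))))
    -- the submanifold `M`, of dimension `n`
    {M : Type*} [TopologicalSpace M] [T2Space M] [ChartedSpace (E n) M] [IsManifold (𝓡 n) ∞ M]
    [RiemannianBundle (fun x : M ↦ TangentSpace (𝓡 n) x)]
    [IsContMDiffRiemannianBundle (𝓡 n) ∞ (E n) (fun x : M ↦ TangentSpace (𝓡 n) x)]
    (f : M → N) (hf : IsIsometricImmersion (n := n) (d := 2 * m + 1) f)
    -- `P` is tangent to `M`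
    (hPtan : ∀ x : M, ∃ u : TangentSpace (𝓡 n) x, df f x u = P (f x)) :
    -- `h` is the second fundamental form of `M`
    (∀ (x : M) (u v : TangentSpace (𝓡 n) x),
      secondFF (semiSymmetric cov P lam₁ lam₂) f x u v = secondFF cov.nabla f x u v) ∧
    -- the equality case
    ∀ (x : M) (Pl : Submodule ℝ (TangentSpace (𝓡 n) x)) (hPl : Module.finrank ℝ Pl = 2),
      chenInvariant cov P lam₁ lam₂ f x Pl hPl = chenBound S cov P lam₁ lam₂ κ μ c f x Pl hPl ↔
      ∃ (e : OrthonormalBasis (Fin n) ℝ (TangentSpace (𝓡 n) x))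
        (ν : Fin p → TangentSpace (𝓡 (2 * m + 1)) (f x)),
        Orthonormal ℝ ν ∧ (∀ r (u : TangentSpace (𝓡 n) x), inner ℝ (ν r) (df f x u) = (0 : ℝ)) ∧
        Submodule.span ℝ {e (fst hn), e (snd hn)} = Pl ∧
        ∀ r : Fin p,
          (r.val = 0 →
            shapeMatrix (semiSymmetric cov P lam₁ lam₂) f x e (ν r) = diagForm n
              (coeffFF (semiSymmetric cov P lam₁ lam₂) f x e (ν r) (fst hn) (fst hn))
              (coeffFF (semiSymmetric cov P lam₁ lam₂) f x e (ν r) (snd hn) (snd hn))) ∧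
          (r.val ≠ 0 →
            shapeMatrix (semiSymmetric cov P lam₁ lam₂) f x e (ν r) = blockForm n
              (coeffFF (semiSymmetric cov P lam₁ lam₂) f x e (ν r) (fst hn) (fst hn))
              (coeffFF (semiSymmetric cov P lam₁ lam₂) f x e (ν r) (fst hn) (snd hn))) := by
  refine ⟨fun x u v ↦ hf.secondFF_semiSymmetric cov lam₁ lam₂ (hPtan x) u v, fun x Pl hPl ↦ ?_⟩
  obtain ⟨B, hB⟩ := exists_bilin_secondFF hf (hasChristoffel cov (f x))
  have hBs : ∀ u v, B u v = B v u := fun u v ↦ by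
    rw [← hB, ← hB]
    exact secondFF_comm hf (hasChristoffel cov (f x))
      (isFlatLC hcov (f x)).torsion.self_of_nhds u v
  have hBi : ∀ u v z : T n x, (inner ℝ (B u v) (df f x z) : ℝ) = 0 := fun u v z ↦ by
    rw [← hB]
    exact hf.inner_normal_df x _ z
  have hhB : ∀ u v, secondFF (semiSymmetric cov P lam₁ lam₂) f x u v = B u v := fun u v ↦ by
    rw [hf.secondFF_semiSymmetric cov lam₁ lam₂ (hPtan x), hB]
  have hdiff := chenBound_sub_chenInvariant (lam₁ := lam₁) (lam₂ := lam₂) hf hn hcov hN hP (hPtan x)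
    Pl hPl hB hBs hBi
  have heq := chenDefect_equality (p := p) (i := (df (n := n) (d := 2 * m + 1) f x).toLinearMap)
    (hf.isometric x) (finrank_tangentSpace x) ((finrank_tangentSpace (f x)).trans hp.symm) hn B hBs
    hBi hPl (stdOrthonormalBasis ℝ (T n x))
    ((stdOrthonormalBasis ℝ Pl).reindex (finCongr hPl))
  rw [eq_comm, ← sub_eq_zero, hdiff]
  refine heq.trans (exists_congr fun e ↦ exists_congr fun ν ↦ and_congr_right fun _ ↦
    and_congr_right fun _ ↦ and_congr_right fun _ ↦ forall_congr' fun r ↦ ?_)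
  -- The entry (j, k) of the shape matrix comes out as B(e_k, e_j); symmetry of B restores the order
  -- below.
  simp only [← Matrix.ext_iff, shapeMatrix_apply hhB, coeffFF, hhB]
  refine and_congr (imp_congr_right fun _ ↦ ?_) (imp_congr_right fun _ ↦ ?_)
  · exact forall_congr' fun j ↦ forall_congr' fun k ↦ by rw [hBs]
  · exact forall_congr' fun j ↦ forall_congr' fun k ↦ by rw [hBs]
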